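/- All graphs are finite and simple. For a graph $G$ let $\alpha(G)$ and $\mu(G)$ be the sizes of a maximum independent set and of a maximum matching; $G$ is König–Egerváry if $\alpha(G)+\mu(G)=|V(G)|$, and almost bipartite if it has exactly one odd cycle. For $X\subseteq V(G)$ let $N(X)$ be the set of vertices having a neighbour in $X$, and let $d(G)=\max_{X\subseteq V(G)}(|X|-|N(X)|)$. A critical independent set is an independent set $X$ for which $|X|-|N(X)|$ is maximum among independent sets; $\ker(G)$ is the intersection of all critical independent sets and $\operatorname{corona}(G)$ is the union of all maximum independent sets. Let $D(G)$ be the set of vertices missed by some maximum matching, $A(G)$ the set of vertices outside $D(G)$ that are adjacent to a vertex of $D(G)$, and $C(G)=V(G)\setminus(D(G)\cup A(G))$. For a matching $M$, an $M$-blossom is an odd cycle of length $2j+1$ with $j$ edges in $M$; its base is the vertex of the cycle not covered by those $j$ edges. An $M$-flower consists of an $M$-blossom and an $M$-alternating path of even length (possibly $0$) from the base to a vertex not saturated by $M$, which meets the blossom only in the base. For an odd cycle $C$ of $G$, the reach set $R(C)$ is the union of the vertex sets of all $M$-flowers with blossom $C$, over all maximum matchings $M$ of $G$. A graph is $R$-disjoint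 if it has an odd cycle, $R(C)\neq\emptyset$ for every odd cycle $C$, and $R(C)\cap R(C')=\emptyset$ for all distinct odd cycles $C,C'$. A graph $G$ is a BAB-graph $(B,G_1,\dots,G_k)$ ($k\ge 0$) if it is obtained from the disjoint union of a (possibly empty) bipartite graph $B$ and almost bipartite non-König–Egerváry graphs $G_1,\dots,G_k$, where in each $G_i$ the reach set of its unique odd cycle is $V(G_i)$, by adding edges between different graphs so that every vertex of $B$ incident with an added edge lies in $A(B)\cup C(B)$ and every vertex of $G_i$ incident with an added edge lies in $A(G_i)$. **Theorem.** (i) For every BAB-graph $G=(B,G_1,\dots,G_k)$, $$|\ker(G)|+|\operatorname{corona}(G)|\le 2\alpha(G)+k=d(G)+|V(G)|.$$ (ii) The bound is tight: every $R$-disjoint graph $G$ with exactly $k$ odd cycles is a BAB-graph $(B,G_1,\dots,G_k)$ for suitable $B,G_1,\dots,G_k$ and satisfies $|\ker(G)|+|\operatorname{corona}(G)|=2\alpha(G)+k$; and for every $k\ge1$ there is an $R$-disjoint graph with exactly $k$ odd cycles. -/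

import Mathlib

namespace BABGraph

open SimpleGraph

variable {V : Type*}

/-- The (open) neighbourhood `N(X)` of a set of vertices. -/
def nbhd (G : SimpleGraph V) (X : Set V) : Set V := {v | ∃ u ∈ X, G.Adj u v}

/-- The vertices of `X` that have a neighbour outside `X`. -/
def boundary (G : SimpleGraph V) (X : Set V) : Set V := {v | v ∈ X ∧ ∃ w, w ∉ X ∧ G.Adj v w}

/-! ### Independent sets, critical sets -/

/-- The difference `|X| - |N(X)|` of a set of vertices. -/
noncomputable def diff (G : SimpleGraph V) (X : Set V) : ℤ :=
  (X.ncard : ℤ) - ((nbhd G X).ncard : ℤ)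

/-- The critical difference `d(G)`: the maximum of `|X| - |N(X)|` over all sets of vertices
(for a finite graph this is a maximum of finitely many integers). -/
noncomputable def critDiff (G : SimpleGraph V) : ℤ := ⨆ X : Set V, diff G X

/-- The critical independence difference: the maximum of `|X| - |N(X)|` over all independent
sets. -/
noncomputable def critIndepDiff (G : SimpleGraph V) : ℤ :=
  ⨆ X : {X : Set V // G.IsIndepSet X}, diff G X.1

/-- Critical independent sets. -/
def IsCriticalIndep (G : SimpleGraph V) (X : Set V) : Prop :=
  G.IsIndepSet X ∧ diff G X = critIndepDiff G

/-- `ker(G)`: the intersection of all critical independent sets. -/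
def kernel (G : SimpleGraph V) : Set V := {v | ∀ X, IsCriticalIndep G X → v ∈ X}

/-- `corona(G)`: the union of all maximum independent sets. -/
def corona [Finite V] (G : SimpleGraph V) : Set V :=
  {v | ∃ S : Finset V, G.IsMaximumIndepSet S ∧ v ∈ S}

/-! ### Matchings. A matching is a subgraph whose vertices are exactly the saturated ones. -/

/-- Matchings with the largest number of edges. -/
def IsMaximumMatching (G : SimpleGraph V) (M : G.Subgraph) : Prop :=
  M.IsMatching ∧ ∀ M' : G.Subgraph, M'.IsMatching → M'.edgeSet.ncard ≤ M.edgeSet.ncard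

/-- The matching number `μ(G)`. -/
noncomputable def matchingNum (G : SimpleGraph V) : ℕ :=
  sSup {n | ∃ M : G.Subgraph, M.IsMatching ∧ M.edgeSet.ncard = n}

/-- König–Egerváry graphs: `α(G) + μ(G) = |V(G)|`. -/
def IsKonigEgervary (G : SimpleGraph V) : Prop :=
  G.indepNum + matchingNum G = Nat.card V

/-- The Gallai–Edmonds set `D(G)`: vertices missed by some maximum matching. -/
def geD (G : SimpleGraph V) : Set V := {v | ∃ M, IsMaximumMatching G M ∧ v ∉ M.verts}

/-- The Gallai–Edmonds set `A(G)`: vertices outside `D(G)` adjacent to a vertex of `D(G)`. -/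
def geA (G : SimpleGraph V) : Set V := {v | v ∉ geD G ∧ ∃ u ∈ geD G, G.Adj v u}

/-- The Gallai–Edmonds set `C(G)`: the remaining vertices. -/
def geC (G : SimpleGraph V) : Set V := (geD G ∪ geA G)ᶜ

/-! ### Odd cycles, flowers and reach sets -/

/-- The subgraph `C` is an odd cycle of `G`. -/
def IsOddCycle (G : SimpleGraph V) (C : G.Subgraph) : Prop :=
  ∃ (v : V) (c : G.Walk v v), c.IsCycle ∧ Odd c.length ∧ c.toSubgraph = C

/-- Almost bipartite graphs: exactly one odd cycle. -/
def IsAlmostBipartite (G : SimpleGraph V) : Prop := ∃! C : G.Subgraph, IsOddCycle G C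

/-- A walk is `M`-alternating if exactly one of any two consecutive edges lies in `M`. -/
def IsAltWalk {G : SimpleGraph V} (M : G.Subgraph) {u v : V} (p : G.Walk u v) : Prop :=
  p.edges.IsChain (fun e f => e ∈ M.edgeSet ↔ f ∉ M.edgeSet)

/-- `C` is an `M`-blossom with base `b`: an odd cycle of length `2j + 1` with `j` edges in `M`,
where `b` is the vertex of `C` that is on no edge of `C` in `M`. -/
def IsBlossom {G : SimpleGraph V} (M C : G.Subgraph) (b : V) : Prop :=
  IsOddCycle G C ∧ C.edgeSet.ncard = 2 * (C.edgeSet ∩ M.edgeSet).ncard + 1 ∧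
    b ∈ C.verts ∧ ∀ w, C.Adj b w → ¬ M.Adj b w

/-- `C` and `p` form an `M`-flower: `C` is an `M`-blossom and `p` is an `M`-stem, that is, an
`M`-alternating path of even length from the base to a vertex (the root) not saturated by `M`,
which meets `C` in the base only. -/
def IsFlower {G : SimpleGraph V} (M C : G.Subgraph) {b r : V} (p : G.Walk b r) : Prop :=
  IsBlossom M C b ∧ p.IsPath ∧ IsAltWalk M p ∧ Even p.length ∧ r ∉ M.verts ∧
    ∀ v, v ∈ p.support → v ∈ C.verts → v = b

/-- The reach set `R(C)`: all vertices of `M`-flowers with blossom `C`, over all maximum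
matchings `M`. -/
def reachSet (G : SimpleGraph V) (C : G.Subgraph) : Set V :=
  {v | ∃ (M : G.Subgraph) (b r : V) (p : G.Walk b r),
    IsMaximumMatching G M ∧ IsFlower M C p ∧ (v ∈ C.verts ∨ v ∈ p.support)}

/-- `R`-disjoint graphs: there is an odd cycle, all reach sets of odd cycles are nonempty, and
those of distinct odd cycles are disjoint. -/
def IsRDisjoint (G : SimpleGraph V) : Prop :=
  (∃ C, IsOddCycle G C) ∧
  (∀ C, IsOddCycle G C → (reachSet G C).Nonempty) ∧
  ∀ C C', IsOddCycle G C → IsOddCycle G C' → C ≠ C' → Disjoint (reachSet G C) (reachSet G C')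

/-- The number of odd cycles of `G` (as subgraphs). -/
noncomputable def numOddCycles (G : SimpleGraph V) : ℕ := {C : G.Subgraph | IsOddCycle G C}.ncard

/-! ### BAB-graphs -/

/-- `G = (B, G₁, …, Gₖ)` is a BAB-graph, where `B` is the subgraph induced on `B` and `Gᵢ` the one
induced on `P i`. A graph obtained from the disjoint union of these graphs by adding edges between
different parts is the same as a graph whose vertex set is partitioned into these sets. -/
structure IsBAB (G : SimpleGraph V) {k : ℕ} (B : Set V) (P : Fin k → Set V) : Prop where
  disjoint_base : ∀ i, Disjoint B (P i)
  disjoint_parts : ∀ i j, i ≠ j → Disjoint (P i) (P j)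
  cover : B ∪ (⋃ i, P i) = Set.univ
  bipartite : (G.induce B).IsBipartite
  almostBipartite : ∀ i, IsAlmostBipartite (G.induce (P i))
  not_konigEgervary : ∀ i, ¬ IsKonigEgervary (G.induce (P i))
  reach : ∀ i, ∀ C, IsOddCycle (G.induce (P i)) C → reachSet (G.induce (P i)) C = Set.univ
  boundary_base :
    boundary G B ⊆ Subtype.val '' (geA (G.induce B) ∪ geC (G.induce B))
  boundary_parts : ∀ i, boundary G (P i) ⊆ Subtype.val '' geA (G.induce (P i))

end BABGraph

namespace BABGraph

open SimpleGraph

variable {V : Type*}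

/-! Everything is measured against d(G) + |V(G)|. The function |X| - |N(X)| is supermodular, so
critical independent sets are closed under intersection and ker(G) is itself critical; an exchange
argument puts it inside every maximum independent set. Hence corona(G) avoids N(ker(G)), which gives
|ker| + |corona| ≤ |V| + |ker| - |N(ker)| = |V| + d in every graph, with equality once each vertex
outside N(ker) lies in a maximum independent set.

For a BAB-graph the identity 2α + k = d + |V| is summed over the parts. Both α and d are subadditive
over a vertex partition, and here the sum is attained: optimal sets can be chosen so that no added
edge spoils them (`IsBAB.critDiff_eq`, `IsBAB.glue_indep`). The bipartite base satisfies 2α = d +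
|V| by König's theorem (`bipartite_two_mul_indepNum`). Each part H satisfies 2α + 1 = d + |V|:
contracting its odd cycle C gives a bipartite graph, hence a colouring constant on C and proper
elsewhere, and reachability forces D(H) and A(H) to be the two colour classes, with A(H) matched
into D(H) off the cycle (`IsReachGraph.structure_aux`). So a maximum independent set consists of the
vertices off C with the colour of C and (|C| - 1)/2 vertices of C, or has the same size.

For an R-disjoint graph, a part is grown around each odd cycle along stems as far as possible
(`exists_closed_reachPart`). Parts stay inside the reach sets, so they are disjoint; what is left is
bipartite, and maximality of the parts gives the boundary conditions (`IsRDisjoint.exists_isBAB`).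
Equality (`IsBAB.mem_corona`) uses that all odd cycles lie in the parts. The delicate vertices are
those of A(Gᵢ): a maximum independent set of Gᵢ through such a vertex
(`IsReachGraph.mem_corona_of_odds`) may have neighbours in the base, but these all lie on one side
of a bipartition of B, and B has a maximum independent set that meets this side only in D(B), where
no added edge ends. Disjoint triangles are the examples for every k. -/

lemma nbhd_mono (G : SimpleGraph V) {X Y : Set V} (h : X ⊆ Y) : nbhd G X ⊆ nbhd G Y :=
  fun _ ⟨u, hu, huv⟩ => ⟨u, h hu, huv⟩

lemma nbhd_union (G : SimpleGraph V) (X Y : Set V) : nbhd G (X ∪ Y) = nbhd G X ∪ nbhd G Y := by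
  ext v
  constructor
  · rintro ⟨u, hu | hu, huv⟩
    exacts [Or.inl ⟨u, hu, huv⟩, Or.inr ⟨u, hu, huv⟩]
  · rintro (⟨u, hu, huv⟩ | ⟨u, hu, huv⟩)
    exacts [⟨u, Or.inl hu, huv⟩, ⟨u, Or.inr hu, huv⟩]

/-! ### Critical sets, the kernel and the corona. -/

lemma diff_le_critDiff [Finite V] (G : SimpleGraph V) (X : Set V) : diff G X ≤ critDiff G :=
  le_ciSup (Set.finite_range _).bddAbove X

lemma exists_diff_eq_critDiff [Finite V] (G : SimpleGraph V) : ∃ X, diff G X = critDiff G :=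
  exists_eq_ciSup_of_finite

lemma critDiff_eq [Finite V] (G : SimpleGraph V) {d : ℤ} (h : ∀ X, diff G X ≤ d)
    (h' : ∃ X, d ≤ diff G X) : critDiff G = d := by
  obtain ⟨X, hX⟩ := h'
  exact le_antisymm (ciSup_le h) (hX.trans (diff_le_critDiff G X))

lemma isIndepSet_diff_nbhd (G : SimpleGraph V) (X : Set V) : G.IsIndepSet (X \ nbhd G X) :=
  fun _ hu _ hv _ huv => hv.2 ⟨_, hu.1, huv⟩

/-- Deleting `X ∩ N(X)` from `X` also removes it from the neighbourhood: a neighbour of a vertex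
outside `N(X)` cannot lie in `X`. Thus independent sets suffice to attain `d(G)`. -/
lemma diff_le_diff_sdiff_nbhd [Finite V] (G : SimpleGraph V) (X : Set V) :
    diff G X ≤ diff G (X \ nbhd G X) := by
  have h1 : nbhd G (X \ nbhd G X) ⊆ nbhd G X \ X := by
    rintro v ⟨u, hu, huv⟩
    exact ⟨⟨u, hu.1, huv⟩, fun hv => hu.2 ⟨v, hv, huv.symm⟩⟩
  have h2 := Set.ncard_le_ncard h1
  have h3 := Set.ncard_inter_add_ncard_sdiff_eq_ncard X (nbhd G X)
  have h4 := Set.ncard_inter_add_ncard_sdiff_eq_ncard (nbhd G X) X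
  rw [Set.inter_comm] at h4
  unfold diff
  omega

lemma critIndepDiff_eq [Finite V] (G : SimpleGraph V) : critIndepDiff G = critDiff G := by
  have : Nonempty {X : Set V // G.IsIndepSet X} := ⟨⟨∅, by simp [SimpleGraph.IsIndepSet]⟩⟩
  apply le_antisymm
  · exact ciSup_le fun X => diff_le_critDiff G X.1
  · refine ciSup_le fun X => (diff_le_diff_sdiff_nbhd G X).trans ?_
    exact le_ciSup (f := fun X : {X : Set V // G.IsIndepSet X} => diff G X.1)
      (Set.finite_range _).bddAbove ⟨_, isIndepSet_diff_nbhd G X⟩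

lemma isCriticalIndep_iff [Finite V] (G : SimpleGraph V) (X : Set V) :
    IsCriticalIndep G X ↔ G.IsIndepSet X ∧ diff G X = critDiff G := by
  rw [IsCriticalIndep, critIndepDiff_eq]

lemma exists_isCriticalIndep [Finite V] (G : SimpleGraph V) : ∃ X, IsCriticalIndep G X := by
  obtain ⟨X, hX⟩ := exists_diff_eq_critDiff G
  refine ⟨X \ nbhd G X, (isCriticalIndep_iff G _).2 ⟨isIndepSet_diff_nbhd G X, ?_⟩⟩
  exact le_antisymm (diff_le_critDiff G _) (hX ▸ diff_le_diff_sdiff_nbhd G X)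

lemma diff_add_diff_le [Finite V] (G : SimpleGraph V) (X Y : Set V) :
    diff G X + diff G Y ≤ diff G (X ∪ Y) + diff G (X ∩ Y) := by
  have h1 := Set.ncard_union_add_ncard_inter X Y
  have h2 := Set.ncard_union_add_ncard_inter (nbhd G X) (nbhd G Y)
  have h3 : (nbhd G (X ∩ Y)).ncard ≤ (nbhd G X ∩ nbhd G Y).ncard :=
    Set.ncard_le_ncard (Set.subset_inter (nbhd_mono G Set.inter_subset_left)
      (nbhd_mono G Set.inter_subset_right))
  unfold diff
  rw [nbhd_union]
  omega

/-- By supermodularity the intersection of two critical independent sets is critical, so one of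
minimum size is contained in all others. -/
lemma isCriticalIndep_kernel [Finite V] (G : SimpleGraph V) : IsCriticalIndep G (kernel G) := by
  obtain ⟨X, hX, hmin⟩ := Set.exists_min_image {X | IsCriticalIndep G X} Set.ncard
    (Set.toFinite _) (exists_isCriticalIndep G)
  have key : ∀ Y, IsCriticalIndep G Y → X ⊆ Y := by
    intro Y hY
    have hXY : IsCriticalIndep G (X ∩ Y) := by
      have hX' := (isCriticalIndep_iff G _).1 hX
      have hY' := (isCriticalIndep_iff G _).1 hY
      refine (isCriticalIndep_iff G _).2 ⟨hX'.1.mono Set.inter_subset_left, ?_⟩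
      have h1 := diff_add_diff_le G X Y
      have h2 := diff_le_critDiff G (X ∪ Y)
      have h3 := diff_le_critDiff G (X ∩ Y)
      omega
    have h := Set.eq_of_subset_of_ncard_le Set.inter_subset_left (hmin _ hXY)
    exact Set.inter_eq_left.1 h
  have : kernel G = X := Set.Subset.antisymm (fun v hv => hv X hX) (fun v hv Y hY => key Y hY hv)
  rwa [this]

lemma kernel_subset [Finite V] {G : SimpleGraph V} {X : Set V} (hX : IsCriticalIndep G X) :
    kernel G ⊆ X := fun _ hv => hv X hX

lemma diff_kernel [Finite V] (G : SimpleGraph V) : diff G (kernel G) = critDiff G :=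
  ((isCriticalIndep_iff G _).1 (isCriticalIndep_kernel G)).2

lemma ncard_le_indepNum [Finite V] {G : SimpleGraph V} {S : Set V} (hS : G.IsIndepSet S) :
    S.ncard ≤ G.indepNum := by
  classical
  have := Fintype.ofFinite V
  rw [Set.ncard_eq_toFinset_card']
  exact SimpleGraph.IsIndepSet.card_le_indepNum (by simpa using hS)

lemma exists_indep_ncard_eq [Finite V] (G : SimpleGraph V) :
    ∃ S : Set V, G.IsIndepSet S ∧ S.ncard = G.indepNum := by
  obtain ⟨s, hs⟩ := G.exists_isNIndepSet_indepNum
  exact ⟨s, hs.1, by rw [Set.ncard_coe_finset, hs.2]⟩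

lemma mem_corona_iff [Finite V] (G : SimpleGraph V) (v : V) :
    v ∈ corona G ↔ ∃ S : Set V, G.IsIndepSet S ∧ S.ncard = G.indepNum ∧ v ∈ S := by
  classical
  have := Fintype.ofFinite V
  constructor
  · rintro ⟨S, hS, hv⟩
    exact ⟨S, hS.1, by rw [Set.ncard_coe_finset, maximumIndepSet_card_eq_indepNum S hS], hv⟩
  · rintro ⟨S, hS, hc, hv⟩
    refine ⟨S.toFinset, ⟨by simpa using hS, fun t ht => ?_⟩, by simpa using hv⟩
    rw [← Set.ncard_eq_toFinset_card', hc]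
    exact ht.card_le_indepNum

/-- Exchange: for a critical `X`, the set `(S \ N(X)) ∪ X` is independent, so maximality of `S`
gives `|X \ S| ≤ |N(X) ∩ S|`. Since `N(X ∩ S)` misses `S`, the set `X ∩ S` is critical as well. -/
lemma kernel_subset_of_maximum [Finite V] {G : SimpleGraph V} {S : Set V} (hS : G.IsIndepSet S)
    (hc : S.ncard = G.indepNum) : kernel G ⊆ S := by
  obtain ⟨X, hX⟩ := exists_isCriticalIndep G
  have hX' := (isCriticalIndep_iff G _).1 hX
  have hT : G.IsIndepSet ((S \ nbhd G X) ∪ X) := by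
    intro u hu v hv huv hadj
    rcases hu with hu | hu <;> rcases hv with hv | hv
    · exact hS hu.1 hv.1 huv hadj
    · exact hu.2 ⟨v, hv, hadj.symm⟩
    · exact hv.2 ⟨u, hu, hadj⟩
    · exact hX.1 hu hv huv hadj
  have h1 := ncard_le_indepNum hT
  have h2 : nbhd G (X ∩ S) ⊆ nbhd G X \ S := by
    rintro v ⟨u, hu, huv⟩
    exact ⟨⟨u, hu.1, huv⟩, fun hv => hS hu.2 hv huv.ne huv⟩
  have h3 := Set.ncard_le_ncard h2
  have h4 := Set.ncard_inter_add_ncard_sdiff_eq_ncard X S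
  have h5 := Set.ncard_inter_add_ncard_sdiff_eq_ncard (nbhd G X) S
  have h6 := Set.ncard_inter_add_ncard_sdiff_eq_ncard S (nbhd G X)
  have h7 : ((S \ nbhd G X) ∪ X).ncard = (S \ nbhd G X).ncard + (X \ S).ncard := by
    rw [← Set.ncard_union_eq]
    · congr 1
      ext v
      have : v ∈ X → v ∈ S → v ∉ nbhd G X := fun hv _ ⟨u, hu, huv⟩ => hX.1 hu hv huv.ne huv
      simp only [Set.mem_union, Set.mem_sdiff]
      tauto
    · exact Set.disjoint_left.2 fun v hv hv' => hv'.2 hv.1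
  rw [Set.inter_comm] at h6
  have h8 : IsCriticalIndep G (X ∩ S) := by
    refine (isCriticalIndep_iff G _).2 ⟨hX.1.mono Set.inter_subset_left, ?_⟩
    have h9 := diff_le_critDiff G (X ∩ S)
    have h10 := hX'.2
    unfold diff at *
    omega
  exact (kernel_subset h8).trans Set.inter_subset_right

lemma ncard_add_ncard_nbhd_le [Finite V] (G : SimpleGraph V) :
    (corona G).ncard + (nbhd G (kernel G)).ncard ≤ Nat.card V := by
  rw [← Set.ncard_univ, ← Set.ncard_union_eq]
  · exact Set.ncard_le_ncard (Set.subset_univ _)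
  · refine Set.disjoint_left.2 fun v hv ⟨u, hu, huv⟩ => ?_
    obtain ⟨S, hS, hc, hvS⟩ := (mem_corona_iff G v).1 hv
    exact hS (kernel_subset_of_maximum hS hc hu) hvS huv.ne huv

/-- `|ker(G)| + |corona(G)| ≤ d(G) + |V(G)|` holds in every graph. -/
lemma ncard_kernel_add_ncard_corona_le [Finite V] (G : SimpleGraph V) :
    ((kernel G).ncard + (corona G).ncard : ℤ) ≤ critDiff G + Nat.card V := by
  have h1 := ncard_add_ncard_nbhd_le G
  have h2 := diff_kernel G
  unfold diff at h2
  omega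

/-- Reduces tightness to covering the complement of `N(ker)` by maximum independent sets. -/
lemma le_ncard_kernel_add_ncard_corona [Finite V] (G : SimpleGraph V)
    (h : ∀ v, v ∉ nbhd G (kernel G) → v ∈ corona G) :
    critDiff G + Nat.card V ≤ ((kernel G).ncard + (corona G).ncard : ℤ) := by
  have h1 : (nbhd G (kernel G))ᶜ.ncard ≤ (corona G).ncard := Set.ncard_le_ncard h
  have h2 := diff_kernel G
  have h3 := Set.ncard_add_ncard_compl (nbhd G (kernel G))
  unfold diff at h2
  omega

/-! ### Maximum matchings through involutions, and the counting bounds they give. -/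

/-- Matchings as involutions: unsaturated vertices are the fixed points. -/
def IsMat (G : SimpleGraph V) (f : V → V) : Prop :=
  (∀ v, f (f v) = v) ∧ ∀ v, f v ≠ v → G.Adj v (f v)

/-- The vertices saturated by an involution. -/
def supp (f : V → V) : Set V := {v | f v ≠ v}

/-- Involutions that represent maximum matchings. -/
def IsMaxMat (G : SimpleGraph V) (f : V → V) : Prop :=
  IsMat G f ∧ ∀ g, IsMat G g → (supp g).ncard ≤ (supp f).ncard

/-- The involution `f` represents the subgraph `M`. -/
def Rep {G : SimpleGraph V} (M : G.Subgraph) (f : V → V) : Prop :=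
  M.verts = supp f ∧ ∀ u v, M.Adj u v ↔ f u = v ∧ u ≠ v

lemma IsMat.inj {G : SimpleGraph V} {f : V → V} (hf : IsMat G f) : Function.Injective f :=
  fun a b h => by rw [← hf.1 a, h, hf.1 b]

lemma IsMat.eq_comm {G : SimpleGraph V} {f : V → V} (hf : IsMat G f) {a b : V} (h : f a = b) :
    f b = a := by rw [← h, hf.1]

lemma IsMat.mem_supp {G : SimpleGraph V} {f : V → V} (hf : IsMat G f) {a : V} (h : a ∈ supp f) :
    f a ∈ supp f := fun h' => h (hf.inj h')

lemma IsMat.id (G : SimpleGraph V) : IsMat G id := ⟨fun _ => rfl, fun _ h => absurd rfl h⟩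

/-- The subgraph of an involution. -/
def matSubgraph (G : SimpleGraph V) {f : V → V} (hf : IsMat G f) : G.Subgraph where
  verts := supp f
  Adj u v := f u = v ∧ u ≠ v
  adj_sub := by
    rintro u _ ⟨rfl, h⟩
    exact hf.2 u (Ne.symm h)
  edge_vert := by
    rintro u _ ⟨rfl, h⟩
    exact Ne.symm h
  symm := ⟨by
    rintro u _ ⟨rfl, h⟩
    exact ⟨hf.1 u, Ne.symm h⟩⟩

lemma rep_matSubgraph {G : SimpleGraph V} {f : V → V} (hf : IsMat G f) : Rep (matSubgraph G hf) f :=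
  ⟨rfl, fun _ _ => Iff.rfl⟩

lemma Rep.isMatching {G : SimpleGraph V} {M : G.Subgraph} {f : V → V} (h : Rep M f) :
    M.IsMatching := by
  intro v hv
  rw [h.1] at hv
  exact ⟨f v, (h.2 _ _).2 ⟨rfl, Ne.symm hv⟩, fun w hw => ((h.2 _ _).1 hw).1.symm⟩

lemma exists_rep {G : SimpleGraph V} {M : G.Subgraph} (hM : M.IsMatching) :
    ∃ f, IsMat G f ∧ Rep M f := by
  classical
  have h : ∀ v : V, ∃ w, (v ∈ M.verts → M.Adj v w) ∧ (v ∉ M.verts → w = v) := by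
    intro v
    by_cases hv : v ∈ M.verts
    · obtain ⟨w, hw, -⟩ := hM hv
      exact ⟨w, fun _ => hw, fun h => absurd hv h⟩
    · exact ⟨v, fun h => absurd h hv, fun _ => rfl⟩
  choose f hf hf' using h
  have huniq : ∀ u v, M.Adj u v → f u = v := by
    intro u v huv
    obtain ⟨w, -, hw⟩ := hM (M.edge_vert huv)
    rw [hw v huv, hw (f u) (hf u (M.edge_vert huv))]
  have hsupp : M.verts = supp f := by
    ext v
    constructor
    · intro hv h
      have := (hf v hv).ne
      exact this h.symm
    · intro hv
      by_contra h
      exact hv (hf' v h)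
  refine ⟨f, ⟨fun v => ?_, fun v hv => ?_⟩, hsupp, fun u v => ⟨fun h => ⟨huniq u v h, h.ne⟩, ?_⟩⟩
  · by_cases hv : v ∈ M.verts
    · exact huniq _ _ (hf v hv).symm
    · rw [hf' v hv, hf' v hv]
  · have : v ∈ M.verts := by rw [hsupp]; exact hv
    exact (hf v this).adj_sub
  · rintro ⟨rfl, h⟩
    have : u ∈ M.verts := by rw [hsupp]; exact Ne.symm h
    exact hf u this

lemma two_mul_edgeSet_ncard [Finite V] {G : SimpleGraph V} {M : G.Subgraph} (hM : M.IsMatching) :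
    2 * M.edgeSet.ncard = M.verts.ncard := by
  classical
  have := Fintype.ofFinite V
  have h := M.coe.sum_degrees_eq_twice_card_edges
  rw [Subgraph.isMatching_iff_forall_degree] at hM
  have hd : ∀ x : M.verts, M.coe.degree x = 1 := fun x => by
    rw [Subgraph.coe_degree]
    convert hM _ x.2
  replace h := h.symm.trans (Finset.sum_congr rfl fun x _ => by convert hd x)
  rw [Finset.sum_const, smul_eq_mul, mul_one, Finset.card_univ] at h
  rw [← Nat.card_coe_set_eq, ← Nat.card_coe_set_eq, Nat.card_eq_fintype_card (α := M.verts), ← h,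
    ← SimpleGraph.card_edgeSet, ← Nat.card_eq_fintype_card, ← Subgraph.image_coe_edgeSet_coe,
    Nat.card_image_of_injective]
  exact Sym2.map.injective Subtype.val_injective

lemma Rep.two_mul_ncard [Finite V] {G : SimpleGraph V} {M : G.Subgraph} {f : V → V} (h : Rep M f) :
    2 * M.edgeSet.ncard = (supp f).ncard := by
  rw [two_mul_edgeSet_ncard h.isMatching, h.1]

lemma Rep.isMaximumMatching_iff [Finite V] {G : SimpleGraph V} {M : G.Subgraph} {f : V → V}
    (h : Rep M f) (hf : IsMat G f) : IsMaximumMatching G M ↔ IsMaxMat G f := by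
  constructor
  · refine fun hM => ⟨hf, fun g hg => ?_⟩
    have h1 := hM.2 _ (rep_matSubgraph hg).isMatching
    have h2 := h.two_mul_ncard
    have h3 := (rep_matSubgraph hg).two_mul_ncard
    omega
  · refine fun hM => ⟨h.isMatching, fun M' hM' => ?_⟩
    obtain ⟨g, hg, hr⟩ := exists_rep hM'
    have h1 := hM.2 _ hg
    have h2 := h.two_mul_ncard
    have h3 := hr.two_mul_ncard
    omega

lemma exists_isMaxMat [Finite V] (G : SimpleGraph V) : ∃ f, IsMaxMat G f := by
  obtain ⟨f, hf, hmax⟩ := Set.exists_max_image {f : V → V | IsMat G f} (fun f => (supp f).ncard)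
    (Set.toFinite _) ⟨_, IsMat.id G⟩
  exact ⟨f, hf, hmax⟩

lemma mem_geD_iff [Finite V] (G : SimpleGraph V) (v : V) :
    v ∈ geD G ↔ ∃ f, IsMaxMat G f ∧ f v = v := by
  constructor
  · rintro ⟨M, hM, hv⟩
    obtain ⟨f, hf, hr⟩ := exists_rep hM.1
    refine ⟨f, (hr.isMaximumMatching_iff hf).1 hM, ?_⟩
    rw [hr.1] at hv
    exact not_not.1 hv
  · rintro ⟨f, hf, hv⟩
    exact ⟨_, ((rep_matSubgraph hf.1).isMaximumMatching_iff hf.1).2 hf, not_not.2 hv⟩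

lemma two_mul_matchingNum [Finite V] {G : SimpleGraph V} {f : V → V} (hf : IsMaxMat G f) :
    2 * matchingNum G = (supp f).ncard := by
  have hr := rep_matSubgraph hf.1
  have hM := (hr.isMaximumMatching_iff hf.1).2 hf
  have : matchingNum G = (matSubgraph G hf.1).edgeSet.ncard := by
    apply le_antisymm
    · refine csSup_le ⟨_, _, hM.1, rfl⟩ ?_
      rintro n ⟨M', hM', rfl⟩
      exact hM.2 M' hM'
    · refine le_csSup ⟨(matSubgraph G hf.1).edgeSet.ncard, ?_⟩ ⟨_, hM.1, rfl⟩
      rintro n ⟨M', hM', rfl⟩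
      exact hM.2 M' hM'
  rw [this, hr.two_mul_ncard]

lemma even_ncard_supp [Finite V] {G : SimpleGraph V} {f : V → V} (hf : IsMat G f) :
    Even (supp f).ncard := ⟨_, by rw [← two_mul]; exact (rep_matSubgraph hf).two_mul_ncard.symm⟩

lemma IsMaxMat.ncard_eq [Finite V] {G : SimpleGraph V} {f g : V → V} (hf : IsMaxMat G f)
    (hg : IsMaxMat G g) : (supp f).ncard = (supp g).ncard :=
  le_antisymm (hg.2 _ hf.1) (hf.2 _ hg.1)

lemma IsMaxMat.of_ncard_le {G : SimpleGraph V} {f g : V → V} (hf : IsMaxMat G f)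
    (hg : IsMat G g) (h : (supp f).ncard ≤ (supp g).ncard) : IsMaxMat G g :=
  ⟨hg, fun k hk => (hf.2 k hk).trans h⟩

lemma ncard_supp_add_compl [Finite V] (f : V → V) :
    (supp f).ncard + {v | f v = v}.ncard = Nat.card V := by
  have := Set.ncard_add_ncard_compl (supp f)
  have h : (supp f)ᶜ = {v | f v = v} := by ext; simp [supp]
  rwa [h] at this

/-- The partners of the saturated vertices of `S` lie outside `S`. -/
lemma IsMat.two_mul_ncard_indep_le [Finite V] {G : SimpleGraph V} {f : V → V} (hf : IsMat G f)
    {S : Set V} (hS : G.IsIndepSet S) : 2 * S.ncard + (supp f).ncard ≤ 2 * Nat.card V := by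
  have h1 : (S ∩ supp f).ncard ≤ (supp f \ S).ncard := by
    refine Set.ncard_le_ncard_of_injOn f ?_ hf.inj.injOn
    rintro v ⟨hv, hv'⟩
    exact ⟨hf.mem_supp hv', fun h => hS hv h (Ne.symm hv') (hf.2 v hv')⟩
  have h2 := Set.ncard_inter_add_ncard_sdiff_eq_ncard S (supp f)
  have h3 := Set.ncard_inter_add_ncard_sdiff_eq_ncard (supp f) S
  have h4 : (S \ supp f).ncard ≤ {v | f v = v}.ncard :=
    Set.ncard_le_ncard fun v hv => not_not.1 hv.2
  have h5 := ncard_supp_add_compl f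
  rw [Set.inter_comm] at h3
  omega

/-- Partners of saturated vertices of `X` are distinct elements of `N(X)`, so only unsaturated
vertices contribute to the difference. -/
lemma IsMat.diff_le [Finite V] {G : SimpleGraph V} {f : V → V} (hf : IsMat G f) (X : Set V) :
    diff G X + (supp f).ncard ≤ Nat.card V := by
  have h1 : (X ∩ supp f).ncard ≤ (nbhd G X).ncard := by
    refine Set.ncard_le_ncard_of_injOn f ?_ hf.inj.injOn
    rintro v ⟨hv, hv'⟩
    exact ⟨v, hv, hf.2 v hv'⟩
  have h2 := Set.ncard_inter_add_ncard_sdiff_eq_ncard X (supp f)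
  have h4 : (X \ supp f).ncard ≤ {v | f v = v}.ncard :=
    Set.ncard_le_ncard fun v hv => not_not.1 hv.2
  have h5 := ncard_supp_add_compl f
  unfold diff
  omega

/-! ### Exchanging a matching edge, augmenting, gluing -/

open Classical in
/-- For `e` unsaturated and `x` the partner of `u`, exchange the edge `ux` for `ue`. -/
noncomputable def exch (f : V → V) (e x : V) : V → V :=
  fun v => Equiv.swap e x (f (Equiv.swap e x v))

section exch

variable {G : SimpleGraph V} {f : V → V} {e u x : V}

lemma exch_apply_self (hx : f u = x) (hu : u ≠ e) (hux : u ≠ x) : exch f e x u = e := by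
  classical
  simp [exch, Equiv.swap_apply_of_ne_of_ne hu hux, hx]

lemma exch_apply_left (hx : f u = x) (hf : IsMat G f) (hu : u ≠ e) (hux : u ≠ x) :
    exch f e x e = u := by
  classical
  simp [exch, hf.eq_comm hx, Equiv.swap_apply_of_ne_of_ne hu hux]

lemma exch_apply_right (he : f e = e) : exch f e x x = x := by
  simp [exch, he]

lemma exch_apply_of_ne (hx : f u = x) (hf : IsMat G f) (he : f e = e) {v : V} (h1 : v ≠ e)
    (h2 : v ≠ x) (h3 : v ≠ u) : exch f e x v = f v := by
  classical
  have h4 : f v ≠ e := fun h => h1 (by rw [← hf.eq_comm h, he])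
  have h5 : f v ≠ x := fun h => h3 (hf.inj (h.trans hx.symm))
  simp [exch, Equiv.swap_apply_of_ne_of_ne h1 h2, Equiv.swap_apply_of_ne_of_ne h4 h5]

lemma isMat_exch (hx : f u = x) (hf : IsMat G f) (he : f e = e) (hux : u ≠ x) (hadj : G.Adj e u) :
    IsMat G (exch f e x) := by
  refine ⟨fun v => by simp [exch, hf.1], fun v hv => ?_⟩
  have hue := hadj.ne'
  rcases eq_or_ne v e with rfl | h1
  · rw [exch_apply_left hx hf hue hux]
    exact hadj
  rcases eq_or_ne v x with rfl | h2
  · exact absurd (exch_apply_right he) hv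
  rcases eq_or_ne v u with rfl | h3
  · rw [exch_apply_self hx hue hux]
    exact hadj.symm
  · rw [exch_apply_of_ne hx hf he h1 h2 h3] at hv ⊢
    exact hf.2 v hv

lemma ncard_supp_exch [Finite V] (f : V → V) (e x : V) :
    (supp (exch f e x)).ncard = (supp f).ncard := by
  classical
  have : supp (exch f e x) = Equiv.swap e x '' supp f := by
    ext v
    rw [Equiv.image_eq_preimage_symm, Equiv.symm_swap]
    simp only [supp, exch, Set.mem_ofPred_eq, Set.mem_preimage, ne_eq, not_iff_not]
    rw [Equiv.swap_apply_eq_iff]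
  rw [this, Set.ncard_image_of_injective _ (Equiv.injective _)]

lemma isMaxMat_exch [Finite V] (hx : f u = x) (hf : IsMaxMat G f) (he : f e = e) (hux : u ≠ x)
    (hadj : G.Adj e u) : IsMaxMat G (exch f e x) :=
  hf.of_ncard_le (isMat_exch hx hf.1 he hux hadj) (ncard_supp_exch f e x).ge

open Classical in
/-- A matching extended by the edge between two unsaturated adjacent vertices. -/
lemma exists_augment (hf : IsMat G f) (he : f e = e) (hu : f u = u)
    (hadj : G.Adj e u) : ∃ g, IsMat G g ∧ supp g = insert e (insert u (supp f)) ∧ g e = u ∧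
      g u = e ∧ ∀ v, v ≠ e → v ≠ u → g v = f v := by
  have hne := hadj.ne
  have hfe : ∀ v, v ≠ e → v ≠ u → f v ≠ e ∧ f v ≠ u := fun v h1 h2 =>
    ⟨fun h => h1 (by rw [← hf.eq_comm h, he]), fun h => h2 (by rw [← hf.eq_comm h, hu])⟩
  refine ⟨fun v => if v = e then u else if v = u then e else f v, ⟨fun v => ?_, fun v hv => ?_⟩,
    ?_, by simp, by simp [hne.symm], fun v h1 h2 => by simp [h1, h2]⟩
  · by_cases h1 : v = e
    · simp [h1, hne.symm]
    · by_cases h2 : v = u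
      · simp [h2, hne.symm]
      · simp [h1, h2, hfe v h1 h2, hf.1]
  · by_cases h1 : v = e
    · simp [h1, hadj]
    · by_cases h2 : v = u
      · simp [h2, hne.symm, hadj.symm]
      · simp only [h1, h2, if_false] at hv ⊢
        exact hf.2 v hv
  · ext v
    by_cases h1 : v = e
    · simp [h1, supp, hne.symm]
    · by_cases h2 : v = u
      · simp [h2, supp, hne.symm, hne]
      · simp [h1, h2, supp]

lemma IsMaxMat.not_adj [Finite V] (hf : IsMaxMat G f) (he : f e = e) (hu : f u = u) :
    ¬ G.Adj e u := by
  intro h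
  obtain ⟨g, hg, hc, -⟩ := exists_augment hf.1 he hu h
  have h1 := hf.2 g hg
  rw [hc, Set.ncard_insert_of_notMem, Set.ncard_insert_of_notMem (by simp [supp, hu])] at h1
  swap
  · simp [supp, he, h.ne]
  omega

end exch

open Classical in
/-- `f` on `Q` and `g` elsewhere. -/
noncomputable def glue (Q : Set V) (f g : V → V) : V → V := fun v => if v ∈ Q then f v else g v

lemma glue_mem {Q : Set V} {f g : V → V} {v : V} (h : v ∈ Q) : glue Q f g v = f v := if_pos h

lemma glue_notMem {Q : Set V} {f g : V → V} {v : V} (h : v ∉ Q) : glue Q f g v = g v := if_neg h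

lemma IsMat.mapsTo_compl {G : SimpleGraph V} {f : V → V} (hf : IsMat G f) {Q : Set V}
    (h : ∀ v ∈ Q, f v ∈ Q) {v : V} (hv : v ∉ Q) : f v ∉ Q := fun h' => hv (hf.1 v ▸ h _ h')

lemma isMat_glue {G : SimpleGraph V} {Q : Set V} {f g : V → V} (hf : IsMat G f) (hg : IsMat G g)
    (hfQ : ∀ v ∈ Q, f v ∈ Q) (hgQ : ∀ v ∉ Q, g v ∉ Q) : IsMat G (glue Q f g) := by
  constructor
  · intro v
    by_cases h : v ∈ Q
    · rw [glue_mem h, glue_mem (hfQ v h), hf.1]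
    · rw [glue_notMem h, glue_notMem (hgQ v h), hg.1]
  · intro v hv
    by_cases h : v ∈ Q
    · rw [glue_mem h] at hv ⊢
      exact hf.2 v hv
    · rw [glue_notMem h] at hv ⊢
      exact hg.2 v hv

lemma ncard_supp_glue [Finite V] (Q : Set V) (f g : V → V) :
    (supp (glue Q f g)).ncard = (supp f ∩ Q).ncard + (supp g \ Q).ncard := by
  rw [← Set.ncard_inter_add_ncard_sdiff_eq_ncard (supp (glue Q f g)) Q]
  congr 2
  · ext v
    simp only [supp, Set.mem_inter_iff, Set.mem_ofPred_eq]
    exact and_congr_left fun h => by rw [glue_mem h]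
  · ext v
    simp only [supp, Set.mem_sdiff, Set.mem_ofPred_eq]
    exact and_congr_left fun h => by rw [glue_notMem h]

/-! ### Matchings between two disjoint sets, and the deficiency version of Hall's theorem -/

/-- `f` is a matching all of whose edges join `A` and `B`. -/
structure IsMatBetween (G : SimpleGraph V) (A B : Set V) (f : V → V) : Prop where
  isMat : IsMat G f
  left : ∀ v ∈ A, f v ≠ v → f v ∈ B
  right : ∀ v ∈ B, f v ≠ v → f v ∈ A
  off : ∀ v, v ∉ A → v ∉ B → f v = v

lemma IsMatBetween.ncard_supp [Finite V] {G : SimpleGraph V} {A B : Set V} {f : V → V}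
    (h : IsMatBetween G A B f) (hAB : Disjoint A B) :
    (supp f).ncard = 2 * (A ∩ supp f).ncard := by
  have h1 : (A ∩ supp f).ncard = (B ∩ supp f).ncard := by
    apply le_antisymm
    · exact Set.ncard_le_ncard_of_injOn f
        (fun v hv => ⟨h.left v hv.1 hv.2, h.isMat.mem_supp hv.2⟩) h.isMat.inj.injOn
    · exact Set.ncard_le_ncard_of_injOn f
        (fun v hv => ⟨h.right v hv.1 hv.2, h.isMat.mem_supp hv.2⟩) h.isMat.inj.injOn
  have h2 : supp f = (A ∩ supp f) ∪ (B ∩ supp f) := by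
    ext v
    constructor
    · intro hv
      by_cases hA : v ∈ A
      · exact Or.inl ⟨hA, hv⟩
      · by_cases hB : v ∈ B
        · exact Or.inr ⟨hB, hv⟩
        · exact absurd (h.off v hA hB) hv
    · rintro (hv | hv) <;> exact hv.2
  rw [h2, Set.ncard_union_eq (hAB.mono Set.inter_subset_left Set.inter_subset_left), ← h1, ← h2]
  omega

/-- The easy half of the deficiency theorem, used as an upper bound on matchings. -/
lemma IsMatBetween.ncard_le [Finite V] {G : SimpleGraph V} {A B : Set V} {f : V → V}
    (h : IsMatBetween G A B f) {Y : Set V} (hY : Y ⊆ A) :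
    Y.ncard + (A ∩ supp f).ncard ≤ (nbhd G Y ∩ B).ncard + A.ncard := by
  have h1 : (Y ∩ supp f).ncard ≤ (nbhd G Y ∩ B).ncard :=
    Set.ncard_le_ncard_of_injOn f (fun v hv => ⟨⟨v, hv.1, h.isMat.2 v hv.2⟩,
      h.left v (hY hv.1) hv.2⟩) h.isMat.inj.injOn
  have h2 := Set.ncard_inter_add_ncard_sdiff_eq_ncard Y (supp f)
  have h3 := Set.ncard_inter_add_ncard_sdiff_eq_ncard A (supp f)
  have h4 : (Y \ supp f).ncard ≤ (A \ supp f).ncard :=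
    Set.ncard_le_ncard (Set.sdiff_subset_sdiff_left hY)
  omega

open Classical in
lemma exists_isMatBetween_of_injOn {G : SimpleGraph V} {A B A₀ : Set V} (hAB : Disjoint A B)
    (hA₀ : A₀ ⊆ A) (m : V → V) (hinj : Set.InjOn m A₀) (hm : Set.MapsTo m A₀ B)
    (hadj : ∀ v ∈ A₀, G.Adj v (m v)) :
    ∃ f, IsMatBetween G A B f ∧ A ∩ supp f = A₀ ∧ ∀ v ∈ A₀, f v = m v := by
  let f : V → V := fun v => if v ∈ A₀ then m v else
    if h : ∃ a ∈ A₀, m a = v then h.choose else v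
  have hBA : ∀ v ∈ B, v ∉ A := fun v hv hv' => Set.disjoint_left.1 hAB hv' hv
  have f1 : ∀ v ∈ A₀, f v = m v := fun v hv => if_pos hv
  have f2 : ∀ a ∈ A₀, f (m a) = a := by
    intro a ha
    have h : ∃ b ∈ A₀, m b = m a := ⟨a, ha, rfl⟩
    have hn : m a ∉ A₀ := fun h' => hBA _ (hm ha) (hA₀ h')
    simp only [f, hn, if_false, dif_pos h]
    exact hinj h.choose_spec.1 ha h.choose_spec.2
  have f3 : ∀ v, v ∉ A₀ → (¬ ∃ a ∈ A₀, m a = v) → f v = v := by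
    intro v h h'
    simp only [f, h, if_false, dif_neg h']
  have cases3 : ∀ v, v ∈ A₀ ∨ (∃ a ∈ A₀, m a = v) ∨ f v = v := by
    intro v
    by_cases h : v ∈ A₀
    · exact Or.inl h
    · by_cases h' : ∃ a ∈ A₀, m a = v
      · exact Or.inr (Or.inl h')
      · exact Or.inr (Or.inr (f3 v h h'))
  refine ⟨f, ⟨⟨fun v => ?_, fun v hv => ?_⟩, fun v hv hv' => ?_, fun v hv hv' => ?_,
    fun v hv hv' => ?_⟩, ?_, f1⟩
  · rcases cases3 v with h | ⟨a, ha, rfl⟩ | h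
    · rw [f1 v h, f2 v h]
    · rw [f2 a ha, f1 a ha]
    · rw [h, h]
  · rcases cases3 v with h | ⟨a, ha, rfl⟩ | h
    · rw [f1 v h]
      exact hadj v h
    · rw [f2 a ha]
      exact (hadj a ha).symm
    · exact absurd h hv
  · rcases cases3 v with h | ⟨a, ha, rfl⟩ | h
    · rw [f1 v h]
      exact hm h
    · exact absurd hv (hBA _ (hm ha))
    · exact absurd h hv'
  · rcases cases3 v with h | ⟨a, ha, rfl⟩ | h
    · exact absurd (hA₀ h) (hBA _ hv)
    · rw [f2 a ha]
      exact hA₀ ha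
    · exact absurd h hv'
  · rcases cases3 v with h | ⟨a, ha, rfl⟩ | h
    · exact absurd (hA₀ h) hv
    · exact absurd (hm ha) hv'
    · exact h
  · ext v
    constructor
    · rintro ⟨hv, hv'⟩
      rcases cases3 v with h | ⟨a, ha, rfl⟩ | h
      · exact h
      · exact absurd hv (hBA _ (hm ha))
      · exact absurd h hv'
    · intro hv
      refine ⟨hA₀ hv, fun h => ?_⟩
      rw [f1 v hv] at h
      exact (hadj v hv).ne h.symm

/-- The deficiency version of Hall's theorem. -/
lemma exists_isMatBetween_of_deficiency [Finite V] {G : SimpleGraph V} {A B : Set V} {d : ℕ}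
    (hAB : Disjoint A B) (h : ∀ Y ⊆ A, Y.ncard ≤ (nbhd G Y ∩ B).ncard + d) :
    ∃ f, IsMatBetween G A B f ∧ A.ncard ≤ (A ∩ supp f).ncard + d := by
  classical
  have := Fintype.ofFinite V
  -- Hall's theorem is applied after adding `d` dummy vertices joined to all of `A`; the vertices
  -- assigned to dummies are the ones left unsaturated.
  let t : A → Finset (V ⊕ Fin d) := fun a =>
    ((nbhd G {a.1} ∩ B).toFinset.disjSum Finset.univ)
  have hall : ∀ s : Finset A, s.card ≤ (s.biUnion t).card := by
    intro s
    rcases s.eq_empty_or_nonempty with rfl | ⟨a₀, ha₀⟩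
    · simp
    let Y : Set V := Subtype.val '' (s : Set A)
    have hY : Y ⊆ A := by
      rintro _ ⟨a, -, rfl⟩
      exact a.2
    have hYc : Y.ncard = s.card := by
      rw [Set.ncard_image_of_injective _ Subtype.val_injective, Set.ncard_coe_finset]
    have hsub : (nbhd G Y ∩ B).toFinset.disjSum (Finset.univ : Finset (Fin d)) ⊆ s.biUnion t := by
      intro x hx
      rw [Finset.mem_biUnion]
      rcases x with x | x
      · simp only [Finset.inl_mem_disjSum, Set.mem_toFinset] at hx
        obtain ⟨⟨_, ⟨a, ha, rfl⟩, hax⟩, hx'⟩ := hx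
        refine ⟨a, ha, ?_⟩
        simp only [t, Finset.inl_mem_disjSum, Set.mem_toFinset]
        exact ⟨⟨_, rfl, hax⟩, hx'⟩
      · exact ⟨a₀, ha₀, by simp [t]⟩
    have h1 := Finset.card_le_card hsub
    rw [Finset.card_disjSum, Finset.card_univ, Fintype.card_fin, ← Set.ncard_eq_toFinset_card'] at h1
    have h2 := h Y hY
    omega
  obtain ⟨φ, hφ, hφt⟩ := (Finset.all_card_le_biUnion_card_iff_exists_injective t).1 hall
  let A₀ : Set V := {v | ∃ (hv : v ∈ A) (w : V), φ ⟨v, hv⟩ = Sum.inl w}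
  have hA₀ : A₀ ⊆ A := fun v ⟨hv, _⟩ => hv
  have hw : ∀ v : V, ∃ w : V, ∀ hv : v ∈ A, v ∈ A₀ → φ ⟨v, hv⟩ = Sum.inl w := by
    intro v
    by_cases h' : v ∈ A₀
    · obtain ⟨hv, w, hw⟩ := h'
      exact ⟨w, fun _ _ => hw⟩
    · exact ⟨v, fun _ h => absurd h h'⟩
  choose m hm using hw
  have hmt : ∀ v (hv : v ∈ A₀), G.Adj v (m v) ∧ m v ∈ B := by
    intro v hv
    have h1 := hφt ⟨v, hA₀ hv⟩
    rw [hm v (hA₀ hv) hv] at h1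
    simp only [t, Finset.inl_mem_disjSum, Set.mem_toFinset] at h1
    obtain ⟨⟨_, rfl, hax⟩, hx'⟩ := h1
    exact ⟨hax, hx'⟩
  obtain ⟨f, hf, hf', -⟩ := exists_isMatBetween_of_injOn (G := G) hAB hA₀ m
    (fun a ha b hb hab => by
      have h1 := hm a (hA₀ ha) ha
      rw [hab, ← hm b (hA₀ hb) hb] at h1
      exact congrArg Subtype.val (hφ h1))
    (fun v hv => (hmt v hv).2) (fun v hv => (hmt v hv).1)
  refine ⟨f, hf, ?_⟩
  rw [hf']
  have h3 := Set.ncard_sdiff_add_ncard_of_subset hA₀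
  have h4 : (A \ A₀).ncard ≤ d := by
    rw [← Nat.card_coe_set_eq]
    calc Nat.card ↥(A \ A₀) ≤ Nat.card (Fin d) := by
          have hr : ∀ a : ↥(A \ A₀), ∃ i : Fin d, φ ⟨a.1, a.2.1⟩ = Sum.inr i := by
            intro a
            rcases hx : φ ⟨a.1, a.2.1⟩ with w | i
            · exact absurd ⟨a.2.1, w, hx⟩ a.2.2
            · exact ⟨i, rfl⟩
          choose r hr using hr
          refine Nat.card_le_card_of_injective r fun a b hab => ?_
          have h5 := hr a
          rw [hab, ← hr b] at h5
          have := congrArg Subtype.val (hφ h5)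
          exact Subtype.ext this
      _ = d := by simp
  omega

/-- A smallest set `X ⊆ A` of maximum deficiency with respect to `B`: each of its vertices is
missed by a largest matching between `A` and `B`. -/
lemma exists_min_deficient [Finite V] (G : SimpleGraph V) {A B : Set V} (hAB : Disjoint A B) :
    ∃ (X : Set V) (d : ℕ), X ⊆ A ∧ X.ncard = (nbhd G X ∩ B).ncard + d ∧
      (∀ Y ⊆ A, Y.ncard ≤ (nbhd G Y ∩ B).ncard + d) ∧
      (∃ f, IsMatBetween G A B f ∧ A.ncard = (A ∩ supp f).ncard + d) ∧
      ∀ x ∈ X, ∃ f, IsMatBetween G A B f ∧ f x = x ∧ A.ncard = (A ∩ supp f).ncard + d := by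
  let δ : Set V → ℤ := fun Y => (Y.ncard : ℤ) - (nbhd G Y ∩ B).ncard
  obtain ⟨X₀, hX₀, hmax⟩ := Set.exists_max_image {Y | Y ⊆ A} δ (Set.toFinite _)
    ⟨∅, Set.empty_subset _⟩
  obtain ⟨X, hX, hmin⟩ := Set.exists_min_image {Y | Y ⊆ A ∧ δ Y = δ X₀} Set.ncard (Set.toFinite _)
    ⟨X₀, hX₀, rfl⟩
  have hd0 : 0 ≤ δ X₀ := by
    have := hmax ∅ (Set.empty_subset _)
    simp only [δ, Set.ncard_empty] at this ⊢
    have h : nbhd G ∅ = ∅ := by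
      ext v
      simp [nbhd]
    rw [h] at this
    simpa using this
  obtain ⟨d, hd⟩ := Int.eq_ofNat_of_zero_le hd0
  have hle : ∀ Y ⊆ A, Y.ncard ≤ (nbhd G Y ∩ B).ncard + d := by
    intro Y hY
    have := hmax Y hY
    simp only [δ] at this hd
    omega
  have hXd : X.ncard = (nbhd G X ∩ B).ncard + d := by
    have := hX.2
    simp only [δ] at this hd
    omega
  have hup : ∀ f, IsMatBetween G A B f → (A ∩ supp f).ncard + d ≤ A.ncard := by
    intro f hf
    have := hf.ncard_le hX.1
    omega
  refine ⟨X, d, hX.1, hXd, hle, ?_, fun x hx => ?_⟩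
  · obtain ⟨f, hf, hf'⟩ := exists_isMatBetween_of_deficiency hAB hle
    exact ⟨f, hf, le_antisymm hf' (hup f hf)⟩
  -- Sets attaining the deficiency `d` are closed under intersection, so the smallest, `X`, lies in
  -- all of them. Every set avoiding `x` then has deficiency at most `d - 1`, and Hall's theorem
  -- applies to `A \ {x}`.
  · have hlt : ∀ Y ⊆ A, Y.ncard = (nbhd G Y ∩ B).ncard + d → x ∈ Y := by
      intro Y hY hYd
      by_contra hxY
      have h1 := Set.ncard_union_add_ncard_inter X Y
      have h2 := Set.ncard_union_add_ncard_inter (nbhd G X ∩ B) (nbhd G Y ∩ B)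
      rw [← Set.union_inter_distrib_right, ← nbhd_union] at h2
      have h3 : (nbhd G (X ∩ Y) ∩ B).ncard ≤ (nbhd G X ∩ B ∩ (nbhd G Y ∩ B)).ncard :=
        Set.ncard_le_ncard (Set.subset_inter
          (Set.inter_subset_inter_left _ (nbhd_mono G Set.inter_subset_left))
          (Set.inter_subset_inter_left _ (nbhd_mono G Set.inter_subset_right)))
      have h4 := hle _ (Set.union_subset hX.1 hY)
      have h5 := hle (X ∩ Y) (Set.inter_subset_left.trans hX.1)
      have h6 := hmin (X ∩ Y) ⟨Set.inter_subset_left.trans hX.1, by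
        simp only [δ] at hd ⊢
        omega⟩
      have h7 : (X ∩ Y).ncard < X.ncard := Set.ncard_lt_ncard
        ⟨Set.inter_subset_left, fun h => hxY (h hx).2⟩
      omega
    -- With `d = 0` the empty set would attain the maximum and would have to contain `x`.
    have hdpos : 1 ≤ d := by
      by_contra h0
      refine hlt ∅ (Set.empty_subset _) ?_
      have h : nbhd G ∅ = ∅ := by
        ext v
        simp [nbhd]
      rw [h]
      simp
      omega
    obtain ⟨f, hf, hf'⟩ := exists_isMatBetween_of_deficiency (G := G) (A := A \ {x}) (B := B)
      (d := d - 1) (hAB.mono_left Set.sdiff_subset) (fun Y hY => by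
        have h1 := hle Y (hY.trans Set.sdiff_subset)
        have h2 : Y.ncard ≠ (nbhd G Y ∩ B).ncard + d := fun h =>
          (hY (hlt Y (hY.trans Set.sdiff_subset) h)).2 rfl
        omega)
    have hxA := hX.1 hx
    have hfx : f x = x := hf.off x (fun h => h.2 rfl) (Set.disjoint_left.1 hAB hxA)
    have hf2 : IsMatBetween G A B f := by
      refine ⟨hf.isMat, fun v hv hv' => ?_, fun v hv hv' => (hf.right v hv hv').1,
        fun v hv hv' => hf.off v (fun h => hv h.1) hv'⟩
      exact hf.left v ⟨hv, by rintro rfl; exact hv' hfx⟩ hv'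
    refine ⟨f, hf2, hfx, le_antisymm ?_ (hup f hf2)⟩
    have h1 := Set.ncard_sdiff_singleton_add_one hxA
    have h2 : (A \ {x} ∩ supp f).ncard ≤ (A ∩ supp f).ncard :=
      Set.ncard_le_ncard (Set.inter_subset_inter_left _ Set.sdiff_subset)
    omega

/-! ### Bipartite graphs -/

section bipartite

variable {G : SimpleGraph V} {A : Set V}

lemma isMatBetween_of_bipartite (hA : G.IsIndepSet A) (hB : G.IsIndepSet Aᶜ) {f : V → V}
    (hf : IsMat G f) : IsMatBetween G A Aᶜ f where
  isMat := hf
  left v hv hv' h := hA hv h (Ne.symm hv') (hf.2 v hv')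
  right v hv hv' := by
    by_contra h
    exact hB hv h (Ne.symm hv') (hf.2 v hv')
  off v h h' := absurd h h'

lemma nbhd_subset_compl (hA : G.IsIndepSet A) {Y : Set V} (hY : Y ⊆ A) : nbhd G Y ⊆ Aᶜ := by
  rintro v ⟨u, hu, huv⟩ hv
  exact hA (hY hu) hv huv.ne huv

/-- In a bipartite graph, one side has a set of maximum deficiency inside `D(G)`. -/
lemma bipartite_side [Finite V] (hA : G.IsIndepSet A) (hB : G.IsIndepSet Aᶜ) :
    ∃ X ⊆ A, X ⊆ geD G ∧ X.ncard + matchingNum G = (nbhd G X).ncard + A.ncard ∧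
      ∀ Y ⊆ A, Y.ncard + matchingNum G ≤ (nbhd G Y).ncard + A.ncard := by
  have hAB : Disjoint A Aᶜ := disjoint_compl_right
  obtain ⟨X, d, hXA, hXd, hle, ⟨f, hf, hfd⟩, hx⟩ := exists_min_deficient G hAB
  -- In a bipartite graph every matching is a matching between the sides, so the deficiency of `X`
  -- bounds all of them.
  have hmax : ∀ f, IsMatBetween G A Aᶜ f → A.ncard = (A ∩ supp f).ncard + d → IsMaxMat G f := by
    refine fun f hf hfd => ⟨hf.isMat, fun g hg => ?_⟩
    have hg' := isMatBetween_of_bipartite hA hB hg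
    have h1 := hg'.ncard_le hXA
    rw [hf.ncard_supp hAB, hg'.ncard_supp hAB]
    omega
  have hμ := two_mul_matchingNum (hmax f hf hfd)
  rw [hf.ncard_supp hAB] at hμ
  have hN : ∀ Y ⊆ A, nbhd G Y ∩ Aᶜ = nbhd G Y := fun Y hY =>
    Set.inter_eq_left.2 (nbhd_subset_compl hA hY)
  refine ⟨X, hXA, fun x hxX => ?_, ?_, fun Y hY => ?_⟩
  · obtain ⟨g, hg, hgx, hgd⟩ := hx x hxX
    exact (mem_geD_iff G x).2 ⟨g, hmax g hg hgd, hgx⟩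
  · rw [hN X hXA] at hXd
    omega
  · have := hle Y hY
    rw [hN Y hY] at this
    omega

lemma isIndepSet_union_sdiff_nbhd (hA : G.IsIndepSet A) (hB : G.IsIndepSet Aᶜ) {X : Set V}
    (hX : X ⊆ A) : G.IsIndepSet (X ∪ (Aᶜ \ nbhd G X)) := by
  intro u hu v hv huv hadj
  rcases hu with hu | hu <;> rcases hv with hv | hv
  · exact hA (hX hu) (hX hv) huv hadj
  · exact hv.2 ⟨u, hu, hadj⟩
  · exact hu.2 ⟨v, hv, hadj.symm⟩
  · exact hB hu.1 hv.1 huv hadj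

lemma ncard_union_sdiff_nbhd [Finite V] (hA : G.IsIndepSet A) {X : Set V} (hX : X ⊆ A) :
    (X ∪ (Aᶜ \ nbhd G X)).ncard + (nbhd G X).ncard = X.ncard + Aᶜ.ncard := by
  rw [Set.ncard_union_eq, add_assoc, Set.ncard_sdiff_add_ncard_of_subset (nbhd_subset_compl hA hX)]
  exact Set.disjoint_left.2 fun v hv hv' => hv'.1 (hX hv)

lemma indepNum_add_matchingNum_le [Finite V] (G : SimpleGraph V) :
    G.indepNum + matchingNum G ≤ Nat.card V := by
  obtain ⟨f, hf⟩ := exists_isMaxMat G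
  obtain ⟨S, hS, hc⟩ := exists_indep_ncard_eq G
  have h1 := two_mul_matchingNum hf
  have h2 := hf.1.two_mul_ncard_indep_le hS
  omega

/-- A maximum independent set of a bipartite graph that meets one side only inside `D(G)`. -/
lemma bipartite_exists_maximum_indep [Finite V] (hA : G.IsIndepSet A) (hB : G.IsIndepSet Aᶜ) :
    ∃ S, G.IsIndepSet S ∧ S.ncard + matchingNum G = Nat.card V ∧ S.ncard = G.indepNum ∧
      S ∩ A ⊆ geD G := by
  obtain ⟨X, hXA, hXD, hX, -⟩ := bipartite_side hA hB
  have h1 := isIndepSet_union_sdiff_nbhd hA hB hXA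
  have h2 := ncard_union_sdiff_nbhd hA hXA
  have h3 := Set.ncard_add_ncard_compl A
  have h4 := indepNum_add_matchingNum_le G
  have h5 := ncard_le_indepNum h1
  refine ⟨_, h1, by omega, by omega, ?_⟩
  rintro v ⟨hv | hv, hv'⟩
  · exact hXD hv
  · exact absurd hv' hv.1

lemma critDiff_add_le [Finite V] (G : SimpleGraph V) :
    critDiff G + 2 * matchingNum G ≤ Nat.card V := by
  obtain ⟨f, hf⟩ := exists_isMaxMat G
  obtain ⟨X, hX⟩ := exists_diff_eq_critDiff G
  have h1 := two_mul_matchingNum hf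
  have h2 := hf.1.diff_le X
  omega

/-- The most deficient sets of the two sides are joined; each lies in `D(G)`, and their differences
add up to the bound given by a maximum matching. -/
lemma bipartite_exists_critical [Finite V] (hA : G.IsIndepSet A) (hB : G.IsIndepSet Aᶜ) :
    critDiff G + 2 * matchingNum G = Nat.card V ∧ ∃ Y ⊆ geD G, diff G Y = critDiff G := by
  obtain ⟨X, hXA, hXD, hX, -⟩ := bipartite_side hA hB
  obtain ⟨Y, hYA, hYD, hY, -⟩ := bipartite_side (A := Aᶜ) hB (by rwa [compl_compl])
  have h1 := Set.ncard_add_ncard_compl A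
  have h2 : (X ∪ Y).ncard = X.ncard + Y.ncard :=
    Set.ncard_union_eq (Set.disjoint_left.2 fun v hv hv' => hYA hv' (hXA hv))
  have h3 := Set.ncard_union_le (nbhd G X) (nbhd G Y)
  rw [← nbhd_union] at h3
  have h4 := critDiff_add_le G
  have h5 := diff_le_critDiff G (X ∪ Y)
  unfold diff at h5
  refine ⟨by omega, X ∪ Y, Set.union_subset hXD hYD, ?_⟩
  unfold diff
  omega

/-- The kernel splits into its traces on the two sides, whose neighbourhoods are disjoint, so each
trace has the maximum deficiency on its side. With `X` the trace on `A`, the set `X ∪ (Aᶜ \ N(X))`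
is therefore a maximum independent set, and it contains `v`. -/
lemma bipartite_mem_corona_aux [Finite V] (hA : G.IsIndepSet A) (hB : G.IsIndepSet Aᶜ) {v : V}
    (hvA : v ∉ A) (hv : v ∉ nbhd G (kernel G)) : v ∈ corona G := by
  obtain ⟨-, -, -, -, hle⟩ := bipartite_side hA hB
  obtain ⟨-, -, -, -, hle'⟩ := bipartite_side (A := Aᶜ) hB (by rwa [compl_compl])
  have hsub : kernel G ∩ A ⊆ A := Set.inter_subset_right
  have hsub' : kernel G \ A ⊆ Aᶜ := fun v hv => hv.2
  have h1 := hle _ hsub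
  have h2 := hle' _ hsub'
  have h3 := Set.ncard_inter_add_ncard_sdiff_eq_ncard (kernel G) A
  have h4 : (nbhd G (kernel G)).ncard =
      (nbhd G (kernel G ∩ A)).ncard + (nbhd G (kernel G \ A)).ncard := by
    rw [← Set.ncard_union_eq, ← nbhd_union, Set.inter_union_sdiff]
    refine Set.disjoint_left.2 fun w hw hw' => ?_
    have := nbhd_subset_compl hB hsub' hw'
    rw [compl_compl] at this
    exact nbhd_subset_compl hA hsub hw this
  have h5 := diff_kernel G
  have h6 := (bipartite_exists_critical hA hB).1
  have h7 := Set.ncard_add_ncard_compl A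
  have h8 := ncard_union_sdiff_nbhd hA hsub
  have h9 := isIndepSet_union_sdiff_nbhd hA hB hsub
  have h10 := ncard_le_indepNum h9
  have h11 := indepNum_add_matchingNum_le G
  unfold diff at h5
  refine (mem_corona_iff G v).2 ⟨_, h9, by omega, Or.inr ⟨hvA, fun h => hv ?_⟩⟩
  exact nbhd_mono G Set.inter_subset_left h

lemma bipartite_mem_corona [Finite V] (hA : G.IsIndepSet A) (hB : G.IsIndepSet Aᶜ) {v : V}
    (hv : v ∉ nbhd G (kernel G)) : v ∈ corona G := by
  by_cases hvA : v ∈ A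
  · exact bipartite_mem_corona_aux (A := Aᶜ) hB (by rwa [compl_compl]) (not_not.2 hvA) hv
  · exact bipartite_mem_corona_aux hA hB hvA hv

lemma bipartite_two_mul_indepNum [Finite V] (hA : G.IsIndepSet A) (hB : G.IsIndepSet Aᶜ) :
    (2 * G.indepNum : ℤ) = critDiff G + Nat.card V := by
  obtain ⟨S, -, h1, h2, -⟩ := bipartite_exists_maximum_indep hA hB
  have h3 := (bipartite_exists_critical hA hB).1
  omega

end bipartite

/-! ### Odd closed walks contain odd cycles -/

/-- What `bypass` cuts out is either a cycle or an edge run back and forth, of even length in both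
cases. -/
lemma even_length_bypass_iff {G : SimpleGraph V} [DecidableEq V]
    (hG : ∀ (v : V) (c : G.Walk v v), c.IsCycle → Even c.length) {u v : V} (p : G.Walk u v) :
    Even p.bypass.length ↔ Even p.length := by
  induction p with
  | nil => simp [Walk.bypass]
  | @cons u v w h p ih =>
    rw [Walk.bypass]
    split_ifs with hs
    · have h1 := congrArg Walk.length (p.bypass.take_spec hs)
      rw [Walk.length_append] at h1
      have hpath := p.bypass_isPath.takeUntil hs
      have h2 : Odd (p.bypass.takeUntil u hs).length := by
        by_contra hodd
        rw [Nat.not_odd_iff_even] at hodd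
        have hcyc : (Walk.cons h (p.bypass.takeUntil u hs)).IsCycle := by
          rw [Walk.cons_isCycle_iff]
          refine ⟨hpath, fun he => ?_⟩
          have := hpath
          generalize p.bypass.takeUntil u hs = q at *
          cases q with
          | nil => simp at he
          | cons h' q' =>
            rw [Walk.edges_cons, List.mem_cons] at he
            rcases he with he | he
            · rw [Walk.cons_isPath_iff] at this
              rw [Sym2.eq_iff] at he
              rcases he with ⟨he, -⟩ | ⟨he, -⟩
              · exact h.ne he
              · subst he
                have h3 := this.1
                rw [Walk.isPath_iff_nil] at h3
                rw [h3.eq_nil] at hodd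
                simp at hodd
            · rw [Walk.cons_isPath_iff] at this
              exact this.2 (Walk.snd_mem_support_of_mem_edges _ he)
        have := hG _ _ hcyc
        rw [Walk.length_cons, Nat.even_add_one] at this
        exact this hodd
      rw [Walk.length_cons, Nat.even_add_one, ← ih, ← h1, Nat.even_add]
      have := Nat.not_even_iff_odd.2 h2
      tauto
    · rw [Walk.length_cons, Walk.length_cons, Nat.even_add_one, Nat.even_add_one, ih]

lemma exists_coloring_of_even_cycles {G : SimpleGraph V}
    (hG : ∀ (v : V) (c : G.Walk v v), c.IsCycle → Even c.length) :
    ∃ col : V → Bool, ∀ u v, G.Adj u v → col u ≠ col v := by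
  classical
  have h : G.Colorable 2 := two_colorable_iff_forall_loop_even.2 fun u w => by
    rw [← even_length_bypass_iff hG w, (Walk.isPath_iff_nil.1 w.bypass_isPath).eq_nil]
    simp
  obtain ⟨c⟩ := h
  refine ⟨fun v => finTwoEquiv (c v), fun u v huv h => c.valid huv (finTwoEquiv.injective h)⟩

/-! ### The vertices and edges of an odd cycle -/

/-- Take every other edge of the path, starting with the first. -/
lemma exists_perfect_of_odd_path {G : SimpleGraph V} : ∀ {u v : V} (p : G.Walk u v), p.IsPath →
    Odd p.length → ∃ f, IsMat G f ∧ supp f = {x | x ∈ p.support} ∧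
      ∀ x ∈ p.support, s(x, f x) ∈ p.edges
  | _, _, .nil, _, h => by simp at h
  | u, v, .cons h .nil, _, _ => by
    obtain ⟨g, hg, hs, h1, h2, -⟩ := exists_augment (IsMat.id G) (e := u) (u := v) rfl rfl h
    refine ⟨g, hg, ?_, ?_⟩
    · rw [hs]
      ext x
      simp [supp]
    · intro x hx
      simp only [Walk.support_cons, Walk.support_nil, List.mem_cons, List.not_mem_nil,
        or_false] at hx
      rcases hx with rfl | rfl
      · simp [h1]
      · simp [h2, Sym2.eq_swap]
  | u, _, .cons (v := a) h (.cons (v := b) h' q), hp, ho => by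
    rw [Walk.cons_isPath_iff, Walk.cons_isPath_iff] at hp
    obtain ⟨f, hf, hs, hfe⟩ := exists_perfect_of_odd_path q hp.1.1 (by
      simp only [Walk.length_cons] at ho
      rwa [Nat.odd_add_one, Nat.odd_add_one, not_not] at ho)
    have hmem : ∀ x, f x = x ↔ x ∉ q.support := fun x => by
      have : x ∈ supp f ↔ x ∈ q.support := by rw [hs]; rfl
      rw [← this]
      simp [supp]
    have hu : u ∉ q.support := fun hx => hp.2 (by simp [hx])
    obtain ⟨g, hg, hgs, h1, h2, h3⟩ := exists_augment hf ((hmem u).2 hu) ((hmem a).2 hp.1.2) h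
    refine ⟨g, hg, ?_, ?_⟩
    · rw [hgs, hs]
      ext x
      simp
    · intro x hx
      rw [Walk.support_cons, Walk.support_cons, List.mem_cons, List.mem_cons] at hx
      rcases hx with rfl | rfl | hx
      · simp [h1]
      · simp [h2, Sym2.eq_swap]
      · rw [h3 x (by rintro rfl; exact hu hx) (by rintro rfl; exact hp.1.2 hx)]
        simp [hfe x hx]

/-- Around a vertex `w` an odd cycle consists of two edges and a path of odd length. -/
lemma exists_path_of_odd_cycle {G : SimpleGraph V} {v : V} {c : G.Walk v v} (hc : c.IsCycle)
    (ho : Odd c.length) {w : V} (hw : w ∈ c.support) :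
    ∃ (a z : V) (q : G.Walk a z), q.IsPath ∧ Odd q.length ∧ w ∉ q.support ∧ G.Adj w a ∧ G.Adj z w ∧
      (∀ x, x ∈ c.support ↔ x = w ∨ x ∈ q.support) ∧
      (∀ e, e ∈ c.edges ↔ e = s(w, a) ∨ e = s(z, w) ∨ e ∈ q.edges) ∧ s(w, a) ≠ s(z, w) := by
  classical
  have hc' := hc.rotate hw
  have ho' : Odd (c.rotate w hw).length := by rwa [Walk.length_rotate]
  have hs : ∀ x, x ∈ c.support ↔ x ∈ (c.rotate w hw).support := fun x =>
    (Walk.mem_support_rotate_iff c w hw).symm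
  have he : ∀ e, e ∈ c.edges ↔ e ∈ (c.rotate w hw).edges := fun e =>
    (c.rotate_edges w hw).mem_iff.symm
  generalize c.rotate w hw = c' at *
  cases c' with
  | nil => simp at ho'
  | @cons _ a _ h p =>
    rw [Walk.cons_isCycle_iff] at hc'
    have hpn : ¬ p.reverse.Nil := by
      intro hn
      have := hn.eq
      exact h.ne this
    obtain ⟨z, h', q, hq⟩ := Walk.not_nil_iff.1 hpn
    have hp : p = q.reverse.concat h'.symm := by
      rw [← Walk.reverse_reverse p, hq, Walk.reverse_cons, Walk.concat_eq_append]
    subst hp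
    have hpath := hc'.1
    rw [Walk.concat_isPath_iff] at hpath
    refine ⟨a, z, q.reverse, hpath.1, ?_, hpath.2, h, h'.symm, fun x => ?_, fun e => ?_, ?_⟩
    · rw [Walk.length_cons, Walk.length_concat, Nat.odd_add_one, Nat.odd_add_one, not_not] at ho'
      exact ho'
    · rw [hs, Walk.support_cons, Walk.support_concat]
      simp
      tauto
    · rw [he, Walk.edges_cons, Walk.edges_concat]
      simp
      tauto
    · intro h
      exact hc'.2 (by rw [Walk.edges_concat]; simp [h])

section OddCycle

variable {G : SimpleGraph V} {C : G.Subgraph}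

/-- An odd cycle has a matching of all its vertices but a given one. -/
lemma IsOddCycle.exists_nearPerfect (hC : IsOddCycle G C) {w : V} (hw : w ∈ C.verts) :
    ∃ f, IsMat G f ∧ supp f = C.verts \ {w} ∧ ∀ x ∈ C.verts, x ≠ w → C.Adj x (f x) := by
  obtain ⟨v, c, hc, ho, rfl⟩ := hC
  rw [Walk.mem_verts_toSubgraph] at hw
  obtain ⟨a, z, q, hq, hqo, hwq, h1, h2, hs, he, -⟩ := exists_path_of_odd_cycle hc ho hw
  obtain ⟨f, hf, hfs, hfe⟩ := exists_perfect_of_odd_path q hq hqo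
  refine ⟨f, hf, ?_, fun x hx hxw => ?_⟩
  · rw [hfs]
    ext x
    simp only [Set.mem_ofPred_eq, Set.mem_sdiff, Walk.mem_verts_toSubgraph, hs,
      Set.mem_singleton_iff]
    constructor
    · intro h
      exact ⟨Or.inr h, by rintro rfl; exact hwq h⟩
    · rintro ⟨h | h, h'⟩
      · exact absurd h h'
      · exact h
  · rw [Walk.mem_verts_toSubgraph, hs] at hx
    rw [← Subgraph.mem_edgeSet, Walk.mem_edges_toSubgraph, he]
    exact Or.inr (Or.inr (hfe x (hx.resolve_left hxw)))

lemma IsOddCycle.nonempty (hC : IsOddCycle G C) : C.verts.Nonempty := by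
  obtain ⟨v, c, hc, ho, rfl⟩ := hC
  exact ⟨v, by simp⟩

lemma IsOddCycle.exists_adj (hC : IsOddCycle G C) {w : V} (hw : w ∈ C.verts) :
    ∃ x, C.Adj w x := by
  obtain ⟨v, c, hc, ho, rfl⟩ := hC
  rw [Walk.mem_verts_toSubgraph] at hw
  obtain ⟨a, z, q, hq, hqo, hwq, h1, h2, hs, he, -⟩ := exists_path_of_odd_cycle hc ho hw
  exact ⟨a, by rw [← Subgraph.mem_edgeSet, Walk.mem_edges_toSubgraph, he]; exact Or.inl rfl⟩

lemma IsOddCycle.exists_ne (hC : IsOddCycle G C) (w : V) : ∃ x ∈ C.verts, x ≠ w := by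
  obtain ⟨v, hv⟩ := hC.nonempty
  by_cases h : v = w
  · obtain ⟨x, hx⟩ := hC.exists_adj hv
    exact ⟨x, C.edge_vert hx.symm, by rw [← h]; exact hx.ne.symm⟩
  · exact ⟨v, hv, h⟩

lemma IsOddCycle.edgeSet_ncard [Finite V] (hC : IsOddCycle G C) :
    C.edgeSet.ncard = C.verts.ncard := by
  classical
  obtain ⟨v, c, hc, ho, rfl⟩ := hC
  have h1 : c.toSubgraph.edgeSet = (c.edges.toFinset : Set (Sym2 V)) := by
    ext e
    simp
  have h2 : c.toSubgraph.verts = (c.support.tail.toFinset : Set V) := by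
    ext x
    rw [Walk.mem_verts_toSubgraph]
    simp only [List.coe_toFinset, Set.mem_ofPred_eq]
    cases c with
    | nil => simp at ho
    | cons h p =>
      rw [Walk.support_cons, List.tail_cons, List.mem_cons]
      constructor
      · rintro (rfl | h)
        · exact p.end_mem_support
        · exact h
      · exact Or.inr
  rw [h1, h2, Set.ncard_coe_finset, Set.ncard_coe_finset, List.toFinset_card_of_nodup,
    List.toFinset_card_of_nodup hc.support_nodup, List.length_tail, Walk.length_support,
    Walk.length_edges]
  · rfl
  · exact hc.edges_nodup

lemma IsOddCycle.odd_ncard [Finite V] (hC : IsOddCycle G C) : Odd C.verts.ncard := by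
  obtain ⟨w, hw⟩ := hC.nonempty
  obtain ⟨f, hf, hs, -⟩ := hC.exists_nearPerfect hw
  have h1 := even_ncard_supp hf
  rw [hs] at h1
  rw [← Set.ncard_sdiff_singleton_add_one hw]
  exact h1.add_one

/-- A set of vertices of an odd cycle has at least as many neighbours on it. -/
lemma IsOddCycle.ncard_le_nbhd [Finite V] (hC : IsOddCycle G C) {Y : Set V} (hY : Y ⊆ C.verts) :
    Y.ncard ≤ (nbhd G Y ∩ C.verts).ncard := by
  -- If `Y` is the whole cycle, each of its vertices is a neighbour of another one. Otherwise a
  -- near-perfect matching missing a vertex outside `Y` injects `Y` into its neighbours.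
  by_cases h : C.verts ⊆ Y
  · refine Set.ncard_le_ncard fun v hv => ?_
    obtain ⟨x, hx⟩ := hC.exists_adj (hY hv)
    exact ⟨⟨x, h (C.edge_vert hx.symm), hx.adj_sub.symm⟩, hY hv⟩
  · obtain ⟨w, hw, hwY⟩ := Set.not_subset.1 h
    obtain ⟨f, hf, hs, hadj⟩ := hC.exists_nearPerfect hw
    refine Set.ncard_le_ncard_of_injOn f (fun v hv => ?_) hf.inj.injOn
    have h1 := hadj v (hY hv) (by rintro rfl; exact hwY hv)
    exact ⟨⟨v, hv, h1.adj_sub⟩, C.edge_vert h1.symm⟩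

end OddCycle

/-! ### Colourings of a graph with a unique odd cycle -/

section Coloring

variable {H : SimpleGraph V} {v : V} {c : H.Walk v v}

/-- Every odd cycle uses every edge of `c`, so deleting one of them leaves a bipartite graph. -/
lemma exists_coloring_off_edge
    (huniq : ∀ (w : V) (c' : H.Walk w w), c'.IsCycle → Odd c'.length → ∀ e ∈ c.edges, e ∈ c'.edges)
    {e : Sym2 V} (he : e ∈ c.edges) :
    ∃ f : V → Bool, ∀ x y, H.Adj x y → s(x, y) ≠ e → f x ≠ f y := by
  obtain ⟨f, hf⟩ := exists_coloring_of_even_cycles (G := H.deleteEdges {e}) (fun w c' hc' => by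
    by_contra h
    rw [Nat.not_even_iff_odd] at h
    have h1 := huniq w (c'.mapLe (H.deleteEdges_le {e})) (hc'.mapLe _) (by simpa using h) e he
    rw [Walk.edges_mapLe_eq_edges] at h1
    have h2 := c'.edges_subset_edgeSet h1
    rw [edgeSet_deleteEdges] at h2
    exact h2.2 rfl)
  refine ⟨f, fun x y hxy hne => hf x y ?_⟩
  rw [deleteEdges_adj]
  exact ⟨hxy, hne⟩

lemma coloring_walk {f : V → Bool} {e : Sym2 V} (hf : ∀ x y, H.Adj x y → s(x, y) ≠ e → f x ≠ f y)
    {a z : V} (q : H.Walk a z) (hq : e ∉ q.edges) : f a = f z ↔ Even q.length := by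
  induction q with
  | nil => simp
  | @cons x y z h q ih =>
    rw [Walk.edges_cons, List.mem_cons, not_or] at hq
    have h1 := hf x y h (Ne.symm hq.1)
    have h2 := ih hq.2
    rw [Walk.length_cons, Nat.even_add_one, ← h2]
    revert h1
    cases f x <;> cases f y <;> cases f z <;> decide

/-- Deleting either cycle edge at `w` leaves a bipartite graph. Both colourings flip along any other
edge, so their xor is constant there, and it changes across each of the two deleted edges; hence on
the cycle it singles out `w`. In effect, without its edges the cycle has no two vertices in one
component. -/
lemma exists_separating (hc : c.IsCycle) (ho : Odd c.length)
    (huniq : ∀ (w : V) (c' : H.Walk w w), c'.IsCycle → Odd c'.length → ∀ e ∈ c.edges, e ∈ c'.edges)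
    {w : V} (hw : w ∈ c.support) :
    ∃ g : V → Bool, g w = true ∧ (∀ x ∈ c.support, x ≠ w → g x = false) ∧
      ∀ x y, H.Adj x y → s(x, y) ∉ c.edges → g x = g y := by
  classical
  obtain ⟨a, z, q, hq, hqo, hwq, h1, h2, hs, he, hne⟩ := exists_path_of_odd_cycle hc ho hw
  have he1 : s(w, a) ∈ c.edges := (he _).2 (Or.inl rfl)
  have he2 : s(z, w) ∈ c.edges := (he _).2 (Or.inr (Or.inl rfl))
  obtain ⟨f1, hf1⟩ := exists_coloring_off_edge huniq he1
  obtain ⟨f2, hf2⟩ := exists_coloring_off_edge huniq he2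
  have hq1 : s(w, a) ∉ q.edges := fun h => hwq (q.fst_mem_support_of_mem_edges h)
  have hq2 : s(z, w) ∉ q.edges := fun h => hwq (q.snd_mem_support_of_mem_edges h)
  refine ⟨fun x => ((f1 x ^^ f2 x) ^^ (f1 a ^^ f2 a)), ?_, fun x hx hxw => ?_, fun x y hxy hnot => ?_⟩
  · have h3 := hf2 w a h1 hne
    have h4 := hf1 z w h2 (Ne.symm hne)
    have h5 := coloring_walk hf1 q hq1
    have h6 : ¬ f1 a = f1 z := by rw [h5]; exact Nat.not_even_iff_odd.2 hqo
    revert h3 h4 h6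
    dsimp only
    cases f1 w <;> cases f1 a <;> cases f1 z <;> cases f2 w <;> cases f2 a <;> decide
  · have hxq := ((hs x).1 hx).resolve_left hxw
    have h3 := coloring_walk hf1 (q.takeUntil x hxq)
      (fun h => hq1 (q.edges_takeUntil_subset_edges hxq h))
    have h4 := coloring_walk hf2 (q.takeUntil x hxq)
      (fun h => hq2 (q.edges_takeUntil_subset_edges hxq h))
    have h5 := h3.trans h4.symm
    revert h5
    dsimp only
    cases f1 x <;> cases f1 a <;> cases f2 x <;> cases f2 a <;> decide
  · have h3 := hf1 x y hxy (by rintro h; exact hnot (h ▸ he1))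
    have h4 := hf2 x y hxy (by rintro h; exact hnot (h ▸ he2))
    revert h3 h4
    dsimp only
    cases f1 x <;> cases f1 y <;> cases f2 x <;> cases f2 y <;> cases (f1 a ^^ f2 a) <;> decide

/-- If an odd cycle is contained in all odd cycles, there is a colouring that is proper outside
the cycle and constant on it. -/
lemma exists_contracted_coloring (hc : c.IsCycle) (ho : Odd c.length)
    (huniq : ∀ (w : V) (c' : H.Walk w w), c'.IsCycle → Odd c'.length → ∀ e ∈ c.edges, e ∈ c'.edges) :
    ∃ col : V → Bool, (∀ x ∈ c.support, col x = false) ∧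
      ∀ x y, H.Adj x y → s(x, y) ∉ c.edges → col x ≠ col y := by
  classical
  have hg : ∀ w, ∃ g : V → Bool, w ∈ c.support → g w = true ∧ (∀ x ∈ c.support, x ≠ w → g x = false) ∧
      ∀ x y, H.Adj x y → s(x, y) ∉ c.edges → g x = g y := by
    intro w
    by_cases hw : w ∈ c.support
    · obtain ⟨g, hg⟩ := exists_separating hc ho huniq hw
      exact ⟨g, fun _ => hg⟩
    · exact ⟨fun _ => true, fun h => absurd h hw⟩
  choose g hg using hg
  obtain ⟨a, z, q, hq, hqo, hwq, h1, h2, hs, he, hne⟩ :=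
    exists_path_of_odd_cycle hc ho c.start_mem_support
  obtain ⟨f, hf⟩ := exists_coloring_off_edge huniq ((he _).2 (Or.inl rfl))
  -- `g w` marks what hangs on the cycle at `w`. Flipping `f` there whenever `f w` is true makes the
  -- cycle constantly false, and edges off the cycle stay properly coloured because both their ends
  -- are flipped or neither is.
  refine ⟨fun x => (f x ^^ decide (∃ w ∈ c.support, g w x = true ∧ f w = true)),
    fun x hx => ?_, fun x y hxy hnot => ?_⟩
  · have : (∃ w ∈ c.support, g w x = true ∧ f w = true) ↔ f x = true := by
      constructor
      · rintro ⟨w, hw, h3, h4⟩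
        by_cases hxw : x = w
        · rwa [hxw]
        · rw [(hg w hw).2.1 x hx hxw] at h3
          exact absurd h3 (by decide)
      · intro h
        exact ⟨x, hx, (hg x hx).1, h⟩
    simp [this]
  · have h3 : (∃ w ∈ c.support, g w x = true ∧ f w = true) ↔
        (∃ w ∈ c.support, g w y = true ∧ f w = true) := by
      constructor <;> rintro ⟨w, hw, h3, h4⟩ <;> refine ⟨w, hw, ?_, h4⟩
      · rwa [← (hg w hw).2.2 x y hxy hnot]
      · rwa [(hg w hw).2.2 x y hxy hnot]
    have h4 := hf x y hxy (by rintro h; exact hnot (h ▸ (he _).2 (Or.inl rfl)))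
    simp only [h3]
    exact fun h5 => h4 (Bool.xor_left_inj.1 h5)

end Coloring

/-! ### Blossoms and flowers in terms of involutions -/

/-- `f` matches the vertices of `C` other than the base `b` along edges of `C`. -/
structure IsBlossomMat {G : SimpleGraph V} (f : V → V) (C : G.Subgraph) (b : V) : Prop where
  mem : b ∈ C.verts
  base : ¬ C.Adj b (f b)
  adj : ∀ x ∈ C.verts, x ≠ b → C.Adj x (f x)

/-- An edge is in the matching iff the number of edges after it is odd. -/
def AltTo {G : SimpleGraph V} (f : V → V) : ∀ {u v : V}, G.Walk u v → Prop
  | _, _, .nil => True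
  | u, _, .cons (v := a) _ q => (f u = a ↔ Odd q.length) ∧ AltTo f q

/-- Flowers in terms of involutions. -/
structure IsFlowerMat {G : SimpleGraph V} (f : V → V) (C : G.Subgraph) {b r : V} (p : G.Walk b r) :
    Prop where
  blossom : IsBlossomMat f C b
  path : p.IsPath
  alt : AltTo f p
  even : Even p.length
  root : f r = r
  meet : ∀ v ∈ p.support, v ∈ C.verts → v = b

section

variable {G : SimpleGraph V} {f : V → V} {C : G.Subgraph}

/-- The matching edges that lie on `C` form a matching of their own, with an even number of
saturated vertices, whereas `C` has an odd number of vertices. -/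
lemma IsMat.ncard_adj_le [Finite V] (hf : IsMat G f) (hC : IsOddCycle G C) :
    {x | C.Adj x (f x)}.ncard + 1 ≤ C.verts.ncard ∧
      ∀ M : G.Subgraph, Rep M f →
        {x | C.Adj x (f x)}.ncard = 2 * (C.edgeSet ∩ M.edgeSet).ncard := by
  classical
  let h : V → V := fun x => if C.Adj x (f x) then f x else x
  have hh : IsMat G h := by
    constructor
    · intro x
      by_cases hx : C.Adj x (f x)
      · have : C.Adj (f x) (f (f x)) := by rw [hf.1]; exact hx.symm
        have e1 : h x = f x := if_pos hx
        have e2 : h (f x) = f (f x) := if_pos this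
        rw [e1, e2, hf.1]
      · simp [h, hx]
    · intro x hx
      by_cases hx' : C.Adj x (f x)
      · simp only [h, hx', if_true]
        exact hx'.adj_sub
      · simp [h, hx'] at hx
  have hs : supp h = {x | C.Adj x (f x)} := by
    ext x
    by_cases hx' : C.Adj x (f x)
    · simpa [supp, h, hx'] using hx'.ne.symm
    · simp [supp, h, hx']
  constructor
  · have h1 := even_ncard_supp hh
    rw [hs] at h1
    have h2 := hC.odd_ncard
    have h3 : {x | C.Adj x (f x)}.ncard ≤ C.verts.ncard :=
      Set.ncard_le_ncard fun x hx => C.edge_vert hx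
    rcases h3.lt_or_eq with h4 | h4
    · exact h4
    · rw [h4] at h1
      exact absurd h2 (Nat.not_odd_iff_even.2 h1)
  · intro M hM
    rw [← hs, ← (rep_matSubgraph hh).two_mul_ncard]
    congr 2
    ext e
    induction e with
    | _ x y =>
    simp only [Subgraph.mem_edgeSet, Set.mem_inter_iff, hM.2, (rep_matSubgraph hh).2]
    constructor
    · rintro ⟨h1, h2⟩
      by_cases hx' : C.Adj x (f x)
      · simp only [h, hx', if_true] at h1
        subst h1
        exact ⟨hx', rfl, h2⟩
      · simp only [h, hx', if_false] at h1
        exact absurd h1 h2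
    · rintro ⟨h1, rfl, h2⟩
      exact ⟨by simp [h, h1], h2⟩

/-- The edge count says that all vertices of `C` but one are matched along `C`; the base is not, so
it is the exception. -/
lemma isBlossom_iff [Finite V] (hf : IsMat G f) (hC : IsOddCycle G C) {M : G.Subgraph}
    (hM : Rep M f) (b : V) : IsBlossom M C b ↔ IsBlossomMat f C b := by
  have h1 := (hf.ncard_adj_le hC).2 M hM
  have hb : (∀ w, C.Adj b w → ¬ M.Adj b w) ↔ ¬ C.Adj b (f b) := by
    constructor
    · intro h h'
      exact h _ h' ((hM.2 _ _).2 ⟨rfl, h'.ne⟩)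
    · intro h w hw hw'
      rw [← ((hM.2 _ _).1 hw').1] at hw
      exact h hw
  unfold IsBlossom
  rw [hb, hC.edgeSet_ncard, ← h1]
  constructor
  · rintro ⟨-, h2, h3, h4⟩
    refine ⟨h3, h4, fun x hx hxb => ?_⟩
    have h5 : {x | C.Adj x (f x)} ⊆ C.verts \ {b} := fun x hx =>
      ⟨C.edge_vert hx, by rintro rfl; exact h4 hx⟩
    have h6 := Set.eq_of_subset_of_ncard_le h5 (by
      have := Set.ncard_sdiff_singleton_add_one h3
      omega)
    have h7 : x ∈ C.verts \ {b} := ⟨hx, hxb⟩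
    rw [← h6] at h7
    exact h7
  · rintro ⟨h2, h3, h4⟩
    refine ⟨hC, ?_, h2, h3⟩
    have h5 : {x | C.Adj x (f x)} = C.verts \ {b} := by
      ext x
      exact ⟨fun hx => ⟨C.edge_vert hx, by rintro rfl; exact h3 hx⟩, fun hx => h4 x hx.1 hx.2⟩
    rw [h5, Set.ncard_sdiff_singleton_add_one h2]

/-- Alternation fixes the pattern of edges only up to interchanging the two kinds. As `r` is
unsaturated, the last edge is outside the matching, and the parity of the number of remaining edges
decides all the others. -/
lemma isAltWalk_iff {M : G.Subgraph} (hM : Rep M f) {v r : V} (p : G.Walk v r) (hf : IsMat G f)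
    (hr : f r = r) : IsAltWalk M p ↔ AltTo f p := by
  have hadj : ∀ {x y : V}, G.Adj x y → (s(x, y) ∈ M.edgeSet ↔ f x = y) := by
    intro x y hxy
    rw [Subgraph.mem_edgeSet, hM.2]
    exact ⟨fun h => h.1, fun h => ⟨h, hxy.ne⟩⟩
  unfold IsAltWalk
  induction p with
  | nil => simp [AltTo]
  | @cons u a w h q ih =>
    cases q with
    | nil =>
      have : f u ≠ a := fun h' => h.ne (by rw [← hf.eq_comm h', hr])
      simp [this, AltTo]
    | @cons _ b _ h' q' =>
      have h1 := ih hr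
      simp only [Walk.edges_cons, List.isChain_cons_cons] at h1 ⊢
      rw [hadj h, hadj h', AltTo, Walk.length_cons, Nat.odd_add_one]
      constructor
      · rintro ⟨h2, h3⟩
        have h4 := h1.1 h3
        exact ⟨by rw [h2, h4.1], h4⟩
      · rintro ⟨h2, h3⟩
        exact ⟨by rw [h2, h3.1], h1.2 h3⟩

lemma isFlower_iff [Finite V] (hf : IsMat G f) (hC : IsOddCycle G C) {M : G.Subgraph}
    (hM : Rep M f) {b r : V} (p : G.Walk b r) : IsFlower M C p ↔ IsFlowerMat f C p := by
  have hr : r ∉ M.verts ↔ f r = r := by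
    rw [hM.1]
    simp [supp]
  unfold IsFlower
  rw [isBlossom_iff hf hC hM, hr]
  constructor
  · rintro ⟨h1, h2, h3, h4, h5, h6⟩
    exact ⟨h1, h2, (isAltWalk_iff hM p hf h5).1 h3, h4, h5, h6⟩
  · rintro ⟨h1, h2, h3, h4, h5, h6⟩
    exact ⟨h1, h2, (isAltWalk_iff hM p hf h5).2 h3, h4, h5, h6⟩

lemma mem_reachSet_iff [Finite V] (hC : IsOddCycle G C) (v : V) :
    v ∈ reachSet G C ↔ ∃ (f : V → V) (b r : V) (p : G.Walk b r),
      IsMaxMat G f ∧ IsFlowerMat f C p ∧ (v ∈ C.verts ∨ v ∈ p.support) := by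
  constructor
  · rintro ⟨M, b, r, p, hM, hp, hv⟩
    obtain ⟨f, hf, hr⟩ := exists_rep hM.1
    exact ⟨f, b, r, p, (hr.isMaximumMatching_iff hf).1 hM, (isFlower_iff hf hC hr p).1 hp, hv⟩
  · rintro ⟨f, b, r, p, hf, hp, hv⟩
    have hr := rep_matSubgraph hf.1
    exact ⟨_, b, r, p, (hr.isMaximumMatching_iff hf.1).2 hf, (isFlower_iff hf.1 hC hr p).2 hp, hv⟩

/-! ### Switching along an alternating path -/

lemma AltTo.of_append {u v w : V} {p : G.Walk u v} {q : G.Walk v w} (h : AltTo f (p.append q)) :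
    AltTo f q := by
  induction p with
  | nil => exact h
  | cons h' p ih => exact ih h.2

lemma AltTo.congr {g : V → V} {u v : V} {p : G.Walk u v} (hp : AltTo f p)
    (h : ∀ x ∈ p.support, g x = f x) : AltTo g p := by
  induction p with
  | nil => trivial
  | cons h' p ih =>
    rw [Walk.support_cons] at h
    refine ⟨?_, ih hp.2 fun x hx => h x (List.mem_cons_of_mem _ hx)⟩
    rw [h _ List.mem_cons_self]
    exact hp.1

/-- Switching an alternating path of even length that ends in an unsaturated vertex. -/
lemma exists_switch [Finite V] (hf : IsMaxMat G f) : ∀ {v r : V} (p : G.Walk v r), p.IsPath →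
    AltTo f p → Even p.length → f r = r →
    ∃ g, IsMaxMat G g ∧ g v = v ∧ ∀ x ∉ p.support, g x = f x
  | _, _, .nil, _, _, _, hr => ⟨f, hf, hr, fun _ _ => rfl⟩
  | _, _, .cons _ .nil, _, _, he, _ => by simp at he
  | v, r, .cons (v := a) h (.cons (v := b) h' q), hp, ha, he, hr => by
    rw [Walk.cons_isPath_iff, Walk.cons_isPath_iff] at hp
    have hq : Even q.length := by
      simp only [Walk.length_cons] at he
      rwa [Nat.even_add_one, Nat.even_add_one, not_not] at he
    obtain ⟨g, hg, hgb, hoff⟩ := exists_switch hf q hp.1.1 ha.2.2 hq hr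
    have hvq : v ∉ q.support := fun hx => hp.2 (by simp [hx])
    have hva : f v = a := ha.1.2 (by rw [Walk.length_cons]; exact hq.add_one)
    have hgv : g v = a := by rw [hoff v hvq, hva]
    have hga : g a = v := hg.1.eq_comm hgv
    -- The recursion has freed `b`; trading the edge `va` for `ab` frees `v`.
    refine ⟨exch g b v, isMaxMat_exch hga hg hgb h.ne' h'.symm, exch_apply_right hgb,
      fun x hx => ?_⟩
    rw [Walk.support_cons, Walk.support_cons, List.mem_cons, List.mem_cons, not_or, not_or] at hx
    rw [exch_apply_of_ne hga hg.1 hgb (by rintro rfl; exact hx.2.2 q.start_mem_support) hx.1 hx.2.1,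
      hoff x hx.2.2]

/-- Switching the stem frees the base and leaves the blossom alone, since the stem meets it in the
base only. -/
lemma IsFlowerMat.exists_base [Finite V] {b r : V} {p : G.Walk b r} (hp : IsFlowerMat f C p)
    (hf : IsMaxMat G f) : ∃ g, IsMaxMat G g ∧ IsBlossomMat g C b ∧ g b = b := by
  obtain ⟨g, hg, hgb, hoff⟩ := exists_switch hf p hp.path hp.alt hp.even hp.root
  refine ⟨g, hg, ⟨hp.blossom.mem, ?_, fun x hx hxb => ?_⟩, hgb⟩
  · rw [hgb]
    exact fun h => h.ne rfl
  · rw [hoff x fun h => hxb (hp.meet x h hx)]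
    exact hp.blossom.adj x hx hxb

lemma IsBlossomMat.mapsTo {b : V} (h : IsBlossomMat f C b) (hb : f b = b) :
    ∀ x ∈ C.verts, f x ∈ C.verts := by
  intro x hx
  by_cases hxb : x = b
  · rw [hxb, hb]
    exact h.mem
  · exact C.edge_vert (h.adj x hx hxb).symm

lemma IsBlossomMat.supp_inter {b : V} (h : IsBlossomMat f C b) (hb : f b = b) :
    supp f ∩ C.verts = C.verts \ {b} := by
  ext x
  constructor
  · rintro ⟨h1, h2⟩
    exact ⟨h2, by rintro rfl; exact h1 hb⟩
  · rintro ⟨h1, h2⟩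
    exact ⟨(h.adj x h1 h2).ne.symm, h1⟩

/-- The unsaturated vertex of a blossom can be chosen freely. -/
lemma IsBlossomMat.exists_rotate [Finite V] {b : V} (h : IsBlossomMat f C b) (hb : f b = b)
    (hf : IsMaxMat G f) (hC : IsOddCycle G C) {w : V} (hw : w ∈ C.verts) :
    ∃ g, IsMaxMat G g ∧ IsBlossomMat g C w ∧ g w = w ∧ ∀ x ∉ C.verts, g x = f x := by
  obtain ⟨k, hk, hks, hka⟩ := hC.exists_nearPerfect hw
  have hkw : k w = w := by
    have : w ∉ supp k := by rw [hks]; simp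
    exact not_not.1 this
  have hk' : IsBlossomMat k C w := ⟨hw, by rw [hkw]; exact fun h => h.ne rfl, hka⟩
  refine ⟨glue C.verts k f, hf.of_ncard_le (isMat_glue hk hf.1 (hk'.mapsTo hkw) fun v hv =>
    hf.1.mapsTo_compl (h.mapsTo hb) hv) ?_, ⟨hw, ?_, fun x hx hxw => ?_⟩, ?_,
    fun x hx => glue_notMem hx⟩
  · rw [ncard_supp_glue, hk'.supp_inter hkw, ← Set.ncard_inter_add_ncard_sdiff_eq_ncard (supp f)
      C.verts, h.supp_inter hb]
    have h1 := Set.ncard_sdiff_singleton_add_one h.mem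
    have h2 := Set.ncard_sdiff_singleton_add_one hw
    omega
  · rw [glue_mem hw, hkw]
    exact fun h => h.ne rfl
  · rw [glue_mem hx]
    exact hka x hx hxw
  · rw [glue_mem hw, hkw]

/-- If every matching edge inside the relevant set meets `O` or lies in `T`, then the matching
saturates few vertices. -/
lemma IsMat.ncard_supp_le [Finite V] (hf : IsMat G f) {O T : Set V}
    (h : ∀ v ∈ supp f, v ∉ O → f v ∉ O → v ∈ T) :
    (supp f).ncard ≤ 2 * (O ∩ supp f).ncard + T.ncard := by
  have h1 : supp f ⊆ (O ∩ supp f) ∪ (f '' (O ∩ supp f) ∪ T) := by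
    intro v hv
    by_cases h1 : v ∈ O
    · exact Or.inl ⟨h1, hv⟩
    · by_cases h2 : f v ∈ O
      · exact Or.inr (Or.inl ⟨f v, ⟨h2, hf.mem_supp hv⟩, hf.1 v⟩)
      · exact Or.inr (Or.inr (h v hv h1 h2))
  have h2 := Set.ncard_le_ncard h1
  have h3 := Set.ncard_union_le (O ∩ supp f) (f '' (O ∩ supp f) ∪ T)
  have h4 := Set.ncard_union_le (f '' (O ∩ supp f)) T
  have h5 := Set.ncard_image_of_injective (O ∩ supp f) hf.inj
  omega

lemma coloring_walk_edges {col : V → Bool} {a z : V} (q : G.Walk a z)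
    (hq : ∀ x y, s(x, y) ∈ q.edges → col x ≠ col y) : col a = col z ↔ Even q.length := by
  induction q with
  | nil => simp
  | @cons x y z h q ih =>
    have h1 := hq x y (by simp)
    have h2 := ih fun x' y' h' => hq x' y' (by simp [h'])
    rw [Walk.length_cons, Nat.even_add_one, ← h2]
    revert h1
    cases col x <;> cases col y <;> cases col z <;> decide

lemma exists_next_of_path {u r v : V} (p : G.Walk u r) (hp : p.IsPath) (hv : v ∈ p.support)
    (hvr : v ≠ r) : ∃ y ∈ p.support, y ≠ u ∧ s(v, y) ∈ p.edges := by
  induction p with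
  | nil =>
    simp only [Walk.support_nil, List.mem_cons, List.not_mem_nil, or_false] at hv
    exact absurd hv hvr
  | @cons x a z h q ih =>
    rw [Walk.cons_isPath_iff] at hp
    rw [Walk.support_cons, List.mem_cons] at hv
    rcases hv with rfl | hv
    · exact ⟨a, by simp, h.ne', by simp⟩
    · obtain ⟨y, hy, -, he⟩ := ih hp.1 hv hvr
      exact ⟨y, by simp [hy], by rintro rfl; exact hp.2 hy, by simp [he]⟩

/-- A stem has no edge of the blossom. -/
lemma IsFlowerMat.not_adj_of_mem_edges {b r : V} {p : G.Walk b r} (hp : IsFlowerMat f C p) {x y : V}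
    (h : s(x, y) ∈ p.edges) : ¬ C.Adj x y := by
  intro h'
  have h1 := hp.meet x (p.fst_mem_support_of_mem_edges h) (C.edge_vert h')
  have h2 := hp.meet y (p.snd_mem_support_of_mem_edges h) (C.edge_vert h'.symm)
  exact h'.ne (h1.trans h2.symm)

end

/-! ### Graphs with a unique odd cycle from which everything is reachable. -/

lemma IsMatBetween.symm {G : SimpleGraph V} {A B : Set V} {f : V → V} (h : IsMatBetween G A B f) :
    IsMatBetween G B A f :=
  ⟨h.isMat, h.right, h.left, fun v hv hv' => h.off v hv' hv⟩

/-- `C` is the only odd cycle of `H`, every vertex is reachable from it, and `col` is a colouring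
that is proper outside `C` and constant on `C`. -/
structure IsReachGraph (H : SimpleGraph V) (C : H.Subgraph) (col : V → Bool) : Prop where
  odd : IsOddCycle H C
  uniq : ∀ C', IsOddCycle H C' → C' = C
  reach : reachSet H C = Set.univ
  col_cycle : ∀ x ∈ C.verts, col x = false
  col_ne : ∀ x y, H.Adj x y → ¬ C.Adj x y → col x ≠ col y

section

variable {H : SimpleGraph V} {C : H.Subgraph}

lemma edges_subset_of_uniq (huniq : ∀ C', IsOddCycle H C' → C' = C) {v : V} {c : H.Walk v v}
    (hcC : c.toSubgraph = C) (w : V) (c' : H.Walk w w) (h1 : c'.IsCycle) (h2 : Odd c'.length) :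
    ∀ e ∈ c.edges, e ∈ c'.edges := by
  intro e he
  have := huniq _ ⟨w, c', h1, h2, rfl⟩
  rw [← hcC] at this
  rwa [← Walk.mem_edges_toSubgraph, this, Walk.mem_edges_toSubgraph]

lemma exists_separating_cycle (hC : IsOddCycle H C) (huniq : ∀ C', IsOddCycle H C' → C' = C) {w : V}
    (hw : w ∈ C.verts) : ∃ g : V → Bool, g w = true ∧ (∀ x ∈ C.verts, x ≠ w → g x = false) ∧
      ∀ x y, H.Adj x y → ¬ C.Adj x y → g x = g y := by
  obtain ⟨v, c, hc, ho, hcC⟩ := hC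
  obtain ⟨g, h1, h2, h3⟩ := exists_separating hc ho (edges_subset_of_uniq huniq hcC)
    (w := w) (by rwa [← Walk.mem_verts_toSubgraph, hcC])
  refine ⟨g, h1, fun x hx => h2 x ?_, fun x y hxy hn => h3 x y hxy fun he => hn ?_⟩
  · rwa [← Walk.mem_verts_toSubgraph, hcC]
  · rwa [← hcC, ← Subgraph.mem_edgeSet, Walk.mem_edges_toSubgraph]

lemma exists_coloring_off_vertex (hC : IsOddCycle H C) (huniq : ∀ C', IsOddCycle H C' → C' = C)
    {w : V} (hw : w ∈ C.verts) :
    ∃ f : V → Bool, ∀ x y, H.Adj x y → x ≠ w → y ≠ w → f x ≠ f y := by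
  obtain ⟨v, c, hc, ho, hcC⟩ := hC
  have hw' : w ∈ c.support := by rwa [← Walk.mem_verts_toSubgraph, hcC]
  obtain ⟨a, z, q, hq, hqo, hwq, h1, h2, hs, he, hne⟩ := exists_path_of_odd_cycle hc ho hw'
  obtain ⟨f, hf⟩ := exists_coloring_off_edge (edges_subset_of_uniq huniq hcC)
    ((he _).2 (Or.inl rfl))
  refine ⟨f, fun x y hxy hx hy => hf x y hxy fun h => ?_⟩
  rw [Sym2.eq_iff] at h
  rcases h with ⟨h, -⟩ | ⟨-, h⟩
  · exact hx h
  · exact hy h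

/-- Independent sets with half of the vertices of an odd cycle, avoiding a given vertex. -/
lemma exists_indep_in_cycle [Finite V] (hC : IsOddCycle H C)
    (huniq : ∀ C', IsOddCycle H C' → C' = C) {w x : V} (hw : w ∈ C.verts) (hx : x ∈ C.verts)
    (hxw : x ≠ w) : ∃ S, H.IsIndepSet S ∧ S ⊆ C.verts ∧ w ∉ S ∧ x ∈ S ∧
      2 * S.ncard + 1 = C.verts.ncard := by
  obtain ⟨f, hf⟩ := exists_coloring_off_vertex hC huniq hw
  obtain ⟨k, hk, hks, hka⟩ := hC.exists_nearPerfect hw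
  have hmaps : ∀ y ∈ C.verts, y ≠ w → k y ∈ C.verts ∧ k y ≠ w ∧ f (k y) ≠ f y := by
    intro y hy hyw
    have h1 := hka y hy hyw
    have h2 : k y ≠ w := by
      intro h
      have h3 : w ∈ supp k := by
        rw [← h]
        exact hk.mem_supp (by rw [hks]; exact ⟨hy, hyw⟩)
      rw [hks] at h3
      exact h3.2 rfl
    exact ⟨C.edge_vert h1.symm, h2, (hf y _ h1.adj_sub hyw h2).symm⟩
  -- The near-perfect matching `k` interchanges the two colour classes of the cycle minus `w`, so
  -- each has half of its vertices.
  let S : Bool → Set V := fun β => {y | y ∈ C.verts ∧ y ≠ w ∧ f y = β}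
  have hle : ∀ β, (S β).ncard ≤ (S (!β)).ncard := by
    intro β
    refine Set.ncard_le_ncard_of_injOn k (fun y hy => ?_) hk.inj.injOn
    obtain ⟨h1, h2, h3⟩ := hmaps y hy.1 hy.2.1
    exact ⟨h1, h2, by rw [hy.2.2] at h3; exact Bool.eq_not.2 h3⟩
  have hunion : C.verts \ {w} = S (f x) ∪ S (!(f x)) := by
    ext y
    constructor
    · rintro ⟨h1, h2⟩
      rcases eq_or_ne (f y) (f x) with h | h
      · exact Or.inl ⟨h1, h2, h⟩
      · exact Or.inr ⟨h1, h2, Bool.eq_not.2 h⟩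
    · rintro (h | h) <;> exact ⟨h.1, h.2.1⟩
  have h1 := Set.ncard_sdiff_singleton_add_one hw
  rw [hunion, Set.ncard_union_eq] at h1
  · have h2 := hle (f x)
    have h3 := hle (!(f x))
    rw [Bool.not_not] at h3
    refine ⟨S (f x), fun a ha b hb hab hadj => ?_, fun y hy => hy.1, fun h => h.2.1 rfl,
      ⟨hx, hxw, rfl⟩, by omega⟩
    exact hf a b hadj ha.2.1 hb.2.1 (ha.2.2.trans hb.2.2.symm)
  · refine Set.disjoint_left.2 fun y hy hy' => ?_
    have := hy.2.2.symm.trans hy'.2.2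
    revert this
    cases f x <;> decide

/-- Some vertex of the cycle is outside `S`; the others are matched along the cycle, and `S` has at
most one end of each matching edge. -/
lemma IsOddCycle.two_mul_ncard_indep_lt [Finite V] (hC : IsOddCycle H C) {S : Set V}
    (hS : H.IsIndepSet S) : 2 * (S ∩ C.verts).ncard + 1 ≤ C.verts.ncard := by
  obtain ⟨w, hw, hwS⟩ : ∃ w ∈ C.verts, w ∉ S := by
    obtain ⟨a, ha⟩ := hC.nonempty
    by_cases h : a ∈ S
    · obtain ⟨b, hb⟩ := hC.exists_adj ha
      exact ⟨b, C.edge_vert hb.symm, fun h' => hS h h' hb.ne hb.adj_sub⟩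
    · exact ⟨a, ha, h⟩
  obtain ⟨k, hk, hks, hka⟩ := hC.exists_nearPerfect hw
  have h1 : (S ∩ C.verts).ncard ≤ ((C.verts \ {w}) \ S).ncard := by
    refine Set.ncard_le_ncard_of_injOn k (fun y hy => ?_) hk.inj.injOn
    have hyw : y ≠ w := by rintro rfl; exact hwS hy.1
    have h2 := hka y hy.2 hyw
    refine ⟨?_, fun h => hS hy.1 h h2.ne h2.adj_sub⟩
    rw [← hks]
    exact hk.mem_supp (by rw [hks]; exact ⟨hy.2, hyw⟩)
  have h2 := Set.ncard_inter_add_ncard_sdiff_eq_ncard (C.verts \ {w}) S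
  have h3 : (C.verts \ {w}) ∩ S = S ∩ C.verts := by
    ext y
    constructor
    · rintro ⟨h, h'⟩
      exact ⟨h', h.1⟩
    · rintro ⟨h, h'⟩
      exact ⟨⟨h', by rintro rfl; exact hwS h⟩, h⟩
  have h4 := Set.ncard_sdiff_singleton_add_one hw
  rw [h3] at h2
  omega

end

/-! ### Gallai–Edmonds sets, independence number and critical difference of such a graph. -/

namespace IsReachGraph

variable {H : SimpleGraph V} {C : H.Subgraph} {col : V → Bool}

/-- The vertices outside the cycle with the colour of the cycle. -/
def even (_ : IsReachGraph H C col) : Set V := {x | col x = false ∧ x ∉ C.verts}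

/-- The vertices with the other colour. -/
def odds (_ : IsReachGraph H C col) : Set V := {x | col x = true}

variable (h : IsReachGraph H C col)

include h

lemma disjoint : Disjoint h.odds h.even :=
  Set.disjoint_left.2 fun _ hx hx' => by
    have := hx.symm.trans hx'.1
    exact absurd this (by decide)

lemma odds_notMem_cycle {x : V} (hx : x ∈ h.odds) : x ∉ C.verts := fun hx' => by
  have := hx.symm.trans (h.col_cycle x hx')
  exact absurd this (by decide)

lemma mem_cases (x : V) : x ∈ h.odds ∨ x ∈ h.even ∨ x ∈ C.verts := by
  by_cases h1 : col x = true
  · exact Or.inl h1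
  · by_cases h2 : x ∈ C.verts
    · exact Or.inr (Or.inr h2)
    · exact Or.inr (Or.inl ⟨Bool.eq_false_iff.2 h1, h2⟩)

lemma adj_even {x y : V} (hx : x ∈ h.even) (hxy : H.Adj x y) : y ∈ h.odds := by
  have := h.col_ne x y hxy fun h' => hx.2 (C.edge_vert h')
  rw [hx.1] at this
  exact Bool.eq_true_of_not_eq_false this.symm

lemma adj_odds {x y : V} (hx : x ∈ h.odds) (hxy : H.Adj x y) : y ∈ h.even ∨ y ∈ C.verts := by
  rcases h.mem_cases y with h1 | h1
  · exact absurd (hx.trans h1.symm)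
      (h.col_ne x y hxy fun h' => h.odds_notMem_cycle hx (C.edge_vert h'))
  · exact h1

lemma adj_cycle {x y : V} (hx : x ∈ C.verts) (hxy : H.Adj x y) : y ∈ h.odds ∨ C.Adj x y := by
  by_cases h1 : C.Adj x y
  · exact Or.inr h1
  · have := h.col_ne x y hxy h1
    rw [h.col_cycle x hx] at this
    exact Or.inl (Bool.eq_true_of_not_eq_false this.symm)

lemma indep_odds : H.IsIndepSet h.odds := fun x hx y hy _ hadj => by
  rcases h.adj_odds hx hadj with h1 | h1
  · exact Set.disjoint_left.1 h.disjoint hy h1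
  · exact h.odds_notMem_cycle hy h1

lemma indep_even : H.IsIndepSet h.even := fun _ hx _ hy _ hadj =>
  Set.disjoint_left.1 h.disjoint (h.adj_even hx hadj) hy

lemma card_eq [Finite V] : h.odds.ncard + h.even.ncard + C.verts.ncard = Nat.card V := by
  rw [← Set.ncard_union_eq h.disjoint, ← Set.ncard_union_eq, ← Set.ncard_univ]
  · congr 1
    ext x
    have := h.mem_cases x
    simp only [Set.mem_union, Set.mem_univ, iff_true]
    tauto
  · refine Set.disjoint_left.2 fun x hx hx' => ?_
    rcases hx with hx | hx
    · exact h.odds_notMem_cycle hx hx'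
    · exact hx.2 hx'

lemma exists_flower [Finite V] (v : V) : ∃ (f : V → V) (b r : V) (p : H.Walk b r),
    IsMaxMat H f ∧ IsFlowerMat f C p ∧ (v ∈ C.verts ∨ v ∈ p.support) := by
  rw [← mem_reachSet_iff h.odd, h.reach]
  trivial

lemma exists_max_base [Finite V] {w : V} (hw : w ∈ C.verts) :
    ∃ g, IsMaxMat H g ∧ IsBlossomMat g C w ∧ g w = w := by
  obtain ⟨f, b, r, p, hf, hp, -⟩ := h.exists_flower w
  obtain ⟨g, hg, hb, hgb⟩ := hp.exists_base hf
  obtain ⟨k, hk, hkw, hkb, -⟩ := hb.exists_rotate hgb hg h.odd hw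
  exact ⟨k, hk, hkw, hkb⟩

/-- Colours alternate along a stem, so a vertex off the cycle with the colour of the cycle is at
even distance from the root, and switching the rest of the stem frees it. -/
lemma mem_geD_of_col [Finite V] {v : V} (hv : col v = false) : v ∈ geD H := by
  classical
  obtain ⟨f, b, r, p, hf, hp, hvp⟩ := h.exists_flower v
  by_cases hvC : v ∈ C.verts
  · obtain ⟨g, hg, -, hgv⟩ := h.exists_max_base hvC
    exact (mem_geD_iff H v).2 ⟨g, hg, hgv⟩
  have hvs := hvp.resolve_left hvC
  have hcol : ∀ {a z : V} (q : H.Walk a z), (∀ e ∈ q.edges, e ∈ p.edges) →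
      (col a = col z ↔ Even q.length) := fun q hq =>
    coloring_walk_edges q fun x y hxy =>
      h.col_ne x y (q.adj_of_mem_edges hxy) (hp.not_adj_of_mem_edges (hq _ hxy))
  have h1 := (hcol p fun _ he => he).2 hp.even
  rw [h.col_cycle b hp.blossom.mem] at h1
  have h2 := (hcol (p.dropUntil v hvs) fun e he => p.edges_dropUntil_subset_edges hvs he).1
    (hv.trans h1)
  have h3 := hp.alt
  rw [← p.take_spec hvs] at h3
  obtain ⟨g, hg, hgv, -⟩ := exists_switch hf _ (hp.path.dropUntil hvs) h3.of_append h2 hp.root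
  exact (mem_geD_iff H v).2 ⟨g, hg, hgv⟩

/-- The root has the colour of the cycle, so `v` is not the last vertex of its stem. The next vertex
is not the base, hence not on the cycle. -/
lemma exists_adj_even [Finite V] {v : V} (hv : v ∈ h.odds) : ∃ y ∈ h.even, H.Adj v y := by
  obtain ⟨f, b, r, p, hf, hp, hvp⟩ := h.exists_flower v
  have hvs := hvp.resolve_left (h.odds_notMem_cycle hv)
  have h1 := (coloring_walk_edges p fun x y hxy =>
    h.col_ne x y (p.adj_of_mem_edges hxy) (hp.not_adj_of_mem_edges hxy)).2 hp.even
  rw [h.col_cycle b hp.blossom.mem] at h1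
  have hvr : v ≠ r := by
    rintro rfl
    have := hv.symm.trans h1.symm
    exact absurd this (by decide)
  obtain ⟨y, hy, hyb, he⟩ := exists_next_of_path p hp.path hvs hvr
  have hadj := p.adj_of_mem_edges he
  refine ⟨y, (h.adj_odds hv hadj).resolve_right fun hyC => hyb (hp.meet y hy hyC), hadj⟩

/-- The matchings between the two sides extend to the cycle. -/
lemma exists_extend [Finite V] {f : V → V} (hf : IsMatBetween H h.odds h.even f) {w : V}
    (hw : w ∈ C.verts) : ∃ g, IsMat H g ∧ g w = w ∧ (∀ x ∉ C.verts, g x = f x) ∧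
      (supp g).ncard + 1 = C.verts.ncard + 2 * (h.odds ∩ supp f).ncard := by
  obtain ⟨k, hk, hks, hka⟩ := h.odd.exists_nearPerfect hw
  have hkw : k w = w := by
    have : w ∉ supp k := by rw [hks]; simp
    exact not_not.1 this
  have hfC : ∀ x ∈ C.verts, f x = x := fun x hx =>
    hf.off x (fun h' => h.odds_notMem_cycle h' hx) (fun h' => h'.2 hx)
  refine ⟨glue C.verts k f, isMat_glue hk hf.isMat (fun x hx => ?_) (fun x hx hx' => ?_), ?_,
    fun x hx => glue_notMem hx, ?_⟩
  · by_cases hxw : x = w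
    · rw [hxw, hkw]
      exact hw
    · exact C.edge_vert (hka x hx hxw).symm
  · have h1 := hfC _ hx'
    rw [hf.isMat.1] at h1
    exact hx (h1 ▸ hx')
  · rw [glue_mem hw, hkw]
  · rw [ncard_supp_glue, ← hf.ncard_supp h.disjoint]
    have h1 : supp f \ C.verts = supp f := by
      ext x
      exact ⟨fun hx => hx.1, fun hx => ⟨hx, fun hx' => hx (hfC x hx')⟩⟩
    have h2 : supp k ∩ C.verts = C.verts \ {w} := by
      rw [hks]
      exact Set.inter_eq_left.2 Set.sdiff_subset
    have h3 := Set.ncard_sdiff_singleton_add_one hw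
    rw [h1, h2]
    omega

/-- The matching number, and the vertices saturated by all maximum matchings. -/
lemma structure_aux [Finite V] :
    (∀ g, IsMaxMat H g → h.odds ⊆ supp g ∧ (supp g).ncard + 1 = C.verts.ncard + 2 * h.odds.ncard) ∧
      ∃ f, IsMatBetween H h.odds h.even f ∧ h.odds ⊆ supp f := by
  obtain ⟨X, d, hX, hXd, hle, ⟨f, hf, hfd⟩, hx⟩ := exists_min_deficient H h.disjoint
  obtain ⟨w, hw⟩ := h.odd.nonempty
  obtain ⟨m, hm, hmw, -, hmc⟩ := h.exists_extend hf hw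
  obtain ⟨f₀, hf₀, hb, hbw⟩ := h.exists_max_base hw
  -- Removing the cycle from a maximum matching that matches the cycle within itself leaves a
  -- matching between the two sides. This makes the extension of a largest such matching maximum in
  -- `H`.
  have hf₀' : IsMatBetween H h.odds h.even (glue C.verts id f₀) := by
    have hmat : IsMat H (glue C.verts id f₀) := isMat_glue (IsMat.id H) hf₀.1 (fun x hx => hx)
      (fun x hx => hf₀.1.mapsTo_compl (hb.mapsTo hbw) hx)
    refine ⟨hmat, fun x hx hx' => ?_, fun x hx hx' => h.adj_even hx (hmat.2 x hx'),
      fun x hx hx' => glue_mem (((h.mem_cases x).resolve_left hx).resolve_left hx')⟩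
    rcases h.adj_odds hx (hmat.2 x hx') with h1 | h1
    · exact h1
    · have := hmat.1 x
      rw [glue_mem h1] at this
      exact absurd this hx'
  have h1 : supp (glue C.verts id f₀) = supp f₀ \ C.verts := by
    ext x
    by_cases hxC : x ∈ C.verts
    · simp [supp, glue_mem hxC, hxC]
    · simp [supp, glue_notMem hxC, hxC]
  have h2 := hf₀'.ncard_supp h.disjoint
  have h3 := hf₀'.ncard_le hX
  have h4 := Set.ncard_inter_add_ncard_sdiff_eq_ncard (supp f₀) C.verts
  rw [hb.supp_inter hbw] at h4
  have h5 := Set.ncard_sdiff_singleton_add_one hw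
  rw [← h1] at h4
  have hmax : ∀ g, IsMat H g → (supp g).ncard + 1 = C.verts.ncard + 2 * (h.odds.ncard - d) →
      IsMaxMat H g := fun g hg hgc => hf₀.of_ncard_le hg (by omega)
  -- A largest matching between the sides that misses `x` extends to a maximum matching missing `y`
  -- too, so `xy` cannot be an edge.
  have hXC : ∀ x ∈ X, ∀ y ∈ C.verts, ¬ H.Adj x y := by
    intro x hxX y hy hadj
    obtain ⟨k, hk, hkx, hkd⟩ := hx x hxX
    obtain ⟨g, hg, hgy, hgx, hgc⟩ := h.exists_extend hk hy
    exact (hmax g hg (by omega)).not_adj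
      (by rw [hgx x (h.odds_notMem_cycle (hX hxX)), hkx]) hgy hadj
  -- A König cover: it meets all edges outside the cycle and has as many vertices as a largest
  -- matching between the sides has edges.
  let O : Set V := (h.odds \ X) ∪ (nbhd H X ∩ h.even)
  have hO : O.ncard + d = h.odds.ncard := by
    have h6 : O.ncard = (h.odds \ X).ncard + (nbhd H X ∩ h.even).ncard :=
      Set.ncard_union_eq (h.disjoint.mono Set.sdiff_subset Set.inter_subset_right)
    have h7 := Set.ncard_sdiff_add_ncard_of_subset hX
    omega
  have hcov : ∀ x ∈ h.odds, ∀ y, H.Adj x y → x ∈ O ∨ y ∈ O := by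
    intro x hxo y hxy
    by_cases hxX : x ∈ X
    · exact Or.inr (Or.inr ⟨⟨x, hxX, hxy⟩,
        (h.adj_odds hxo hxy).resolve_right fun hy => hXC x hxX y hy hxy⟩)
    · exact Or.inl (Or.inl ⟨hxo, hxX⟩)
  -- Matching edges that miss `O` lie on `C` and saturate at most `|C| - 1` vertices, so a maximum
  -- matching can afford to miss no vertex of `O`.
  have hsat : ∀ g, IsMaxMat H g → O ⊆ supp g ∧ (supp g).ncard + 1 = C.verts.ncard + 2 * O.ncard := by
    intro g hg
    have h6 := hg.1.ncard_supp_le (O := O) (T := {x | C.Adj x (g x)}) (by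
      intro v hv hvO hgvO
      have hadj := hg.1.2 v hv
      rcases h.mem_cases v with h7 | h7 | h7
      · rcases hcov v h7 _ hadj with h8 | h8
        · exact absurd h8 hvO
        · exact absurd h8 hgvO
      · rcases hcov _ (h.adj_even h7 hadj) _ hadj.symm with h8 | h8
        · exact absurd h8 hgvO
        · exact absurd h8 hvO
      · rcases h.adj_cycle h7 hadj with h8 | h8
        · rcases hcov _ h8 _ hadj.symm with h8 | h8
          · exact absurd h8 hgvO
          · exact absurd h8 hvO
        · exact h8)
    have h7 := (hg.1.ncard_adj_le h.odd).1
    have h8 := hg.2 m hm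
    have h9 : (O ∩ supp g).ncard ≤ O.ncard := Set.ncard_le_ncard Set.inter_subset_left
    refine ⟨?_, by omega⟩
    exact Set.inter_eq_left.1 (Set.eq_of_subset_of_ncard_le Set.inter_subset_left (by omega))
  -- A vertex of `X` would have an even neighbour. That neighbour is in `O`, hence always saturated,
  -- although even vertices belong to `D(H)`.
  have hX0 : X = ∅ := by
    rw [Set.eq_empty_iff_forall_notMem]
    intro x hxX
    obtain ⟨y, hy, hxy⟩ := h.exists_adj_even (hX hxX)
    obtain ⟨g, hg, hgy⟩ := (mem_geD_iff H y).1 (h.mem_geD_of_col hy.1)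
    exact (hsat g hg).1 (Or.inr ⟨⟨x, hxX, hxy⟩, hy⟩) hgy
  have hd0 : d = 0 := by
    rw [hX0, Set.ncard_empty] at hXd
    omega
  subst hd0
  have hOodds : O = h.odds := by
    simp [O, hX0, nbhd]
  rw [hOodds] at hsat
  refine ⟨hsat, f, hf, ?_⟩
  exact Set.inter_eq_left.1 (Set.eq_of_subset_of_ncard_le Set.inter_subset_left (by omega))

lemma mem_geD_iff_col [Finite V] (v : V) : v ∈ geD H ↔ col v = false := by
  constructor
  · intro hv
    obtain ⟨g, hg, hgv⟩ := (mem_geD_iff H v).1 hv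
    by_contra hc
    exact (h.structure_aux.1 g hg).1 (Bool.eq_true_of_not_eq_false hc) hgv
  · exact h.mem_geD_of_col

lemma mem_geA_iff_col [Finite V] (v : V) : v ∈ geA H ↔ col v = true := by
  constructor
  · intro hv
    by_contra hc
    exact hv.1 ((h.mem_geD_iff_col v).2 (Bool.eq_false_iff.2 hc))
  · intro hv
    obtain ⟨y, hy, hvy⟩ := h.exists_adj_even hv
    refine ⟨fun hv' => ?_, y, h.mem_geD_of_col hy.1, hvy⟩
    have := hv.symm.trans ((h.mem_geD_iff_col v).1 hv')
    exact absurd this (by decide)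

/-- Vertices of `S` in the odd class are paid for by their partners in the even class, and the cycle
contributes less than half of its vertices. -/
lemma indep_ncard_le [Finite V] {S : Set V} (hS : H.IsIndepSet S) :
    2 * S.ncard + 1 ≤ 2 * h.even.ncard + C.verts.ncard := by
  obtain ⟨-, f, hf, hfs⟩ := h.structure_aux
  have h1 := h.odd.two_mul_ncard_indep_lt hS
  have h2 : (S ∩ h.odds).ncard ≤ (h.even \ S).ncard := by
    refine Set.ncard_le_ncard_of_injOn f (fun x hx => ?_) hf.isMat.inj.injOn
    have hfx := hfs hx.2
    exact ⟨hf.left x hx.2 hfx, fun h' => hS hx.1 h' (Ne.symm hfx) (hf.isMat.2 x hfx)⟩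
  have h3 := Set.ncard_inter_add_ncard_sdiff_eq_ncard h.even S
  have h4 : S ⊆ (S ∩ h.odds) ∪ ((h.even ∩ S) ∪ (S ∩ C.verts)) := by
    intro x hx
    rcases h.mem_cases x with h5 | h5 | h5
    · exact Or.inl ⟨hx, h5⟩
    · exact Or.inr (Or.inl ⟨h5, hx⟩)
    · exact Or.inr (Or.inr ⟨hx, h5⟩)
  have h5 := Set.ncard_le_ncard h4
  have h6 := Set.ncard_union_le (S ∩ h.odds) ((h.even ∩ S) ∪ (S ∩ C.verts))
  have h7 := Set.ncard_union_le (h.even ∩ S) (S ∩ C.verts)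
  omega

lemma ncard_even_union [Finite V] {S : Set V} (hS : S ⊆ C.verts) :
    (h.even ∪ S).ncard = h.even.ncard + S.ncard :=
  Set.ncard_union_eq (Set.disjoint_left.2 fun _ hx hx' => hx.2 (hS hx'))

/-- Every vertex outside `A(H)` is in a maximum independent set that avoids `A(H)`. -/
lemma exists_maximum_indep [Finite V] {v : V} (hv : v ∉ h.odds) :
    ∃ S, H.IsIndepSet S ∧ 2 * S.ncard + 1 = 2 * h.even.ncard + C.verts.ncard ∧ v ∈ S ∧
      Disjoint S h.odds := by
  obtain ⟨x, w, hx, hw, hxw, hvx⟩ : ∃ x w, x ∈ C.verts ∧ w ∈ C.verts ∧ x ≠ w ∧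
      (v = x ∨ v ∈ h.even) := by
    rcases (h.mem_cases v).resolve_left hv with h1 | h1
    · obtain ⟨x, hx⟩ := h.odd.nonempty
      obtain ⟨w, hw, hwx⟩ := h.odd.exists_ne x
      exact ⟨x, w, hx, hw, hwx.symm, Or.inr h1⟩
    · obtain ⟨w, hw, hwx⟩ := h.odd.exists_ne v
      exact ⟨v, w, h1, hw, hwx.symm, Or.inl rfl⟩
  obtain ⟨S, hS, hSC, -, hxS, hSc⟩ := exists_indep_in_cycle h.odd h.uniq hw hx hxw
  refine ⟨h.even ∪ S, ?_, ?_, ?_, ?_⟩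
  · intro a ha b hb hab hadj
    have key : ∀ a ∈ h.even, ∀ b ∈ S, ¬ H.Adj a b := fun a ha b hb hadj =>
      h.odds_notMem_cycle (h.adj_even ha hadj) (hSC hb)
    rcases ha with ha | ha <;> rcases hb with hb | hb
    · exact h.indep_even ha hb hab hadj
    · exact key a ha b hb hadj
    · exact key b hb a ha hadj.symm
    · exact hS ha hb hab hadj
  · rw [h.ncard_even_union hSC]
    omega
  · rcases hvx with rfl | h1
    · exact Or.inr hxS
    · exact Or.inl h1
  · refine Set.disjoint_left.2 fun y hy hy' => ?_
    rcases hy with hy | hy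
    · exact Set.disjoint_left.1 h.disjoint hy' hy
    · exact h.odds_notMem_cycle hy' (hSC hy)

lemma two_mul_indepNum [Finite V] : 2 * H.indepNum + 1 = 2 * h.even.ncard + C.verts.ncard := by
  obtain ⟨v, hv⟩ := h.odd.nonempty
  obtain ⟨S, hS, hSc, -⟩ := h.exists_maximum_indep (v := v) fun h' => h.odds_notMem_cycle h' hv
  obtain ⟨T, hT, hTc⟩ := exists_indep_ncard_eq H
  have h1 := h.indep_ncard_le hT
  have h2 := ncard_le_indepNum hS
  omega

lemma nbhd_even : nbhd H h.even ⊆ h.odds := by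
  rintro v ⟨u, hu, huv⟩
  exact h.adj_even hu huv

/-- Split `X` and `N(X)` into odd class, even class and cycle. Odd vertices of `X` inject into even
neighbours, its cycle vertices have enough neighbours on the cycle, and even vertices exceed their
odd neighbours by at most the number of even vertices that the matching leaves unsaturated. -/
lemma critDiff_eq_and [Finite V] : critDiff H = h.even.ncard - h.odds.ncard ∧
    diff H h.even = critDiff H := by
  obtain ⟨-, f, hf, hfs⟩ := h.structure_aux
  have h1 : ∀ X, diff H X ≤ h.even.ncard - h.odds.ncard := by
    intro X
    have h2 : (X ∩ h.odds).ncard ≤ (nbhd H X ∩ h.even).ncard := by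
      refine Set.ncard_le_ncard_of_injOn f (fun x hx => ?_) hf.isMat.inj.injOn
      have hfx := hfs hx.2
      exact ⟨⟨x, hx.1, hf.isMat.2 x hfx⟩, hf.left x hx.2 hfx⟩
    have h3 := hf.symm.ncard_le (Y := X ∩ h.even) Set.inter_subset_right
    have h4 : (nbhd H (X ∩ h.even) ∩ h.odds).ncard ≤ (nbhd H X ∩ h.odds).ncard :=
      Set.ncard_le_ncard (Set.inter_subset_inter_left _ (nbhd_mono H Set.inter_subset_left))
    have h5 := hf.ncard_supp h.disjoint
    have h6 := hf.symm.ncard_supp h.disjoint.symm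
    rw [Set.inter_eq_left.2 hfs] at h5
    have h7 := h.odd.ncard_le_nbhd (Y := X ∩ C.verts) Set.inter_subset_right
    have h8 : (nbhd H (X ∩ C.verts) ∩ C.verts).ncard ≤ (nbhd H X ∩ C.verts).ncard :=
      Set.ncard_le_ncard (Set.inter_subset_inter_left _ (nbhd_mono H Set.inter_subset_left))
    have hsplit : ∀ Y : Set V,
        Y.ncard = (Y ∩ h.odds).ncard + (Y ∩ h.even).ncard + (Y ∩ C.verts).ncard := by
      intro Y
      rw [← Set.ncard_union_eq (h.disjoint.mono Set.inter_subset_right Set.inter_subset_right),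
        ← Set.ncard_union_eq, ← Set.inter_union_distrib_left, ← Set.inter_union_distrib_left]
      · congr 1
        ext x
        have := h.mem_cases x
        simp only [Set.mem_inter_iff, Set.mem_union]
        tauto
      · refine Set.disjoint_left.2 fun x hx hx' => ?_
        rcases hx with hx | hx
        · exact h.odds_notMem_cycle hx.2 hx'.2
        · exact hx.2.2 hx'.2
    have h9 := hsplit X
    have h10 := hsplit (nbhd H X)
    unfold diff
    omega
  have h2 : (h.even.ncard - h.odds.ncard : ℤ) ≤ diff H h.even := by
    have := Set.ncard_le_ncard h.nbhd_even
    unfold diff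
    omega
  have h3 := critDiff_eq H h1 ⟨_, h2⟩
  exact ⟨h3, le_antisymm (diff_le_critDiff H _) (h3 ▸ h2)⟩

lemma two_mul_indepNum_add_one [Finite V] :
    (2 * H.indepNum + 1 : ℤ) = critDiff H + Nat.card V := by
  have h1 := h.two_mul_indepNum
  have h2 := h.critDiff_eq_and.1
  have h3 := h.card_eq
  omega

/-- The odd vertices outside `N(ker)` that hang on the cycle at the same place as `v` form a set `T`
with at most `|T|` even neighbours, so they may replace those neighbours in the standard maximum
independent set. They touch the cycle in at most one vertex, and half of the cycle can be chosen to
avoid it. -/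
lemma mem_corona_of_odds [Finite V] {v : V} (hv : v ∈ h.odds) (hvk : v ∉ nbhd H (kernel H)) :
    v ∈ corona H := by
  obtain ⟨-, f, hf, hfs⟩ := h.structure_aux
  obtain ⟨hd, hde⟩ := h.critDiff_eq_and
  have hker : kernel H ⊆ h.even :=
    kernel_subset ((isCriticalIndep_iff H _).2 ⟨h.indep_even, hde⟩)
  have hkd := diff_kernel H
  have hNk : nbhd H (kernel H) ⊆ h.odds := (nbhd_mono H hker).trans h.nbhd_even
  choose! g hg1 hg2 hg3 using fun w (hw : w ∈ C.verts) => exists_separating_cycle h.odd h.uniq hw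
  let T₀ : Set V := h.odds \ nbhd H (kernel H)
  let T : Set V := {t | t ∈ T₀ ∧ ∀ w ∈ C.verts, g w t = g w v}
  have hT₀ : T₀ ⊆ h.odds := Set.sdiff_subset
  have hTT : T ⊆ T₀ := fun t ht => ht.1
  have hvT : v ∈ T := ⟨⟨hv, hvk⟩, fun _ _ => rfl⟩
  have hmap : ∀ Y ⊆ h.odds, Y.ncard ≤ (nbhd H Y ∩ h.even).ncard := fun Y hY =>
    Set.ncard_le_ncard_of_injOn f (fun x hx => ⟨⟨x, hx, hf.isMat.2 x (hfs (hY hx))⟩,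
      hf.left x (hY hx) (hfs (hY hx))⟩) hf.isMat.inj.injOn
  have hdisj : Disjoint (nbhd H T ∩ h.even) (nbhd H (T₀ \ T) ∩ h.even) := by
    refine Set.disjoint_left.2 fun y hy hy' => ?_
    obtain ⟨⟨t, ht, hty⟩, hye⟩ := hy
    obtain ⟨⟨t', ht', hty'⟩, -⟩ := hy'
    refine ht'.2 ⟨ht'.1, fun w hw => ?_⟩
    rw [← ht.2 w hw, hg3 w hw t y hty fun h' => hye.2 (C.edge_vert h'.symm),
      hg3 w hw t' y hty' fun h' => hye.2 (C.edge_vert h'.symm)]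
  have hsub : (nbhd H T ∩ h.even) ∪ (nbhd H (T₀ \ T) ∩ h.even) ⊆ h.even \ kernel H := by
    have key : ∀ Y ⊆ T₀, nbhd H Y ∩ h.even ⊆ h.even \ kernel H := by
      rintro Y hY y ⟨⟨t, ht, hty⟩, hye⟩
      exact ⟨hye, fun hyk => (hY ht).2 ⟨y, hyk, hty.symm⟩⟩
    exact Set.union_subset (key _ hTT) (key _ Set.sdiff_subset)
  have h1 := Set.ncard_le_ncard hsub
  rw [Set.ncard_union_eq hdisj] at h1
  have h2 := hmap (T₀ \ T) (Set.sdiff_subset.trans hT₀)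
  have h3 := Set.ncard_sdiff_add_ncard_of_subset hTT
  have h4 := Set.ncard_sdiff_add_ncard_of_subset hker
  have h5 := Set.ncard_sdiff_add_ncard_of_subset hNk
  -- As `ker` attains `d = |even| - |odds|`, the sets `even \ ker` and `T₀` are equally large. The
  -- neighbours of `T₀ \ T` use up at least `|T₀ \ T|` of the former and are disjoint from those of
  -- `T`.
  have h6 : (nbhd H T ∩ h.even).ncard ≤ T.ncard := by
    unfold diff at hkd
    have : T₀.ncard = (h.odds \ nbhd H (kernel H)).ncard := rfl
    omega
  -- Two different attachment vertices on the cycle would be told apart by `g w`, which is constant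
  -- on `T`.
  obtain ⟨w, hw, hwT⟩ : ∃ w ∈ C.verts, ∀ t ∈ T, ∀ y ∈ C.verts, H.Adj t y → y = w := by
    by_cases hex : ∃ t ∈ T, ∃ w ∈ C.verts, H.Adj t w
    · obtain ⟨t, ht, w, hw, htw⟩ := hex
      refine ⟨w, hw, fun t' ht' y hy hty => ?_⟩
      by_contra hyw
      have e1 := hg3 w hw t w htw fun h' => h.odds_notMem_cycle (hT₀ (hTT ht)) (C.edge_vert h')
      have e2 := hg3 w hw t' y hty fun h' => h.odds_notMem_cycle (hT₀ (hTT ht')) (C.edge_vert h')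
      rw [ht.2 w hw, hg1 w hw] at e1
      rw [ht'.2 w hw, hg2 w hw y hy hyw, e1] at e2
      exact absurd e2 (by decide)
    · obtain ⟨w, hw⟩ := h.odd.nonempty
      exact ⟨w, hw, fun t ht y hy hty => absurd ⟨t, ht, y, hy, hty⟩ hex⟩
  obtain ⟨x, hx, hxw⟩ := h.odd.exists_ne w
  obtain ⟨S, hS, hSC, hwS, -, hSc⟩ := exists_indep_in_cycle h.odd h.uniq hw hx hxw
  have hcE : ∀ a ∈ h.even, ∀ b ∈ S, ¬ H.Adj a b := fun a ha b hb hadj =>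
    h.odds_notMem_cycle (h.adj_even ha hadj) (hSC hb)
  have hcT : ∀ a ∈ T, ∀ b ∈ S, ¬ H.Adj a b := fun a ha b hb hadj =>
    hwS (hwT a ha b (hSC hb) hadj ▸ hb)
  have hcTE : ∀ a ∈ T, ∀ b ∈ h.even \ nbhd H T, ¬ H.Adj a b := fun a ha b hb hadj =>
    hb.2 ⟨a, ha, hadj⟩
  have hind : H.IsIndepSet (T ∪ ((h.even \ nbhd H T) ∪ S)) := by
    intro a ha b hb hab hadj
    rcases ha with ha | ha | ha <;> rcases hb with hb | hb | hb
    · exact h.indep_odds (hT₀ (hTT ha)) (hT₀ (hTT hb)) hab hadj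
    · exact hcTE a ha b hb hadj
    · exact hcT a ha b hb hadj
    · exact hcTE b hb a ha hadj.symm
    · exact h.indep_even ha.1 hb.1 hab hadj
    · exact hcE a ha.1 b hb hadj
    · exact hcT b hb a ha hadj.symm
    · exact hcE b hb.1 a ha hadj.symm
    · exact hS ha hb hab hadj
  have hc1 : (T ∪ ((h.even \ nbhd H T) ∪ S)).ncard =
      T.ncard + ((h.even \ nbhd H T).ncard + S.ncard) := by
    rw [Set.ncard_union_eq, Set.ncard_union_eq]
    · exact Set.disjoint_left.2 fun y hy hy' => hy.1.2 (hSC hy')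
    · refine Set.disjoint_left.2 fun y hy hy' => ?_
      rcases hy' with hy' | hy'
      · exact Set.disjoint_left.1 h.disjoint (hT₀ (hTT hy)) hy'.1
      · exact h.odds_notMem_cycle (hT₀ (hTT hy)) (hSC hy')
  have hc2 := Set.ncard_inter_add_ncard_sdiff_eq_ncard h.even (nbhd H T)
  rw [Set.inter_comm] at hc2
  have hc3 := h.two_mul_indepNum
  have hc4 := ncard_le_indepNum hind
  exact (mem_corona_iff H v).2 ⟨_, hind, by omega, Or.inl hvT⟩

lemma ncard_eq_indepNum [Finite V] {S : Set V}
    (hS : 2 * S.ncard + 1 = 2 * h.even.ncard + C.verts.ncard) : S.ncard = H.indepNum := by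
  have := h.two_mul_indepNum
  omega

end IsReachGraph

lemma exists_isReachGraph {H : SimpleGraph V} (hab : IsAlmostBipartite H)
    (hr : ∀ C, IsOddCycle H C → reachSet H C = Set.univ) :
    ∃ (C : H.Subgraph) (col : V → Bool), IsReachGraph H C col := by
  obtain ⟨C, hC, huniq⟩ := hab
  have hC' := hC
  obtain ⟨v, c, hc, ho, hcC⟩ := hC'
  obtain ⟨col, h1, h2⟩ := exists_contracted_coloring hc ho (edges_subset_of_uniq huniq hcC)
  refine ⟨C, col, hC, huniq, hr C hC, fun x hx => h1 x ?_, fun x y hxy hn => h2 x y hxy fun he => hn ?_⟩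
  · rwa [← Walk.mem_verts_toSubgraph, hcC]
  · rwa [← hcC, ← Subgraph.mem_edgeSet, Walk.mem_edges_toSubgraph]

lemma exists_sides {H : SimpleGraph V} (hH : H.IsBipartite) :
    ∃ A : Set V, H.IsIndepSet A ∧ H.IsIndepSet Aᶜ := by
  obtain ⟨c⟩ := hH
  refine ⟨{v | c v = 0}, fun u hu v hv _ huv => c.valid huv (hu.trans hv.symm),
    fun u hu v hv _ huv => c.valid huv ?_⟩
  have h1 : c u ≠ 0 := hu
  have h2 : c v ≠ 0 := hv
  omega

/-! ### Graphs whose vertex set is partitioned -/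

section partition

variable {ι : Type*} {Q : ι → Set V}

/-- The union of subsets of the parts. -/
def unionParts (S : ∀ t, Set (Q t)) : Set V := ⋃ t, Subtype.val '' S t

lemma mem_unionParts (S : ∀ t, Set (Q t)) {v : V} :
    v ∈ unionParts S ↔ ∃ t, ∃ h : v ∈ Q t, ⟨v, h⟩ ∈ S t := by
  simp [unionParts]

lemma preimage_unionParts (hQ : Pairwise (Function.onFun Disjoint Q)) (S : ∀ t, Set (Q t)) (t : ι) :
    Subtype.val ⁻¹' unionParts S = S t := by
  ext ⟨v, hv⟩
  rw [Set.mem_preimage, mem_unionParts]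
  constructor
  · rintro ⟨s, hs, h⟩
    by_cases hst : s = t
    · subst hst
      exact h
    · exact absurd hv (Set.disjoint_left.1 (hQ hst) hs)
  · exact fun h => ⟨t, hv, h⟩

lemma ncard_eq_sum [Finite V] [Fintype ι] (hQ : Pairwise (Function.onFun Disjoint Q))
    (hcov : ⋃ t, Q t = Set.univ) (Y : Set V) :
    Y.ncard = ∑ t, (Subtype.val ⁻¹' Y : Set (Q t)).ncard := by
  have h1 : Y = ⋃ t, Subtype.val '' (Subtype.val ⁻¹' Y : Set (Q t)) := by
    ext v
    have hv : v ∈ ⋃ t, Q t := hcov ▸ Set.mem_univ v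
    simp only [Set.mem_iUnion] at hv
    simp [hv]
  have h2 : Pairwise (Function.onFun Disjoint
      fun t => Subtype.val '' (Subtype.val ⁻¹' Y : Set (Q t))) := by
    intro s t hst
    exact (hQ hst).mono (Subtype.coe_image_subset _ _) (Subtype.coe_image_subset _ _)
  conv_lhs => rw [h1]
  rw [Set.ncard_iUnion_of_finite (fun t => Set.toFinite _) h2, finsum_eq_sum_of_fintype]
  exact Finset.sum_congr rfl fun t _ => Set.ncard_image_of_injective _ Subtype.val_injective

variable (G : SimpleGraph V)

lemma indep_preimage {S : Set V} (hS : G.IsIndepSet S) (W : Set V) :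
    (G.induce W).IsIndepSet (Subtype.val ⁻¹' S) := fun _ hu _ hv huv hadj =>
  hS hu hv (fun h => huv (Subtype.ext h)) hadj

lemma nbhd_induce_subset (Y W : Set V) :
    nbhd (G.induce W) (Subtype.val ⁻¹' Y) ⊆ Subtype.val ⁻¹' nbhd G Y := by
  rintro v ⟨u, hu, huv⟩
  exact ⟨u, hu, huv⟩

/-- Passing to the parts can only lose neighbours. -/
lemma diff_le_sum [Finite V] [Fintype ι] (hQ : Pairwise (Function.onFun Disjoint Q))
    (hcov : ⋃ t, Q t = Set.univ) (Y : Set V) :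
    diff G Y ≤ ∑ t, diff (G.induce (Q t)) (Subtype.val ⁻¹' Y) := by
  unfold diff
  rw [Finset.sum_sub_distrib, ncard_eq_sum hQ hcov Y, ncard_eq_sum hQ hcov (nbhd G Y)]
  push_cast
  refine sub_le_sub_left (Finset.sum_le_sum fun t _ => ?_) _
  exact_mod_cast Set.ncard_le_ncard (nbhd_induce_subset G Y (Q t))

/-- Optimal sets of the parts that avoid the boundary gain no neighbours in other parts, so their
union attains the sum. -/
lemma critDiff_eq_sum [Finite V] [Fintype ι] (hQ : Pairwise (Function.onFun Disjoint Q))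
    (hcov : ⋃ t, Q t = Set.univ)
    (h : ∀ t, ∃ Y : Set (Q t), diff (G.induce (Q t)) Y = critDiff (G.induce (Q t)) ∧
      ∀ v ∈ Y, v.1 ∉ boundary G (Q t)) :
    critDiff G = ∑ t, critDiff (G.induce (Q t)) := by
  choose Y hY hYb using h
  refine critDiff_eq G (fun X => (diff_le_sum G hQ hcov X).trans
    (Finset.sum_le_sum fun t _ => diff_le_critDiff _ _)) ⟨unionParts Y, ?_⟩
  rw [← Finset.sum_congr rfl fun t _ => hY t]
  unfold diff
  rw [Finset.sum_sub_distrib, ncard_eq_sum hQ hcov (unionParts Y),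
    ncard_eq_sum hQ hcov (nbhd G (unionParts Y))]
  push_cast
  have h1 : ∀ t, (Subtype.val ⁻¹' nbhd G (unionParts Y) : Set (Q t)) ⊆
      nbhd (G.induce (Q t)) (Y t) := by
    rintro t ⟨v, hv⟩ ⟨u, hu, huv⟩
    obtain ⟨s, hs, h⟩ := (mem_unionParts Y).1 hu
    by_cases hst : s = t
    · subst hst
      exact ⟨_, h, huv⟩
    · refine absurd ⟨hs, v, fun hvs => ?_, huv⟩ (hYb s _ h)
      exact Set.disjoint_left.1 (hQ hst) hvs hv
  refine sub_le_sub (Finset.sum_le_sum fun t _ => ?_) (Finset.sum_le_sum fun t _ => ?_)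
  · rw [preimage_unionParts hQ]
  · exact_mod_cast Set.ncard_le_ncard (h1 t)

lemma indepNum_le_sum [Finite V] [Fintype ι] (hQ : Pairwise (Function.onFun Disjoint Q))
    (hcov : ⋃ t, Q t = Set.univ) : G.indepNum ≤ ∑ t, (G.induce (Q t)).indepNum := by
  obtain ⟨S, hS, hSc⟩ := exists_indep_ncard_eq G
  rw [← hSc, ncard_eq_sum hQ hcov S]
  exact Finset.sum_le_sum fun t _ => ncard_le_indepNum (indep_preimage G hS _)

lemma indep_unionParts (S : ∀ t, Set (Q t)) (hS : ∀ t, (G.induce (Q t)).IsIndepSet (S t))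
    (hcross : ∀ s t, s ≠ t → ∀ u ∈ S s, ∀ v ∈ S t, ¬ G.Adj u.1 v.1) :
    G.IsIndepSet (unionParts S) := by
  intro u hu v hv huv hadj
  obtain ⟨s, hs, h⟩ := (mem_unionParts S).1 hu
  obtain ⟨t, ht, h'⟩ := (mem_unionParts S).1 hv
  by_cases hst : s = t
  · subst hst
    exact hS s h h' (fun h => huv (congrArg Subtype.val h)) hadj
  · exact hcross s t hst _ h _ h' hadj

lemma indepNum_eq_sum [Finite V] [Fintype ι] (hQ : Pairwise (Function.onFun Disjoint Q))
    (hcov : ⋃ t, Q t = Set.univ) (S : ∀ t, Set (Q t))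
    (hS : ∀ t, (G.induce (Q t)).IsIndepSet (S t))
    (hSc : ∀ t, (S t).ncard = (G.induce (Q t)).indepNum)
    (hcross : ∀ s t, s ≠ t → ∀ u ∈ S s, ∀ v ∈ S t, ¬ G.Adj u.1 v.1) :
    G.indepNum = ∑ t, (G.induce (Q t)).indepNum ∧ (unionParts S).ncard = G.indepNum := by
  have h1 : (unionParts S).ncard = ∑ t, (G.induce (Q t)).indepNum := by
    rw [ncard_eq_sum hQ hcov]
    exact Finset.sum_congr rfl fun t _ => by rw [preimage_unionParts hQ, hSc]
  have h2 := ncard_le_indepNum (indep_unionParts G S hS hcross)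
  have h3 := indepNum_le_sum G hQ hcov
  omega

/-- The differences of the traces of `ker(G)` sum to at least `d(G)`, the sum of the maxima, so
every trace is critical in its part. -/
lemma image_kernel_subset [Finite V] [Fintype ι] (hQ : Pairwise (Function.onFun Disjoint Q))
    (hcov : ⋃ t, Q t = Set.univ) (hd : critDiff G = ∑ t, critDiff (G.induce (Q t))) (t : ι) :
    Subtype.val '' kernel (G.induce (Q t)) ⊆ kernel G := by
  have hk := isCriticalIndep_kernel G
  have h1 := diff_le_sum G hQ hcov (kernel G)
  rw [diff_kernel, hd] at h1
  have h2 : ∀ s ∈ Finset.univ, diff (G.induce (Q s)) (Subtype.val ⁻¹' kernel G) ≤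
      critDiff (G.induce (Q s)) := fun s _ => diff_le_critDiff _ _
  have h3 := (Finset.sum_eq_sum_iff_of_le h2).1 (le_antisymm (Finset.sum_le_sum h2) h1) t
    (Finset.mem_univ t)
  rintro _ ⟨v, hv, rfl⟩
  exact kernel_subset ((isCriticalIndep_iff _ _).2 ⟨indep_preimage G hk.1 _, h3⟩) hv

end partition

/-! ### BAB-graphs -/

section BAB

variable {G : SimpleGraph V} {k : ℕ} {B : Set V} {P : Fin k → Set V}

/-- The parts of a BAB-graph. -/
def babParts (B : Set V) (P : Fin k → Set V) : Option (Fin k) → Set V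
  | none => B
  | some i => P i

lemma pairwise_disjoint_babParts (h1 : ∀ i, Disjoint B (P i))
    (h2 : ∀ i j, i ≠ j → Disjoint (P i) (P j)) :
    Pairwise (Function.onFun Disjoint (babParts B P)) := by
  rintro (_ | i) (_ | j) hij
  · exact absurd rfl hij
  · exact h1 j
  · exact (h1 i).symm
  · exact h2 i j fun h => hij (by rw [h])

lemma iUnion_babParts (h : B ∪ (⋃ i, P i) = Set.univ) : ⋃ t, babParts B P t = Set.univ := by
  rw [← h]
  ext v
  simp [babParts, Option.exists]

variable (h : IsBAB G B P)

include h

lemma IsBAB.pairwise_disjoint : Pairwise (Function.onFun Disjoint (babParts B P)) :=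
  pairwise_disjoint_babParts h.disjoint_base h.disjoint_parts

lemma IsBAB.iUnion_parts : ⋃ t, babParts B P t = Set.univ := iUnion_babParts h.cover

lemma IsBAB.exists_isReachGraph (i : Fin k) :
    ∃ C col, IsReachGraph (G.induce (P i)) C col :=
  BABGraph.exists_isReachGraph (h.almostBipartite i) (h.reach i)

lemma IsBAB.notMem_boundary_base {v : B} (hv : v ∈ geD (G.induce B)) : v.1 ∉ boundary G B := by
  intro hb
  obtain ⟨w, hw, hwv⟩ := h.boundary_base hb
  rw [Subtype.val_injective hwv] at hw
  rcases hw with hw | hw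
  · exact hw.1 hv
  · exact hw (Or.inl hv)

lemma IsBAB.notMem_boundary_part {i : Fin k} {v : P i} (hv : v ∉ geA (G.induce (P i))) :
    v.1 ∉ boundary G (P i) := by
  intro hb
  obtain ⟨w, hw, hwv⟩ := h.boundary_parts i hb
  rw [Subtype.val_injective hwv] at hw
  exact hv hw

lemma IsBAB.critDiff_eq [Finite V] :
    critDiff G = ∑ t, critDiff (G.induce (babParts B P t)) := by
  refine critDiff_eq_sum G h.pairwise_disjoint h.iUnion_parts ?_
  rintro (_ | i)
  · obtain ⟨A, hA, hA'⟩ := exists_sides h.bipartite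
    obtain ⟨-, Y, hY, hYd⟩ := bipartite_exists_critical hA hA'
    exact ⟨Y, hYd, fun v hv => h.notMem_boundary_base (hY hv)⟩
  · obtain ⟨C, col, hr⟩ := h.exists_isReachGraph i
    refine ⟨hr.even, hr.critDiff_eq_and.2, fun v hv => h.notMem_boundary_part fun hv' => ?_⟩
    exact Set.disjoint_left.1 hr.disjoint ((hr.mem_geA_iff_col v).1 hv') hv

lemma IsBAB.not_adj_parts {i : Fin k} {t : Option (Fin k)} (hit : some i ≠ t) {u : P i}
    {v : babParts B P t} (hu : u ∉ geA (G.induce (P i))) : ¬ G.Adj u.1 v.1 := by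
  intro hadj
  refine h.notMem_boundary_part hu ⟨u.2, v.1, fun hv => ?_, hadj⟩
  exact Set.disjoint_left.1 (h.pairwise_disjoint hit) hv v.2

lemma IsBAB.exists_part_indep [Finite V] (i : Fin k) {v : P i} (hv : v ∉ geA (G.induce (P i))) :
    ∃ S, (G.induce (P i)).IsIndepSet S ∧ S.ncard = (G.induce (P i)).indepNum ∧ v ∈ S ∧
      ∀ u ∈ S, u ∉ geA (G.induce (P i)) := by
  obtain ⟨C, col, hr⟩ := h.exists_isReachGraph i
  rw [hr.mem_geA_iff_col] at hv
  obtain ⟨S, hS, hSc, hvS, hSo⟩ := hr.exists_maximum_indep hv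
  exact ⟨S, hS, hr.ncard_eq_indepNum hSc, hvS, fun u hu hu' =>
    Set.disjoint_left.1 hSo hu ((hr.mem_geA_iff_col u).1 hu')⟩

lemma IsBAB.exists_part_indep' [Finite V] (i : Fin k) :
    ∃ S, (G.induce (P i)).IsIndepSet S ∧ S.ncard = (G.induce (P i)).indepNum ∧
      ∀ u ∈ S, u ∉ geA (G.induce (P i)) := by
  obtain ⟨C, col, hr⟩ := h.exists_isReachGraph i
  obtain ⟨v, hv⟩ := hr.odd.nonempty
  obtain ⟨S, h1, h2, -, h3⟩ := h.exists_part_indep i (v := v) fun hv' =>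
    hr.odds_notMem_cycle ((hr.mem_geA_iff_col v).1 hv') hv
  exact ⟨S, h1, h2, h3⟩

/-- Maximum independent sets of the parts, all but possibly the base avoiding the boundary,
form a maximum independent set. -/
lemma IsBAB.glue_indep [Finite V] (S : ∀ t, Set (babParts B P t))
    (hS : ∀ t, (G.induce (babParts B P t)).IsIndepSet (S t))
    (hSc : ∀ t, (S t).ncard = (G.induce (babParts B P t)).indepNum)
    (hSa : ∀ i, ∀ u ∈ S (some i), u ∉ geA (G.induce (P i))) :
    G.indepNum = ∑ t, (G.induce (babParts B P t)).indepNum ∧ G.IsIndepSet (unionParts S) ∧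
      (unionParts S).ncard = G.indepNum := by
  have hcross : ∀ s t, s ≠ t → ∀ u ∈ S s, ∀ v ∈ S t, ¬ G.Adj u.1 v.1 := by
    rintro (_ | i) (_ | j) hst u hu v hv hadj
    · exact hst rfl
    · exact h.not_adj_parts hst.symm (hSa j v hv) hadj.symm
    · exact h.not_adj_parts hst (hSa i u hu) hadj
    · exact h.not_adj_parts hst (hSa i u hu) hadj
  have h1 := indepNum_eq_sum G h.pairwise_disjoint h.iUnion_parts S hS hSc hcross
  exact ⟨h1.1, indep_unionParts G S hS hcross, h1.2⟩

lemma IsBAB.indepNum_eq [Finite V] :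
    G.indepNum = ∑ t, (G.induce (babParts B P t)).indepNum := by
  obtain ⟨SB, hSB, hSBc⟩ := exists_indep_ncard_eq (G.induce B)
  choose S hS hSc hSa using h.exists_part_indep'
  exact (h.glue_indep (fun t => match t with | none => SB | some i => S i)
    (by rintro (_ | i); exacts [hSB, hS i]) (by rintro (_ | i); exacts [hSBc, hSc i])
    (fun i => hSa i)).1

/-- `2α(G) + k = d(G) + |V(G)|` for BAB-graphs. -/
theorem IsBAB.two_mul_indepNum_add [Finite V] :
    ((2 * G.indepNum + k : ℕ) : ℤ) = critDiff G + (Nat.card V : ℤ) := by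
  have h1 : Nat.card V = ∑ t, Nat.card (babParts B P t) := by
    have := ncard_eq_sum h.pairwise_disjoint h.iUnion_parts Set.univ
    simpa [Set.ncard_univ] using this
  rw [h.critDiff_eq, h.indepNum_eq, h1, Fintype.sum_option, Fintype.sum_option, Fintype.sum_option]
  obtain ⟨A, hA, hA'⟩ := exists_sides h.bipartite
  have h2 := bipartite_two_mul_indepNum hA hA'
  have h3 : ∀ i, (2 * (G.induce (P i)).indepNum + 1 : ℤ) =
      critDiff (G.induce (P i)) + Nat.card (P i) := fun i => by
    obtain ⟨C, col, hr⟩ := h.exists_isReachGraph i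
    exact hr.two_mul_indepNum_add_one
  have h4 := Finset.sum_congr rfl fun i (_ : i ∈ Finset.univ) => h3 i
  rw [Finset.sum_add_distrib, Finset.sum_add_distrib, ← Finset.mul_sum] at h4
  simp only [Finset.sum_const, Finset.card_univ, Fintype.card_fin, nsmul_eq_mul, mul_one] at h4
  simp only [babParts]
  push_cast
  linarith

/-- `|ker(G)| + |corona(G)| ≤ 2α(G) + k` for BAB-graphs. -/
theorem IsBAB.ncard_kernel_add_ncard_corona_le [Finite V] :
    (kernel G).ncard + (corona G).ncard ≤ 2 * G.indepNum + k := by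
  have h1 := BABGraph.ncard_kernel_add_ncard_corona_le G
  have h2 := h.two_mul_indepNum_add
  omega

end BAB

/-! ### Odd cycles of induced subgraphs, and a colouring around one part. -/

section induce

variable {G : SimpleGraph V} {W : Set V}

lemma IsOddCycle.map_induce {C : (G.induce W).Subgraph} (hC : IsOddCycle (G.induce W) C) :
    IsOddCycle G (C.map (Embedding.induce W).toHom) := by
  obtain ⟨v, c, hc, ho, rfl⟩ := hC
  refine ⟨_, c.map (Embedding.induce W).toHom, hc.map Subtype.val_injective, ?_, ?_⟩
  · rwa [Walk.length_map]
  · rw [Walk.toSubgraph_map]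

lemma IsOddCycle.exists_induce {C : G.Subgraph} (hC : IsOddCycle G C) (hW : C.verts ⊆ W) :
    ∃ C', IsOddCycle (G.induce W) C' ∧ C'.map (Embedding.induce W).toHom = C := by
  obtain ⟨v, c, hc, ho, rfl⟩ := hC
  have hs : ∀ x ∈ c.support, x ∈ W := fun x hx => hW (by rwa [Walk.mem_verts_toSubgraph])
  have hm := c.map_induce hs
  refine ⟨(c.induce W hs).toSubgraph, ⟨_, c.induce W hs, ?_, ?_, rfl⟩, ?_⟩
  · rw [← hm] at hc
    exact hc.of_map
  · rwa [← Walk.length_map (Embedding.induce W).toHom, hm]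
  · rw [← Walk.toSubgraph_map, hm]
    rfl

lemma map_induce_adj {C : (G.induce W).Subgraph} {u v : W} :
    (C.map (Embedding.induce W).toHom).Adj u.1 v.1 ↔ C.Adj u v := by
  constructor
  · rintro ⟨u', v', h, hu, hv⟩
    rwa [← Subtype.val_injective hu, ← Subtype.val_injective hv]
  · exact fun h => ⟨u, v, h, rfl, rfl⟩

lemma map_induce_verts {C : (G.induce W).Subgraph} {u : W} :
    u.1 ∈ (C.map (Embedding.induce W).toHom).verts ↔ u ∈ C.verts := by
  constructor
  · rintro ⟨u', h, hu⟩
    rwa [← Subtype.val_injective hu]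
  · exact fun h => ⟨u, h, rfl⟩

lemma map_induce_inj {C C' : (G.induce W).Subgraph}
    (h : C.map (Embedding.induce W).toHom = C'.map (Embedding.induce W).toHom) : C = C' := by
  ext u v
  · rw [← map_induce_verts, h, map_induce_verts]
  · rw [← map_induce_adj, h, map_induce_adj]

end induce

/-- The edges of `G` inside `Z`. -/
def within (G : SimpleGraph V) (Z : Set V) : SimpleGraph V where
  Adj u v := G.Adj u v ∧ u ∈ Z ∧ v ∈ Z
  symm := ⟨fun _ _ h => ⟨h.1.symm, h.2.2, h.2.1⟩⟩
  loopless := ⟨fun _ h => h.1.ne rfl⟩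

lemma within_le (G : SimpleGraph V) (Z : Set V) : within G Z ≤ G := fun _ _ h => h.1

/-- A colouring for an odd cycle in `P` that is the only one inside `Z ⊇ P`. -/
lemma exists_coloring_within {G : SimpleGraph V} {P Z : Set V} (hPZ : P ⊆ Z)
    {C : (G.induce P).Subgraph} (hC : IsOddCycle (G.induce P) C)
    (huniq : ∀ D, IsOddCycle G D → D.verts ⊆ Z → D = C.map (Embedding.induce P).toHom) :
    ∃ col : V → Bool, (∀ x ∈ C.verts, col x.1 = false) ∧
      (∀ x y : P, G.Adj x.1 y.1 → ¬ C.Adj x y → col x.1 ≠ col y.1) ∧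
      ∀ u v, G.Adj u v → u ∈ Z → v ∈ Z → u ∉ P → col u ≠ col v := by
  obtain ⟨v, c, hc, ho, rfl⟩ := hC
  -- `within G Z` keeps all of `V` as its vertex set, so the colouring is defined on `V` and can be
  -- used on the base and on the part alike.
  let φ : G.induce P →g within G Z := ⟨Subtype.val, fun {a b} h => ⟨h, hPZ a.2, hPZ b.2⟩⟩
  have hφ : Function.Injective φ := Subtype.val_injective
  have he : ∀ x y : P, s(x.1, y.1) ∈ (c.map φ).edges → c.toSubgraph.Adj x y := by
    intro x y h
    rw [Walk.edges_map, List.mem_map] at h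
    obtain ⟨e, he, h'⟩ := h
    have h2 : e = s(x, y) := Sym2.map.injective hφ (by rw [h']; rfl)
    rw [← Subgraph.mem_edgeSet, Walk.mem_edges_toSubgraph, ← h2]
    exact he
  obtain ⟨col, h1, h2⟩ := exists_contracted_coloring (c := c.map φ) (hc.map hφ)
    (by rwa [Walk.length_map]) (by
      intro w c' hc' ho' e he
      have hZ : ∀ x ∈ c'.support, x ∈ Z := by
        intro x hx
        have h3 : ¬ c'.Nil := hc'.not_nil
        obtain ⟨y, hy⟩ := IsOddCycle.exists_adj (C := c'.toSubgraph) ⟨w, c', hc', ho', rfl⟩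
          (w := x) (by simpa using hx)
        exact hy.adj_sub.2.1
      have h3 := huniq (c'.mapLe (within_le G Z)).toSubgraph
        ⟨w, c'.mapLe (within_le G Z), hc'.mapLe _, by simpa using ho', rfl⟩ (by
          intro x hx
          rw [Walk.mem_verts_toSubgraph] at hx
          exact hZ x (by simpa using hx))
      rw [Walk.edges_map, List.mem_map] at he
      obtain ⟨e', he', rfl⟩ := he
      have h4 : Sym2.map φ e' ∈ (c.map (Embedding.induce P).toHom).edges := by
        rw [Walk.edges_map]
        exact List.mem_map.2 ⟨e', he', rfl⟩
      rw [← Walk.mem_edges_toSubgraph, Walk.toSubgraph_map, ← h3, Walk.mem_edges_toSubgraph] at h4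
      rwa [Walk.edges_mapLe_eq_edges] at h4)
  refine ⟨col, fun x hx => h1 _ ?_, fun x y hxy hn => h2 _ _ ⟨hxy, hPZ x.2, hPZ y.2⟩ fun h =>
    hn (he x y h), fun u v huv hu hv huP => h2 u v ⟨huv, hu, hv⟩ fun h => huP ?_⟩
  · rw [Walk.mem_verts_toSubgraph] at hx
    rw [Walk.support_map]
    exact List.mem_map.2 ⟨x, hx, rfl⟩
  · have := Walk.fst_mem_support_of_mem_edges _ h
    rw [Walk.support_map, List.mem_map] at this
    obtain ⟨x, -, rfl⟩ := this
    exact x.2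

/-! ### Equality when all odd cycles lie in the parts. -/

section BAB

variable {G : SimpleGraph V} {k : ℕ} {B : Set V} {P : Fin k → Set V}

/-- Among the vertices of `B ∪ P i` the only odd cycle is that of `P i`, so the contracted colouring
of the part extends to a proper colouring of the base that respects the edges between them. -/
lemma IsBAB.exists_coloring (h : IsBAB G B P)
    (hodd : ∀ C, IsOddCycle G C → ∃ i, C.verts ⊆ P i) (i : Fin k) :
    ∃ C, ∃ col : V → Bool, IsReachGraph (G.induce (P i)) C (fun x => col x.1) ∧
      ∀ u v, G.Adj u v → u ∈ B → v ∈ B ∪ P i → col u ≠ col v := by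
  obtain ⟨C, hC, huniq⟩ := h.almostBipartite i
  obtain ⟨col, h1, h2, h3⟩ := exists_coloring_within (G := G) (P := P i) (Z := B ∪ P i)
    Set.subset_union_right hC (by
      intro D hD hDZ
      obtain ⟨j, hj⟩ := hodd D hD
      have hij : j = i := by
        by_contra hne
        obtain ⟨x, hx⟩ := hD.nonempty
        rcases hDZ hx with h4 | h4
        · exact Set.disjoint_left.1 (h.disjoint_base j) h4 (hj hx)
        · exact Set.disjoint_left.1 (h.disjoint_parts j i hne) (hj hx) h4
      subst hij
      obtain ⟨C', hC', rfl⟩ := hD.exists_induce hj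
      rw [huniq C' hC'])
  exact ⟨C, col, ⟨hC, huniq, h.reach i C hC, h1, h2⟩, fun u v huv hu hv =>
    h3 u v huv (Or.inl hu) hv fun hP => Set.disjoint_left.1 (h.disjoint_base i) hu hP⟩

/-- In a BAB-graph all whose odd cycles lie in the parts, every vertex without a neighbour in the
kernel is in a maximum independent set. -/
theorem IsBAB.mem_corona [Finite V] (h : IsBAB G B P)
    (hodd : ∀ C, IsOddCycle G C → ∃ i, C.verts ⊆ P i) {v : V} (hv : v ∉ nbhd G (kernel G)) :
    v ∈ corona G := by
  have hker := image_kernel_subset G h.pairwise_disjoint h.iUnion_parts h.critDiff_eq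
  have hvt : ∀ (t) (hvt : v ∈ babParts B P t), (⟨v, hvt⟩ : babParts B P t) ∉
      nbhd (G.induce (babParts B P t)) (kernel (G.induce (babParts B P t))) := by
    rintro t hvt ⟨u, hu, huv⟩
    exact hv ⟨u, hker t ⟨u, hu, rfl⟩, huv⟩
  choose S hS hSc hSa using h.exists_part_indep'
  have hvU : v ∈ ⋃ t, babParts B P t := h.iUnion_parts ▸ Set.mem_univ v
  rw [Set.mem_iUnion] at hvU
  obtain ⟨t, ht⟩ := hvU
  rcases t with _ | i
  · obtain ⟨A, hA, hA'⟩ := exists_sides h.bipartite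
    obtain ⟨SB, hSB, hSBc, hvS⟩ := (mem_corona_iff _ _).1 (bipartite_mem_corona hA hA' (hvt none ht))
    obtain ⟨-, h1, h2⟩ := h.glue_indep (fun t => match t with | none => SB | some i => S i)
      (by rintro (_ | i); exacts [hSB, hS i]) (by rintro (_ | i); exacts [hSBc, hSc i])
      (fun i => hSa i)
    exact (mem_corona_iff G v).2 ⟨_, h1, h2, (mem_unionParts _).2 ⟨none, ht, hvS⟩⟩
  · classical
    obtain ⟨C, col, hr, hcol⟩ := h.exists_coloring hodd i
    by_cases hva : (⟨v, ht⟩ : P i) ∈ hr.odds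
    · obtain ⟨Sv, hSv, hSvc, hvS⟩ :=
        (mem_corona_iff _ _).1 (hr.mem_corona_of_odds hva (hvt (some i) ht))
      have hcolB : ∀ u v : B, G.Adj u.1 v.1 → col u.1 ≠ col v.1 := fun u v huv =>
        hcol _ _ huv u.2 (Or.inl v.2)
      -- Vertices of the part with neighbours in the base are coloured true, so those neighbours are
      -- coloured false. Choosing `SB` to meet the false side only in `D(B)` rules out edges to
      -- `Sv`, since no added edge ends in `D(B)`.
      obtain ⟨SB, hSB, -, hSBc, hSBD⟩ := bipartite_exists_maximum_indep (G := G.induce B)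
        (A := {u | col u.1 = false})
        (fun u hu w hw _ hadj => hcolB u w hadj (Eq.trans hu (Eq.symm hw)))
        (fun u hu w hw _ hadj => hcolB u w hadj (by
          have h1 : col u.1 ≠ false := hu
          have h2 : col w.1 ≠ false := hw
          rw [Bool.eq_true_of_not_eq_false h1, Bool.eq_true_of_not_eq_false h2]))
      let T : ∀ t, Set (babParts B P t) := fun t => match t with
        | none => SB
        | some j => if hj : j = i then hj ▸ Sv else S j
      have hTi : T (some i) = Sv := dif_pos rfl
      have hTj : ∀ j, j ≠ i → T (some j) = S j := fun j hj => dif_neg hj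
      have hBv : ∀ u ∈ SB, ∀ w ∈ Sv, ¬ G.Adj u.1 w.1 := by
        intro u hu w hw hadj
        have hwa : w ∈ geA (G.induce (P i)) := by
          by_contra hwa
          exact h.not_adj_parts (t := none) (v := u) (by simp) hwa hadj.symm
        have h1 := (hr.mem_geA_iff_col w).1 hwa
        have h2 := hcol _ _ hadj u.2 (Or.inr w.2)
        rw [h1] at h2
        exact h.notMem_boundary_base (hSBD ⟨hu, Bool.eq_false_iff.2 h2⟩) ⟨u.2, w.1, fun hwB =>
          Set.disjoint_left.1 (h.disjoint_base i) hwB w.2, hadj⟩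
      have hcross : ∀ s t, s ≠ t → ∀ u ∈ T s, ∀ w ∈ T t, ¬ G.Adj u.1 w.1 := by
        have key : ∀ j t, some j ≠ t → ∀ u ∈ T (some j), ∀ w ∈ T t, ¬ G.Adj u.1 w.1 := by
          intro j t hjt u hu w hw hadj
          by_cases hj : j = i
          · subst hj
            rcases t with _ | l
            · rw [hTi] at hu
              exact hBv w hw u hu hadj.symm
            · have hlj : l ≠ j := fun h => hjt (by rw [h])
              rw [hTj l hlj] at hw
              exact h.not_adj_parts (Ne.symm hjt) (hSa l w hw) hadj.symm
          · rw [hTj j hj] at hu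
            exact h.not_adj_parts hjt (hSa j u hu) hadj
        rintro (_ | j) (_ | l) hst u hu w hw hadj
        · exact hst rfl
        · exact key l none (Ne.symm hst) w hw u hu hadj.symm
        · exact key j none hst u hu w hw hadj
        · exact key j (some l) hst u hu w hw hadj
      have hTS : ∀ t, (G.induce (babParts B P t)).IsIndepSet (T t) := by
        rintro (_ | j)
        · exact hSB
        · by_cases hj : j = i
          · subst hj
            rw [hTi]
            exact hSv
          · rw [hTj j hj]
            exact hS j
      have hTc : ∀ t, (T t).ncard = (G.induce (babParts B P t)).indepNum := by
        rintro (_ | j)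
        · exact hSBc
        · by_cases hj : j = i
          · subst hj
            rw [hTi]
            exact hSvc
          · rw [hTj j hj]
            exact hSc j
      have h3 := indepNum_eq_sum G h.pairwise_disjoint h.iUnion_parts T hTS hTc hcross
      refine (mem_corona_iff G v).2 ⟨_, indep_unionParts G T hTS hcross, h3.2,
        (mem_unionParts _).2 ⟨some i, ht, ?_⟩⟩
      rw [hTi]
      exact hvS
    · obtain ⟨Sv, hSv, hSvc, hvS, hSva⟩ := h.exists_part_indep i (v := ⟨v, ht⟩) fun h' =>
        hva ((hr.mem_geA_iff_col _).1 h')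
      obtain ⟨SB, hSB, hSBc⟩ := exists_indep_ncard_eq (G.induce B)
      have hex : ∀ j, ∃ S', (G.induce (P j)).IsIndepSet S' ∧
          S'.ncard = (G.induce (P j)).indepNum ∧ (∀ hj : v ∈ P j, (⟨v, hj⟩ : P j) ∈ S') ∧
          ∀ u ∈ S', u ∉ geA (G.induce (P j)) := by
        intro j
        by_cases hj : j = i
        · subst hj
          exact ⟨Sv, hSv, hSvc, fun _ => hvS, hSva⟩
        · exact ⟨S j, hS j, hSc j, fun hvj =>
            absurd hvj (Set.disjoint_left.1 (h.disjoint_parts i j (Ne.symm hj)) ht), hSa j⟩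
      choose S' hS' hSc' hvS' hSa' using hex
      obtain ⟨-, h1, h2⟩ := h.glue_indep (fun t => match t with | none => SB | some i => S' i)
        (by rintro (_ | i); exacts [hSB, hS' i]) (by rintro (_ | i); exacts [hSBc, hSc' i])
        (fun i => hSa' i)
      exact (mem_corona_iff G v).2 ⟨_, h1, h2, (mem_unionParts _).2 ⟨some i, ht, hvS' i ht⟩⟩

theorem IsBAB.ncard_kernel_add_ncard_corona_eq [Finite V] (h : IsBAB G B P)
    (hodd : ∀ C, IsOddCycle G C → ∃ i, C.verts ⊆ P i) :
    (kernel G).ncard + (corona G).ncard = 2 * G.indepNum + k := by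
  have h1 := h.ncard_kernel_add_ncard_corona_le
  have h2 := le_ncard_kernel_add_ncard_corona G fun v hv => h.mem_corona hodd hv
  have h3 := h.two_mul_indepNum_add
  omega

end BAB

/-! ### Growing the part of an odd cycle -/

section grow

variable {G : SimpleGraph V} {f g : V → V} {C : G.Subgraph} {E O Q : Set V}

/-- Appending two edges preserves the parity of the number of edges after each earlier one. -/
lemma AltTo.concat_concat {b e u x : V} {p : G.Walk b e} (hp : AltTo f p) (h : G.Adj e u)
    (h' : G.Adj u x) (h1 : f e = u) (h2 : f u ≠ x) : AltTo f ((p.concat h).concat h') := by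
  induction p with
  | nil => exact ⟨by simp [h1], by simp [h2], trivial⟩
  | cons h0 p ih =>
    refine ⟨?_, ih hp.2 h h1⟩
    change f _ = _ ↔ Odd ((p.concat h).concat h').length
    rw [hp.1, Walk.length_concat, Walk.length_concat]
    simp [Nat.odd_add_one]

lemma AltTo.concat_congr {b o x y : V} {q : G.Walk b o} {h : G.Adj o x} (hq : AltTo f (q.concat h))
    (h' : G.Adj o y) (h1 : f o ≠ y) : AltTo f (q.concat h') := by
  induction q with
  | nil => exact ⟨by simp [h1], trivial⟩
  | cons h0 q ih =>
    refine ⟨?_, ih hq.2 h' h1⟩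
    have := hq.1
    change _ ↔ Odd (q.concat h).length at this
    change f _ = _ ↔ Odd (q.concat h').length
    rw [this, Walk.length_concat, Walk.length_concat]

/-- The condition never evaluates the involution at the last vertex, which on a path occurs only at
the end. -/
lemma AltTo.congr_of_isPath {b r : V} {p : G.Walk b r} (hp : AltTo f p) (hpath : p.IsPath)
    (h : ∀ x ∈ p.support, x ≠ r → g x = f x) : AltTo g p := by
  induction p with
  | nil => trivial
  | cons h0 p ih =>
    rw [Walk.cons_isPath_iff] at hpath
    rw [Walk.support_cons] at h
    refine ⟨?_, ih hp.2 hpath.1 fun x hx => h x (List.mem_cons_of_mem _ hx)⟩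
    rw [h _ List.mem_cons_self fun h' => hpath.2 (h' ▸ p.end_mem_support)]
    exact hp.1

/-- `p` is the stem of a flower inside `Q`, for a maximum matching that agrees with `f` outside
`Q`. -/
def IsStemIn (f : V → V) (C : G.Subgraph) (Q : Set V) {b r : V} (p : G.Walk b r) : Prop :=
  ∃ g, IsMaxMat G g ∧ (∀ v ∉ Q, g v = f v) ∧ IsFlowerMat g C p ∧ ∀ v ∈ p.support, v ∈ Q

lemma IsStemIn.mono {Q' : Set V} {b r : V} {p : G.Walk b r} (h : IsStemIn f C Q p) (hQ : Q ⊆ Q') :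
    IsStemIn f C Q' p := by
  obtain ⟨g, h1, h2, h3, h4⟩ := h
  exact ⟨g, h1, fun v hv => h2 v fun hv' => hv (hQ hv'), h3, fun v hv => hQ (h4 v hv)⟩

/-- A part of the graph grown from the odd cycle `C`: `E` and `O` are the vertices at even and odd
distance from the cycle on stems. -/
structure IsReachPart (f : V → V) (C : G.Subgraph) (E O : Set V) : Prop where
  max : IsMaxMat G f
  base : ∃ b, IsBlossomMat f C b ∧ f b = b
  cycle : C.verts ⊆ E
  disjoint : Disjoint E O
  mapsTo : ∀ o ∈ O, f o ∈ E
  closed : ∀ e ∈ E, f e ∈ E ∪ O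
  even : ∀ e ∈ E, ∃ (b : V) (p : G.Walk b e), IsStemIn f C (E ∪ O) p
  odd : ∀ o ∈ O, ∃ (b x : V) (q : G.Walk b o) (h : G.Adj o x), IsStemIn f C (E ∪ O) (q.concat h)

lemma IsReachPart.mapsTo_union (h : IsReachPart f C E O) : ∀ v ∈ E ∪ O, f v ∈ E ∪ O := by
  rintro v (hv | hv)
  · exact h.closed v hv
  · exact Or.inl (h.mapsTo v hv)

/-- Switching a stem frees the base of the blossom. Rotating the blossom then makes each vertex of
the cycle a root with the trivial stem. -/
lemma exists_initial [Finite V] (hC : IsOddCycle G C) (hne : (reachSet G C).Nonempty) :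
    ∃ f, IsReachPart f C C.verts ∅ := by
  obtain ⟨v, hv⟩ := hne
  obtain ⟨f, b, r, p, hf, hp, -⟩ := (mem_reachSet_iff hC v).1 hv
  obtain ⟨g, hg, hb, hgb⟩ := hp.exists_base hf
  refine ⟨g, hg, ⟨b, hb, hgb⟩, subset_rfl, Set.disjoint_empty _, fun o ho => absurd ho (by simp),
    fun e he => Or.inl (hb.mapsTo hgb e he), fun e he => ?_, fun o ho => absurd ho (by simp)⟩
  obtain ⟨k, hk, hke, hkf, hoff⟩ := hb.exists_rotate hgb hg hC he
  refine ⟨e, .nil, k, hk, fun v hv => hoff v fun h => hv (Or.inl h),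
    ⟨hke, Walk.IsPath.nil, trivial, by simp, hkf, by simp⟩, by simpa using he⟩

/-- Extending a stem by an edge and a matching edge. -/
lemma IsStemIn.extend [Finite V] {b e u : V} {p : G.Walk b e} (hp : IsStemIn f C Q p)
    (hf : IsMaxMat G f) (hCQ : C.verts ⊆ Q) (hQ : ∀ v ∈ Q, f v ∈ Q) (hu : u ∉ Q) (h : G.Adj e u) :
    ∃ h' : G.Adj u (f u), IsStemIn f C (insert u (insert (f u) Q)) ((p.concat h).concat h') := by
  obtain ⟨g, hg, hoff, hfl, hpQ⟩ := hp
  have hgu : g u = f u := hoff u hu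
  have heQ : e ∈ Q := hpQ e p.end_mem_support
  -- An unsaturated `u` next to the unsaturated root `e` would allow augmentation.
  have hux : u ≠ f u := fun h' => hg.not_adj hfl.root (by rw [hgu, ← h']) h
  have h' : G.Adj u (f u) := hf.1.2 u hux.symm
  have hxQ : f u ∉ Q := hf.1.mapsTo_compl hQ hu
  have hue : u ≠ e := fun h => hu (h ▸ heQ)
  have hne : ∀ v ∈ Q, v ≠ e → exch g e (f u) v = g v := fun v hv hve =>
    exch_apply_of_ne hgu hg.1 hfl.root hve (fun h => hxQ (h ▸ hv)) (fun h => hu (h ▸ hv))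
  have hge : exch g e (f u) e = u := exch_apply_left hgu hg.1 hue hux
  have hgu' : exch g e (f u) u = e := exch_apply_self hgu hue hux
  have hup : u ∉ p.support := fun h => hu (hpQ u h)
  have hxp : f u ∉ p.support := fun h => hxQ (hpQ _ h)
  refine ⟨h', exch g e (f u), isMaxMat_exch hgu hg hfl.root hux h, fun v hv => ?_,
    ⟨⟨hfl.blossom.mem, ?_, fun x hx hxb => ?_⟩, ?_, ?_, ?_, exch_apply_right hfl.root, ?_⟩, ?_⟩
  · simp only [Set.mem_insert_iff, not_or] at hv
    have hve : v ≠ e := by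
      rintro rfl
      exact hv.2.2 heQ
    rw [exch_apply_of_ne hgu hg.1 hfl.root hve hv.2.1 hv.1, hoff v hv.2.2]
  · by_cases hbe : b = e
    · intro hadj
      rw [hbe, hge] at hadj
      exact hu (hCQ (C.edge_vert hadj.symm))
    · rw [hne b (hCQ hfl.blossom.mem) hbe]
      exact hfl.blossom.base
  · rw [hne x (hCQ hx) fun h => hxb (hfl.meet x (h ▸ p.end_mem_support) hx)]
    exact hfl.blossom.adj x hx hxb
  · refine (hfl.path.concat hup h).concat ?_ h'
    simp [Walk.support_concat, hxp, hux.symm]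
  · exact (hfl.alt.congr_of_isPath hfl.path fun x hx hxe => hne x (hpQ x hx) hxe).concat_concat h h'
      hge (by rw [hgu']; exact fun h => hxQ (h ▸ heQ))
  · simpa [Walk.length_concat, Nat.even_add_one] using hfl.even
  · intro v hv hvC
    simp only [Walk.support_concat, List.mem_append, List.mem_singleton] at hv
    rcases hv with (hv | rfl) | rfl
    · exact hfl.meet v hv hvC
    · exact absurd (hCQ hvC) hu
    · exact absurd (hCQ hvC) hxQ
  · intro v hv
    simp only [Walk.support_concat, List.mem_append, List.mem_singleton] at hv
    rcases hv with (hv | rfl) | rfl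
    · exact Or.inr (Or.inr (hpQ v hv))
    · exact Or.inl rfl
    · exact Or.inr (Or.inl rfl)

/-- Exchanging the matching edge at `u` for `eu` frees `f u`. So the stem ending in `e` extends
through `u`, which becomes odd, to the new root `f u`, which becomes even. -/
lemma IsReachPart.grow_edge [Finite V] (h : IsReachPart f C E O) {e u : V} (he : e ∈ E)
    (hu : u ∉ E ∪ O) (hadj : G.Adj e u) : IsReachPart f C (insert (f u) E) (insert u O) := by
  obtain ⟨b, p, hp⟩ := h.even e he
  have hCQ : C.verts ⊆ E ∪ O := fun v hv => Or.inl (h.cycle hv)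
  obtain ⟨h', hs⟩ := hp.extend h.max hCQ h.mapsTo_union hu hadj
  have hx : f u ∉ E ∪ O := h.max.1.mapsTo_compl h.mapsTo_union hu
  have hQ : insert u (insert (f u) (E ∪ O)) = insert (f u) E ∪ insert u O := by
    ext v
    simp only [Set.mem_insert_iff, Set.mem_union]
    tauto
  have hsub : E ∪ O ⊆ insert (f u) E ∪ insert u O :=
    Set.union_subset_union (Set.subset_insert _ _) (Set.subset_insert _ _)
  rw [hQ] at hs
  rw [Set.mem_union, not_or] at hu hx
  refine ⟨h.max, h.base, h.cycle.trans (Set.subset_insert _ _), ?_, ?_, ?_, ?_, ?_⟩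
  · rw [Set.disjoint_insert_left, Set.disjoint_insert_right, Set.mem_insert_iff, not_or]
    exact ⟨⟨h'.ne', hx.2⟩, hu.1, h.disjoint⟩
  · rintro o (rfl | ho)
    · exact Or.inl rfl
    · exact Or.inr (h.mapsTo o ho)
  · rintro v (rfl | hv)
    · rw [h.max.1.1]
      exact Or.inr (Or.inl rfl)
    · exact hsub (h.closed v hv)
  · rintro v (rfl | hv)
    · exact ⟨b, _, hs⟩
    · obtain ⟨b', p', hp'⟩ := h.even v hv
      exact ⟨b', p', hp'.mono hsub⟩
  · rintro v (rfl | hv)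
    · exact ⟨b, _, _, h', hs⟩
    · obtain ⟨b', x', q, hq, hp'⟩ := h.odd v hv
      exact ⟨b', x', q, hq, hp'.mono hsub⟩

/-- Changing the matching outside the part. -/
lemma IsStemIn.change [Finite V] {f' : V → V} (hf : IsMaxMat G f) (hf' : IsMaxMat G f')
    (hagree : ∀ v ∈ Q, f' v = f v) (hQ : ∀ v ∈ Q, f v ∈ Q) (hCQ : C.verts ⊆ Q) {b r : V}
    {p : G.Walk b r} (hp : IsStemIn f C Q p) :
    ∃ g, IsMaxMat G g ∧ (∀ v ∉ Q, g v = f' v) ∧ (∀ v ∈ Q, g v ∈ Q) ∧ IsFlowerMat g C p ∧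
      ∀ v ∈ p.support, v ∈ Q := by
  obtain ⟨g, hg, hoff, hfl, hpQ⟩ := hp
  have hQ' : ∀ v ∈ Q, f' v ∈ Q := fun v hv => by rw [hagree v hv]; exact hQ v hv
  -- Outside `Q` the matchings `g` and `f` agree, and `f` has no edge leaving `Q`.
  have hgQ : ∀ v ∈ Q, g v ∈ Q := by
    intro v hv
    by_contra hv'
    have h1 := hf.1.mapsTo_compl hQ hv'
    rw [← hoff _ hv', hg.1.1] at h1
    exact h1 hv
  have hin : ∀ v ∈ Q, glue Q g f' v = g v := fun v hv => glue_mem hv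
  refine ⟨glue Q g f', hg.of_ncard_le (isMat_glue hg.1 hf'.1 hgQ fun v hv =>
    hf'.1.mapsTo_compl hQ' hv) ?_, fun v hv => glue_notMem hv, fun v hv => ?_, ⟨⟨hfl.blossom.mem,
    ?_, fun x hx hxb => ?_⟩, hfl.path, hfl.alt.congr fun x hx => hin x (hpQ x hx), hfl.even, ?_,
    hfl.meet⟩, hpQ⟩
  · have h1 : supp f' ∩ Q = supp f ∩ Q := by
      ext v
      refine and_congr_left fun hv => ?_
      change f' v ≠ v ↔ f v ≠ v
      rw [hagree v hv]
    have h2 : supp g \ Q = supp f \ Q := by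
      ext v
      refine and_congr_left fun hv => ?_
      change g v ≠ v ↔ f v ≠ v
      rw [hoff v hv]
    have h3 := hf.ncard_eq hf'
    rw [ncard_supp_glue, ← Set.ncard_inter_add_ncard_sdiff_eq_ncard (supp g) Q, h2]
    rw [← Set.ncard_inter_add_ncard_sdiff_eq_ncard (supp f) Q,
      ← Set.ncard_inter_add_ncard_sdiff_eq_ncard (supp f') Q, h1] at h3
    omega
  · rw [hin v hv]
    exact hgQ v hv
  · rw [hin b (hCQ hfl.blossom.mem)]
    exact hfl.blossom.base
  · rw [hin x (hCQ hx)]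
    exact hfl.blossom.adj x hx hxb
  · rw [hin r (hpQ r p.end_mem_support)]
    exact hfl.root

/-- The stem through `o` is redirected: its last edge is replaced by the edge to `x`, which is a
root for the new matching. That edge is unmatched because the matching inside the part does not
leave it. -/
lemma IsReachPart.grow_vertex [Finite V] (h : IsReachPart f C E O) {o x : V} (ho : o ∈ O)
    (hx : x ∉ E ∪ O) (hadj : G.Adj o x) {f' : V → V} (hf' : IsMaxMat G f')
    (hagree : ∀ v ∈ E ∪ O, f' v = f v) (hfx : f' x = x) : IsReachPart f' C (insert x E) O := by
  have hCQ : C.verts ⊆ E ∪ O := fun v hv => Or.inl (h.cycle hv)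
  have hsub : E ∪ O ⊆ insert x E ∪ O := Set.union_subset_union_left _ (Set.subset_insert _ _)
  refine ⟨hf', ?_, h.cycle.trans (Set.subset_insert _ _), ?_, fun v hv => ?_, ?_, ?_, fun v hv => ?_⟩
  · obtain ⟨b, hb, hfb⟩ := h.base
    refine ⟨b, ⟨hb.mem, ?_, fun y hy hyb => ?_⟩, ?_⟩
    · rw [hagree b (hCQ hb.mem)]
      exact hb.base
    · rw [hagree y (hCQ hy)]
      exact hb.adj y hy hyb
    · rw [hagree b (hCQ hb.mem), hfb]
  · rw [Set.disjoint_insert_left]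
    exact ⟨fun h' => hx (Or.inr h'), h.disjoint⟩
  · rw [hagree v (Or.inr hv)]
    exact Or.inr (h.mapsTo v hv)
  · rintro v (rfl | hv)
    · rw [hfx]
      exact Or.inl (Or.inl rfl)
    · rw [hagree v (Or.inl hv)]
      exact hsub (h.closed v hv)
  · rintro v (rfl | hv)
    · obtain ⟨b, y, q, hoy, hs⟩ := h.odd o ho
      obtain ⟨g, hg, hoff, hgQ, hfl, hpQ⟩ := hs.change h.max hf' hagree h.mapsTo_union hCQ
      have hqQ : ∀ w ∈ q.support, w ∈ E ∪ O := fun w hw => hpQ w (by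
        rw [Walk.support_concat]
        simp [hw])
      refine ⟨b, q.concat hadj, g, hg, fun w hw => hoff w fun hw' => hw (hsub hw'),
        ⟨hfl.blossom, ((Walk.concat_isPath_iff hoy).1 hfl.path).1.concat (fun hv => hx (hqQ _ hv))
          hadj, hfl.alt.concat_congr hadj (fun h' => hx (h' ▸ hgQ o (Or.inr ho))), ?_, ?_, ?_⟩, ?_⟩
      · have := hfl.even
        rw [Walk.length_concat] at this ⊢
        exact this
      · rw [hoff _ hx, hfx]
      · intro w hw hwC
        rw [Walk.support_concat] at hw
        simp only [List.mem_append, List.mem_singleton] at hw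
        rcases hw with hw | rfl
        · exact hfl.meet w (by rw [Walk.support_concat]; simp [hw]) hwC
        · exact absurd (hCQ hwC) hx
      · intro w hw
        rw [Walk.support_concat] at hw
        simp only [List.mem_append, List.mem_singleton] at hw
        rcases hw with hw | rfl
        · exact hsub (hqQ w hw)
        · exact Or.inl (Or.inl rfl)
    · obtain ⟨b, p, hs⟩ := h.even v hv
      obtain ⟨g, hg, hoff, -, hfl, hpQ⟩ := hs.change h.max hf' hagree h.mapsTo_union hCQ
      exact ⟨b, p, IsStemIn.mono ⟨g, hg, hoff, hfl, hpQ⟩ hsub⟩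
  · obtain ⟨b, y, q, hoy, hs⟩ := h.odd v hv
    obtain ⟨g, hg, hoff, -, hfl, hpQ⟩ := hs.change h.max hf' hagree h.mapsTo_union hCQ
    exact ⟨b, y, q, hoy, IsStemIn.mono ⟨g, hg, hoff, hfl, hpQ⟩ hsub⟩

/-- A part that cannot be grown any more. -/
lemma exists_closed_reachPart [Finite V] (hC : IsOddCycle G C) (hne : (reachSet G C).Nonempty) :
    ∃ f E O, IsReachPart f C E O ∧ (∀ e ∈ E, ∀ u, G.Adj e u → u ∈ E ∪ O) ∧
      ∀ x ∉ E ∪ O, ∀ o ∈ O, G.Adj o x → ∀ f', IsMaxMat G f' → (∀ v ∈ E ∪ O, f' v = f v) →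
        f' x ≠ x := by
  obtain ⟨f₀, h₀⟩ := exists_initial hC hne
  obtain ⟨⟨f, E, O⟩, h, hmax⟩ := Set.exists_max_image
    {t : (V → V) × Set V × Set V | IsReachPart t.1 C t.2.1 t.2.2}
    (fun t => t.2.1.ncard + t.2.2.ncard) (Set.toFinite _) ⟨(f₀, C.verts, ∅), h₀⟩
  change IsReachPart f C E O at h
  refine ⟨f, E, O, h, fun e he u hadj => ?_, fun x hx o ho hadj f' hf' hagree hfx => ?_⟩
  · by_contra hu
    have h1 := hmax (f, insert (f u) E, insert u O) (h.grow_edge he hu hadj)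
    have h2 : (insert u O).ncard = O.ncard + 1 :=
      Set.ncard_insert_of_notMem (fun h => hu (Or.inr h))
    have h3 := Set.ncard_le_ncard (Set.subset_insert (f u) E)
    simp only at h1
    omega
  · have h1 := hmax (f', insert x E, O) (h.grow_vertex ho hx hadj hf' hagree hfx)
    have h2 : (insert x E).ncard = E.ncard + 1 :=
      Set.ncard_insert_of_notMem (fun h => hx (Or.inl h))
    simp only at h1
    omega

lemma verts_subset_reachSet (h : (reachSet G C).Nonempty) :
    C.verts ⊆ reachSet G C := by
  obtain ⟨v, f, b, r, p, hf, hp, -⟩ := h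
  exact fun w hw => ⟨f, b, r, p, hf, hp, Or.inl hw⟩

lemma IsReachPart.subset_reachSet [Finite V] (h : IsReachPart f C E O) (hC : IsOddCycle G C) :
    E ∪ O ⊆ reachSet G C := by
  rintro v (hv | hv)
  · obtain ⟨b, p, g, hg, -, hp, -⟩ := h.even v hv
    exact (mem_reachSet_iff hC v).2 ⟨g, b, v, p, hg, hp, Or.inr p.end_mem_support⟩
  · obtain ⟨b, x, q, hox, g, hg, -, hp, -⟩ := h.odd v hv
    exact (mem_reachSet_iff hC v).2 ⟨g, b, x, _, hg, hp, Or.inr (by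
      rw [Walk.support_concat]
      simp)⟩

end grow

/-! ### Restricting matchings and flowers to an induced subgraph -/

section restrict

variable {G : SimpleGraph V} {f : V → V} {W : Set V}

open Classical in
/-- The restriction of an involution to a set. -/
noncomputable def restr (W : Set V) (f : V → V) : W → W :=
  fun v => if h : f v.1 ∈ W then ⟨f v.1, h⟩ else v

open Classical in
/-- The extension of an involution by fixed points. -/
noncomputable def extend (h : W → W) : V → V := fun v => if hv : v ∈ W then (h ⟨v, hv⟩).1 else v

lemma extend_mem (h : W → W) (v : W) : extend h v.1 = (h v).1 := dif_pos v.2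

lemma extend_notMem (h : W → W) {v : V} (hv : v ∉ W) : extend h v = v := dif_neg hv

lemma isMat_extend {h : W → W} (hh : IsMat (G.induce W) h) : IsMat G (extend h) := by
  constructor
  · intro v
    by_cases hv : v ∈ W
    · rw [extend_mem h ⟨v, hv⟩, extend_mem, hh.1]
    · rw [extend_notMem h hv, extend_notMem h hv]
  · intro v hne
    by_cases hv : v ∈ W
    · rw [extend_mem h ⟨v, hv⟩] at hne ⊢
      exact hh.2 ⟨v, hv⟩ fun h' => hne (by rw [h'])
    · exact absurd (extend_notMem h hv) hne

lemma extend_mapsTo (h : W → W) : ∀ v ∈ W, extend h v ∈ W := fun v hv => by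
  rw [extend_mem h ⟨v, hv⟩]
  exact (h _).2

lemma supp_extend (h : W → W) : supp (extend h) = Subtype.val '' supp h := by
  ext v
  by_cases hv : v ∈ W
  · constructor
    · intro h'
      refine ⟨⟨v, hv⟩, fun h'' => h' ?_, rfl⟩
      rw [extend_mem h ⟨v, hv⟩, h'']
    · rintro ⟨w, hw, rfl⟩ h'
      rw [extend_mem] at h'
      exact hw (Subtype.ext h')
  · refine iff_of_false (fun h' => h' (extend_notMem h hv)) ?_
    rintro ⟨w, -, rfl⟩
    exact hv w.2

lemma restr_apply {v : W} (h : f v.1 ∈ W) : (restr W f v).1 = f v.1 := by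
  rw [restr, dif_pos h]

lemma isMat_restr (hf : IsMat G f) : IsMat (G.induce W) (restr W f) := by
  constructor
  · intro v
    by_cases h : f v.1 ∈ W
    · apply Subtype.ext
      rw [restr_apply (by rw [restr_apply h, hf.1]; exact v.2), restr_apply h, hf.1]
    · have h1 : restr W f v = v := dif_neg h
      rw [h1, h1]
  · intro v hv
    by_cases h : f v.1 ∈ W
    · change G.Adj v.1 (restr W f v).1
      rw [restr_apply h]
      exact hf.2 _ fun h' => hv (Subtype.ext (by rw [restr_apply h, h']))
    · exact absurd (dif_neg h) hv

lemma image_supp_restr : Subtype.val '' supp (restr W f) = {v | v ∈ supp f ∧ v ∈ W ∧ f v ∈ W} := by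
  ext v
  constructor
  · rintro ⟨w, hw, rfl⟩
    by_cases h : f w.1 ∈ W
    · exact ⟨fun h' => hw (Subtype.ext (by rw [restr_apply h, h'])), w.2, h⟩
    · exact absurd (dif_neg h) hw
  · rintro ⟨h1, h2, h3⟩
    exact ⟨⟨v, h2⟩, fun h' => h1 (by rw [← restr_apply (v := ⟨v, h2⟩) h3, h']), rfl⟩

/-- A maximum matching that has no edge leaving `W` is maximum inside `W`. -/
lemma isMaxMat_restr [Finite V] (hf : IsMaxMat G f) (hW : ∀ v ∈ W, f v ∈ W) :
    IsMaxMat (G.induce W) (restr W f) := by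
  refine ⟨isMat_restr hf.1, fun h hh => ?_⟩
  have h1 := hf.2 _ (isMat_glue (isMat_extend hh) hf.1 (extend_mapsTo h) fun v hv =>
    hf.1.mapsTo_compl hW hv)
  rw [ncard_supp_glue, ← Set.ncard_inter_add_ncard_sdiff_eq_ncard (supp f) W, supp_extend,
    Set.inter_eq_left.2 (Subtype.coe_image_subset _ _)] at h1
  have h2 : supp f ∩ W = Subtype.val '' supp (restr W f) := by
    rw [image_supp_restr]
    ext v
    exact ⟨fun h => ⟨h.1, h.2, hW v h.2⟩, fun h => ⟨h.1, h.2.1⟩⟩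
  rw [h2, Set.ncard_image_of_injective _ Subtype.val_injective,
    Set.ncard_image_of_injective _ Subtype.val_injective] at h1
  omega

lemma AltTo.of_map {g : W → W} (hg : ∀ v, (g v).1 = f v.1) {u v : W} {p : (G.induce W).Walk u v}
    (h : AltTo f (p.map (Embedding.induce W).toHom)) : AltTo g p := by
  induction p with
  | nil => trivial
  | @cons u a w h0 p ih =>
    refine ⟨?_, ih h.2⟩
    have := h.1
    rw [Walk.length_map] at this
    rw [← this, Subtype.ext_iff, hg]
    rfl

lemma IsFlowerMat.of_map {g : W → W} (hg : ∀ v, (g v).1 = f v.1) {b r : W}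
    {p : (G.induce W).Walk b r} {C : (G.induce W).Subgraph}
    (h : IsFlowerMat f (C.map (Embedding.induce W).toHom) (p.map (Embedding.induce W).toHom)) :
    IsFlowerMat g C p where
  blossom := by
    refine ⟨map_induce_verts.1 h.blossom.mem, fun h' => h.blossom.base ?_, fun x hx hxb => ?_⟩
    · have := map_induce_adj.2 h'
      rwa [hg] at this
    · rw [← map_induce_adj, hg]
      exact h.blossom.adj x.1 (map_induce_verts.2 hx) fun h' => hxb (Subtype.ext h')
  path := h.path.of_map
  alt := h.alt.of_map hg
  even := by
    have := h.even
    rwa [Walk.length_map] at this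
  root := Subtype.ext (by rw [hg]; exact h.root)
  meet := fun v hv hvC => Subtype.ext (h.meet v.1 (by
    rw [Walk.support_map]
    exact List.mem_map.2 ⟨v, hv, rfl⟩) (map_induce_verts.2 hvC))

end restrict

/-! ### A grown part as a graph of its own. -/

section part

variable {G : SimpleGraph V} {f : V → V} {C : G.Subgraph} {E O Q : Set V}

lemma IsStemIn.exists_induce [Finite V] (hf : IsMaxMat G f) (hQ : ∀ v ∈ Q, f v ∈ Q)
    {C' : (G.induce Q).Subgraph} {b r : V} {p : G.Walk b r}
    (hp : IsStemIn f (C'.map (Embedding.induce Q).toHom) Q p) (hs : ∀ v ∈ p.support, v ∈ Q) :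
    ∃ g, IsMaxMat (G.induce Q) g ∧ IsFlowerMat g C' (p.induce Q hs) := by
  obtain ⟨g, hg, hoff, hfl, -⟩ := hp
  have hgQ : ∀ v ∈ Q, g v ∈ Q := by
    intro v hv
    by_contra hv'
    have h1 := hf.1.mapsTo_compl hQ hv'
    rw [← hoff _ hv', hg.1.1] at h1
    exact h1 hv
  refine ⟨restr Q g, isMaxMat_restr hg hgQ, IsFlowerMat.of_map
    (fun v => restr_apply (hgQ v.1 v.2)) ?_⟩
  rw [Walk.map_induce]
  exact hfl

lemma IsStemIn.support_subset {b r : V} {p : G.Walk b r} (hp : IsStemIn f C Q p) :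
    ∀ v ∈ p.support, v ∈ Q := by
  obtain ⟨-, -, -, -, h⟩ := hp
  exact h

/-- Every matching edge off the cycle meets the odd class, so `μ ≤ |odds| + (|C| - 1)/2`; together
with `α = |even| + (|C| - 1)/2` this falls short of `|V|` by one. -/
lemma IsReachGraph.not_isKonigEgervary [Finite V] {H : SimpleGraph V} {C : H.Subgraph}
    {col : V → Bool} (h : IsReachGraph H C col) : ¬ IsKonigEgervary H := by
  intro hK
  obtain ⟨f, hf⟩ := exists_isMaxMat H
  have h1 := h.two_mul_indepNum
  have h2 := h.card_eq
  have h3 := two_mul_matchingNum hf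
  have h4 := (hf.1.ncard_adj_le h.odd).1
  have h5 := hf.1.ncard_supp_le (O := h.odds) (T := {x | C.Adj x (f x)}) fun v hv hvO hfvO => by
    by_contra hn
    refine h.col_ne _ _ (hf.1.2 v hv) hn ?_
    rw [Bool.eq_false_iff.2 hvO, Bool.eq_false_iff.2 hfvO]
  have h6 := Set.ncard_le_ncard (Set.inter_subset_left : h.odds ∩ supp f ⊆ h.odds)
  unfold IsKonigEgervary at hK
  omega

variable [Finite V] (h : IsReachPart f C E O)

include h

/-- The graph induced by a grown part. -/
lemma IsReachPart.exists_isReachGraph (hC : IsOddCycle G C)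
    (huniq : ∀ D, IsOddCycle G D → D.verts ⊆ E ∪ O → D = C) :
    ∃ (C' : (G.induce (E ∪ O)).Subgraph) (col : ↥(E ∪ O) → Bool),
      C'.map (Embedding.induce (E ∪ O)).toHom = C ∧ IsReachGraph (G.induce (E ∪ O)) C' col ∧
      ∀ v, col v = true ↔ v.1 ∈ O := by
  have hCQ : C.verts ⊆ E ∪ O := fun v hv => Or.inl (h.cycle hv)
  obtain ⟨C', hC', rfl⟩ := hC.exists_induce hCQ
  have hu : ∀ D, IsOddCycle (G.induce (E ∪ O)) D → D = C' := fun D hD =>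
    map_induce_inj (huniq _ hD.map_induce (by rintro _ ⟨v, -, rfl⟩; exact v.2))
  have hfl : ∀ v : ↥(E ∪ O), ∃ (b r : V) (p : G.Walk b r),
      IsStemIn f (C'.map (Embedding.induce (E ∪ O)).toHom) (E ∪ O) p ∧ v.1 ∈ p.support := by
    rintro ⟨v, hv | hv⟩
    · obtain ⟨b, p, hp⟩ := h.even v hv
      exact ⟨b, v, p, hp, p.end_mem_support⟩
    · obtain ⟨b, x, q, hox, hp⟩ := h.odd v hv
      exact ⟨b, x, _, hp, by rw [Walk.support_concat]; simp⟩
  have hreach : reachSet (G.induce (E ∪ O)) C' = Set.univ := by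
    refine Set.eq_univ_of_forall fun v => ?_
    obtain ⟨b, r, p, hp, hv⟩ := hfl v
    obtain ⟨g, hg, hgp⟩ := hp.exists_induce h.max h.mapsTo_union hp.support_subset
    refine (mem_reachSet_iff hC' v).2 ⟨g, _, _, _, hg, hgp, Or.inr ?_⟩
    rw [Walk.support_induce, List.mem_attachWith]
    exact hv
  obtain ⟨C'', col, hr⟩ := BABGraph.exists_isReachGraph ⟨C', hC', hu⟩ fun D hD => by
    rw [hu D hD, hreach]
  obtain rfl := hu C'' hr.odd
  -- A vertex of `E` is a root, hence in `D` and coloured false. A vertex of `O` is joined to a root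
  -- by an edge off the cycle, hence coloured true.
  refine ⟨C'', col, rfl, hr, fun ⟨v, hv⟩ => ⟨fun hcol => ?_, fun hvO => ?_⟩⟩
  · rcases hv with hvE | hvO
    · exfalso
      obtain ⟨b, p, hp⟩ := h.even v hvE
      obtain ⟨g, hg, hgp⟩ := hp.exists_induce h.max h.mapsTo_union hp.support_subset
      have h1 := (hr.mem_geD_iff_col _).1 ((mem_geD_iff _ _).2 ⟨g, hg, hgp.root⟩)
      rw [hcol] at h1
      exact Bool.noConfusion h1
    · exact hvO
  · obtain ⟨b, x, q, hox, hp⟩ := h.odd v hvO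
    obtain ⟨g, hg, hgp⟩ := hp.exists_induce h.max h.mapsTo_union hp.support_subset
    have hxQ : x ∈ E ∪ O := hp.support_subset x (Walk.end_mem_support _)
    have h1 := (hr.mem_geD_iff_col _).1 ((mem_geD_iff _ _).2 ⟨g, hg, hgp.root⟩)
    have h2 : ¬ C''.Adj ⟨v, hv⟩ ⟨x, hxQ⟩ := by
      obtain ⟨g', -, -, hfl', -⟩ := hp
      intro h'
      exact hfl'.not_adj_of_mem_edges (x := v) (y := x) (by rw [Walk.edges_concat]; simp)
        (map_induce_adj.2 h')
    have h3 := hr.col_ne ⟨v, hv⟩ ⟨x, hxQ⟩ hox h2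
    rw [h1] at h3
    exact Bool.eq_true_of_not_eq_false h3

/-- The number of vertices of a grown part that its matching saturates. -/
lemma IsReachPart.two_mul_ncard_add_le :
    2 * O.ncard + C.verts.ncard ≤ (supp f ∩ (E ∪ O)).ncard + 1 := by
  obtain ⟨b, hb, hfb⟩ := h.base
  have hinj : (f '' O).ncard = O.ncard := Set.ncard_image_of_injective _ h.max.1.inj
  have hCO : Disjoint O C.verts := h.disjoint.symm.mono_right h.cycle
  have h1 : O ∪ (f '' O ∪ C.verts \ {b}) ⊆ supp f ∩ (E ∪ O) := by
    have hO : ∀ v ∈ O, f v ≠ v := fun v hv h' =>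
      Set.disjoint_left.1 h.disjoint (h' ▸ h.mapsTo v hv) hv
    rintro v (hv | ⟨w, hw, rfl⟩ | hv)
    · exact ⟨hO v hv, Or.inr hv⟩
    · exact ⟨h.max.1.mem_supp (hO w hw), Or.inl (h.mapsTo w hw)⟩
    · rw [← hb.supp_inter hfb] at hv
      exact ⟨hv.1, Or.inl (h.cycle hv.2)⟩
  have h2 : Disjoint (f '' O) (C.verts \ {b}) := by
    rw [Set.disjoint_left]
    rintro _ ⟨w, hw, rfl⟩ hv
    have := hb.mapsTo hfb _ hv.1
    rw [h.max.1.1] at this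
    exact Set.disjoint_left.1 hCO hw this
  have h3 : Disjoint O (f '' O ∪ C.verts \ {b}) := by
    rw [Set.disjoint_left]
    rintro v hv (⟨w, hw, rfl⟩ | hv')
    · exact Set.disjoint_left.1 h.disjoint (h.mapsTo w hw) hv
    · exact Set.disjoint_left.1 hCO hv hv'.1
  have h4 := Set.ncard_le_ncard h1
  rw [Set.ncard_union_eq h3, Set.ncard_union_eq h2, hinj] at h4
  have h5 := Set.ncard_sdiff_singleton_add_one hb.mem
  omega

end part

/-! ### `R`-disjoint graphs are BAB-graphs -/

lemma ncard_eq_sum_inter [Finite V] {ι : Type*} [Fintype ι] {Q : ι → Set V}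
    (hQ : Pairwise (Function.onFun Disjoint Q)) (hcov : ⋃ t, Q t = Set.univ) (Y : Set V) :
    Y.ncard = ∑ t, (Q t ∩ Y).ncard := by
  rw [ncard_eq_sum hQ hcov]
  refine Finset.sum_congr rfl fun t _ => ?_
  rw [← Subtype.image_preimage_coe, Set.ncard_image_of_injective _ Subtype.val_injective]

section family

variable {G : SimpleGraph V} {k : ℕ} {C : Fin k → G.Subgraph} {f : Fin k → V → V}
  {E O : Fin k → Set V}

open Classical in
/-- The involutions of the parts and one of the complement, put together. -/
noncomputable def glueParts (f : Fin k → V → V) (P : Fin k → Set V) (N : V → V) : V → V :=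
  fun v => if h : ∃ i, v ∈ P i then f h.choose v else N v

lemma glueParts_mem {P : Fin k → Set V} (hP : ∀ i j, i ≠ j → Disjoint (P i) (P j)) {N : V → V}
    {i : Fin k} {v : V} (hv : v ∈ P i) : glueParts f P N v = f i v := by
  have h : ∃ i, v ∈ P i := ⟨i, hv⟩
  rw [glueParts, dif_pos h]
  congr 1
  by_contra hne
  exact Set.disjoint_left.1 (hP _ _ hne) h.choose_spec hv

lemma glueParts_notMem {P : Fin k → Set V} {N : V → V} {v : V} (hv : v ∈ (⋃ i, P i)ᶜ) :
    glueParts f P N v = N v := by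
  refine dif_neg ?_
  rwa [← Set.mem_iUnion]

variable [Finite V] (h : ∀ i, IsReachPart (f i) (C i) (E i) (O i))
  (hC : ∀ i, IsOddCycle G (C i))
  (hE : ∀ i, ∀ e ∈ E i, ∀ u, G.Adj e u → u ∈ E i ∪ O i)
  (hEE : ∀ i, ∀ e ∈ E i, ∀ e' ∈ E i, G.Adj e e' → (C i).Adj e e')
  (hP : ∀ i j, i ≠ j → Disjoint (E i ∪ O i) (E j ∪ O j))

include h hC hE hEE hP

/-- The matchings of the parts and a maximum matching of the rest form a maximum matching. -/
lemma isMaxMat_glueParts : ∀ N, IsMaxMat (G.induce (⋃ i, (E i ∪ O i))ᶜ) N →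
    IsMaxMat G (glueParts f (fun i => E i ∪ O i) (extend N)) := by
  set P : Fin k → Set V := fun i => E i ∪ O i with hPdef
  set B : Set V := (⋃ i, P i)ᶜ with hBdef
  intro N hN
  have hmem : ∀ {i v}, v ∈ P i → glueParts f P (extend N) v = f i v := fun hv => glueParts_mem hP hv
  have hB : ∀ {v}, v ∈ B → glueParts f P (extend N) v = extend N v := fun hv => glueParts_notMem hv
  have hcases : ∀ v, v ∈ B ∨ ∃ i, v ∈ P i := fun v => by
    by_cases hv : v ∈ B
    · exact Or.inl hv
    · rw [hBdef, Set.notMem_compl_iff, Set.mem_iUnion] at hv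
      exact Or.inr hv
  have hBP : ∀ i, Disjoint B (P i) := fun i => Set.disjoint_left.2 fun v hv hv' =>
    hv (Set.mem_iUnion.2 ⟨i, hv'⟩)
  have hNm := isMat_extend hN.1
  refine ⟨⟨fun v => ?_, fun v hv => ?_⟩, fun g hg => ?_⟩
  · rcases hcases v with hv | ⟨i, hv⟩
    · rw [hB hv, hB (extend_mapsTo N v hv), hNm.1]
    · rw [hmem hv, hmem ((h i).mapsTo_union v hv), (h i).max.1.1]
  · rcases hcases v with hv' | ⟨i, hv'⟩
    · rw [hB hv'] at hv ⊢
      exact hNm.2 v hv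
    · rw [hmem hv'] at hv ⊢
      exact (h i).max.1.2 v hv
  · have hcov : B ∪ ⋃ i, P i = Set.univ := Set.compl_union_self _
    have hsum := ncard_eq_sum_inter (pairwise_disjoint_babParts hBP hP) (iUnion_babParts hcov)
    -- By closedness of the parts, an edge of `g` meets some `O i`, lies inside `B`, or is an edge
    -- of some `C i`.
    have h1 := hg.ncard_supp_le (O := ⋃ i, O i)
      (T := {v | v ∈ supp g ∧ ((v ∈ B ∧ g v ∈ B) ∨ ∃ i, (C i).Adj v (g v))}) fun v hv hvO hgO => by
        refine ⟨hv, ?_⟩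
        rw [Set.mem_iUnion, not_exists] at hvO hgO
        have hadj := hg.2 v hv
        rcases hcases v with hvB | ⟨i, hvE | hvO'⟩
        · rcases hcases (g v) with hgB | ⟨i, hgE | hgO'⟩
          · exact Or.inl ⟨hvB, hgB⟩
          · exact absurd (hE i _ hgE v hadj.symm) (Set.disjoint_left.1 (hBP i) hvB)
          · exact absurd hgO' (hgO i)
        · rcases hE i v hvE _ hadj with hgE | hgO'
          · exact Or.inr ⟨i, hEE i v hvE _ hgE hadj⟩
          · exact absurd hgO' (hgO i)
        · exact absurd hvO' (hvO i)
    have h2 := Set.ncard_le_ncard (Set.inter_subset_left : (⋃ i, O i) ∩ supp g ⊆ ⋃ i, O i)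
    refine h1.trans ((Nat.add_le_add_right (Nat.mul_le_mul_left 2 h2) _).trans ?_)
    rw [hsum (⋃ i, O i), hsum {v | _}, hsum (supp (glueParts f P _)), Finset.mul_sum,
      ← Finset.sum_add_distrib]
    -- The bound is compared with the glued matching part by part: on `B` by maximality of `N`, on
    -- `P i` because a matching saturates at most `|C i| - 1` vertices along `C i`.
    refine Finset.sum_le_sum fun t _ => ?_
    rcases t with _ | i
    · have h3 : B ∩ ⋃ i, O i = ∅ := by
        ext v
        simp only [Set.mem_inter_iff, Set.mem_iUnion, Set.mem_empty_iff_false, iff_false, not_and,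
          not_exists]
        exact fun hv i hi => Set.disjoint_left.1 (hBP i) hv (Or.inr hi)
      have h4 : B ∩ {v | v ∈ supp g ∧ ((v ∈ B ∧ g v ∈ B) ∨ ∃ i, (C i).Adj v (g v))} ⊆
          Subtype.val '' supp (restr B g) := by
        rintro v ⟨hvB, hv, h' | ⟨i, h'⟩⟩
        · rw [image_supp_restr]
          exact ⟨hv, h'⟩
        · exact absurd (Or.inl ((h i).cycle ((C i).edge_vert h')))
            (Set.disjoint_left.1 (hBP i) hvB)
      have h5 : B ∩ supp (glueParts f P (extend N)) = Subtype.val '' supp N := by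
        rw [← supp_extend]
        ext v
        by_cases hv : v ∈ B
        · simp only [Set.mem_inter_iff, hv, true_and]
          change _ ≠ _ ↔ _ ≠ _
          rw [hB hv]
        · exact iff_of_false (fun h' => hv h'.1) fun h' => h' (extend_notMem N hv)
      change 2 * (B ∩ ⋃ i, O i).ncard + (B ∩ _).ncard ≤ (B ∩ _).ncard
      rw [h3, h5, Set.ncard_empty, Set.ncard_image_of_injective _ Subtype.val_injective]
      have h6 := Set.ncard_le_ncard h4
      rw [Set.ncard_image_of_injective _ Subtype.val_injective] at h6
      have h7 := hN.2 _ (isMat_restr (W := B) hg)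
      omega
    · have h3 : P i ∩ ⋃ i, O i = O i := by
        ext v
        rw [Set.mem_inter_iff, Set.mem_iUnion]
        constructor
        · rintro ⟨hv, j, hj⟩
          by_cases hij : i = j
          · rwa [hij]
          · exact absurd (Or.inr hj) (Set.disjoint_left.1 (hP i j hij) hv)
        · exact fun hv => ⟨Or.inr hv, i, hv⟩
      have h4 : P i ∩ {v | v ∈ supp g ∧ ((v ∈ B ∧ g v ∈ B) ∨ ∃ i, (C i).Adj v (g v))} ⊆
          {v | (C i).Adj v (g v)} := by
        rintro v ⟨hv, -, h' | ⟨j, h'⟩⟩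
        · exact absurd hv (Set.disjoint_left.1 (hBP i) h'.1)
        · by_cases hij : i = j
          · rw [hij]
            exact h'
          · exact absurd (Or.inl ((h j).cycle ((C j).edge_vert h')))
              (Set.disjoint_left.1 (hP i j hij) hv)
      have h5 : P i ∩ supp (glueParts f P (extend N)) = supp (f i) ∩ P i := by
        rw [Set.inter_comm]
        ext v
        refine and_congr_left fun hv => ?_
        change _ ≠ _ ↔ _ ≠ _
        rw [hmem hv]
      change 2 * (P i ∩ ⋃ i, O i).ncard + (P i ∩ _).ncard ≤ (P i ∩ _).ncard
      rw [h3, h5]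
      have h6 := Set.ncard_le_ncard h4
      have h7 := (hg.ncard_adj_le (hC i)).1
      have h8 : 2 * (O i).ncard + (C i).verts.ncard ≤ (supp (f i) ∩ P i).ncard + 1 :=
        (h i).two_mul_ncard_add_le
      omega

end family

/-- Every `R`-disjoint graph with `k` odd cycles is a BAB-graph with `k` parts that contain the odd
cycles. -/
theorem IsRDisjoint.exists_isBAB [Finite V] {G : SimpleGraph V} (hG : IsRDisjoint G) {k : ℕ}
    (hk : numOddCycles G = k) : ∃ (B : Set V) (P : Fin k → Set V), IsBAB G B P ∧
      ∀ C, IsOddCycle G C → ∃ i, C.verts ⊆ P i := by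
  obtain ⟨-, hne, hdisj⟩ := hG
  let e := Finite.equivFinOfCardEq ((Nat.card_coe_set_eq {C | IsOddCycle G C}).trans hk)
  set C : Fin k → G.Subgraph := fun i => (e.symm i).1 with hCdef
  have hC : ∀ i, IsOddCycle G (C i) := fun i => (e.symm i).2
  have hCinj : ∀ i j, i ≠ j → C i ≠ C j := fun i j hij h =>
    hij (e.symm.injective (Subtype.ext h))
  have hCsurj : ∀ D, IsOddCycle G D → ∃ i, C i = D := fun D hD =>
    ⟨e ⟨D, hD⟩, by simp [hCdef]⟩
  choose f E O h hE hO using fun i => exists_closed_reachPart (hC i) (hne _ (hC i))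
  have hP : ∀ i j, i ≠ j → Disjoint (E i ∪ O i) (E j ∪ O j) := fun i j hij =>
    (hdisj _ _ (hC i) (hC j) (hCinj i j hij)).mono ((h i).subset_reachSet (hC i))
      ((h j).subset_reachSet (hC j))
  -- A second odd cycle in the part would lie in two disjoint reach sets.
  have huniq : ∀ i, ∀ D, IsOddCycle G D → D.verts ⊆ E i ∪ O i → D = C i := by
    intro i D hD hDP
    by_contra hDC
    obtain ⟨x, hx⟩ := hD.nonempty
    exact Set.disjoint_left.1 (hdisj _ _ hD (hC i) hDC) (verts_subset_reachSet (hne _ hD) hx)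
      ((h i).subset_reachSet (hC i) (hDP hx))
  choose C' col hC' hr hcol using fun i => (h i).exists_isReachGraph (hC i) (huniq i)
  have hcolE : ∀ i, ∀ v (hv : v ∈ E i), col i ⟨v, Or.inl hv⟩ = false := fun i v hv =>
    Bool.eq_false_iff.2 fun h' => Set.disjoint_left.1 (h i).disjoint hv ((hcol i _).1 h')
  have hEE : ∀ i, ∀ v ∈ E i, ∀ w ∈ E i, G.Adj v w → (C i).Adj v w := by
    intro i v hv w hw hadj
    by_contra hn
    refine (hr i).col_ne ⟨v, Or.inl hv⟩ ⟨w, Or.inl hw⟩ hadj (fun h' => hn ?_) ?_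
    · rw [← hC' i]
      exact map_induce_adj.2 h'
    · rw [hcolE i v hv, hcolE i w hw]
  have hab : ∀ i, IsAlmostBipartite (G.induce (E i ∪ O i)) := fun i => ⟨C' i, (hr i).odd, (hr i).uniq⟩
  refine ⟨(⋃ i, (E i ∪ O i))ᶜ, fun i => E i ∪ O i, ⟨fun i => ?_, hP, Set.compl_union_self _, ?_, hab,
    fun i => (hr i).not_isKonigEgervary, fun i D hD => ?_, ?_, fun i => ?_⟩, fun D hD => ?_⟩
  · exact Set.disjoint_left.2 fun v hv hv' => hv (Set.mem_iUnion.2 ⟨i, hv'⟩)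
  · obtain ⟨c, hc⟩ := exists_coloring_of_even_cycles (G := G.induce (⋃ i, (E i ∪ O i))ᶜ) (by
      intro v c hc
      by_contra hodd
      rw [Nat.not_even_iff_odd] at hodd
      obtain ⟨i, hi⟩ := hCsurj _ (IsOddCycle.map_induce ⟨v, c, hc, hodd, rfl⟩)
      have h1 : v.1 ∈ (C i).verts := by
        rw [hi]
        exact map_induce_verts.2 (by simp)
      exact v.2 (Set.mem_iUnion.2 ⟨i, Or.inl ((h i).cycle h1)⟩))
    exact (Coloring.mk c fun {u v} huv => hc u v huv).colorable
  · rw [(hr i).uniq D hD, (hr i).reach]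
  -- If `x` were in `D(B)`, some maximum matching `N` of the base would miss it. Glued to the
  -- matchings of the parts, `N` would let the part at `w ∈ O i` grow by `x`; and `w ∈ E i` has no
  -- neighbour outside its part.
  · rintro x ⟨hx, w, hw, hadj⟩
    refine ⟨⟨x, hx⟩, ?_, rfl⟩
    by_contra hx'
    have hxD : (⟨x, hx⟩ : ↥(⋃ i, (E i ∪ O i))ᶜ) ∈ geD (G.induce (⋃ i, (E i ∪ O i))ᶜ) := by
      by_contra hD
      rw [Set.mem_union, not_or] at hx'
      exact hx'.2 fun h' => h'.elim hD hx'.1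
    obtain ⟨N, hN, hNx⟩ := (mem_geD_iff _ _).1 hxD
    rw [Set.notMem_compl_iff, Set.mem_iUnion] at hw
    obtain ⟨i, hw⟩ := hw
    have hxi : x ∉ E i ∪ O i := fun h' => hx (Set.mem_iUnion.2 ⟨i, h'⟩)
    rcases hw with hw | hw
    · exact hxi (hE i w hw x hadj.symm)
    · refine hO i x hxi w hw hadj.symm _ (isMaxMat_glueParts h hC hE hEE hP N hN)
        (fun v hv => glueParts_mem (P := fun i => E i ∪ O i) hP hv) ?_
      rw [glueParts_notMem hx, extend_mem N ⟨x, hx⟩, hNx]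
  · rintro v ⟨hv, w, hw, hadj⟩
    refine ⟨⟨v, hv⟩, ((hr i).mem_geA_iff_col _).2 ((hcol i _).2 ?_), rfl⟩
    rcases hv with hv | hv
    · exact absurd (hE i v hv w hadj) hw
    · exact hv
  · obtain ⟨i, rfl⟩ := hCsurj D hD
    exact ⟨i, fun v hv => Or.inl ((h i).cycle hv)⟩

/-! ### Disjoint triangles -/

section triangles

variable {κ : Type*} {β : V → κ}

/-- The disjoint union of complete graphs on the fibres of `β`. -/
def fibreGraph (β : V → κ) : SimpleGraph V where
  Adj u v := u ≠ v ∧ β u = β v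
  symm := ⟨fun _ _ h => ⟨h.1.symm, h.2.symm⟩⟩
  loopless := ⟨fun _ h => h.1 rfl⟩

/-- The complete graph on a fibre. -/
def fibreSubgraph (β : V → κ) (t : κ) : (fibreGraph β).Subgraph :=
  (⊤ : (fibreGraph β).Subgraph).induce {v | β v = t}

lemma fibreGraph_walk {u v x : V} (p : (fibreGraph β).Walk u v) (hx : x ∈ p.support) : β x = β u := by
  induction p with
  | nil => rw [List.mem_singleton.1 hx]
  | cons h p ih =>
    rw [Walk.support_cons, List.mem_cons] at hx
    rcases hx with rfl | hx
    · rfl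
    · rw [ih hx, h.2]

lemma reachSet_fibreSubgraph_subset (t : κ) :
    reachSet (fibreGraph β) (fibreSubgraph β t) ⊆ {v | β v = t} := by
  rintro v ⟨M, b, r, p, -, hp, hv | hv⟩
  · exact hv
  · exact (fibreGraph_walk p hv).trans hp.1.2.2.1

variable [Finite V] (hβ : ∀ t, {v | β v = t}.ncard = 3)

include hβ

/-- An odd cycle stays in one fibre and has an odd number of vertices greater than one, so it has
all three. Each pair is joined in `C`, since the near-perfect matching that misses the third vertex
must match it. -/
lemma eq_fibreSubgraph {C : (fibreGraph β).Subgraph} (hC : IsOddCycle (fibreGraph β) C) :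
    ∃ t, C = fibreSubgraph β t := by
  obtain ⟨w, hw⟩ := hC.nonempty
  have hsub : C.verts ⊆ {v | β v = β w} := by
    obtain ⟨v, c, -, -, rfl⟩ := hC
    intro x hx
    rw [Walk.mem_verts_toSubgraph] at hx hw
    exact (fibreGraph_walk c hx).trans (fibreGraph_walk c hw).symm
  have hle : 3 ≤ C.verts.ncard := by
    obtain ⟨x, hx, hxw⟩ := hC.exists_ne w
    have h1 := (Set.one_lt_ncard (Set.toFinite _)).2 ⟨x, hx, w, hw, hxw⟩
    obtain ⟨m, hm⟩ := hC.odd_ncard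
    omega
  have hverts : C.verts = {v | β v = β w} :=
    Set.eq_of_subset_of_ncard_le hsub (by rw [hβ]; exact hle)
  refine ⟨β w, ?_⟩
  ext u v
  · rw [hverts]
    rfl
  · refine ⟨fun h => ⟨hsub (C.edge_vert h), hsub (C.edge_vert h.symm), h.adj_sub⟩, ?_⟩
    rintro ⟨hu, hv, huv⟩
    have hu' : u ∈ C.verts := hverts ▸ hu
    have hv' : v ∈ C.verts := hverts ▸ hv
    obtain ⟨z, hz, hzuv⟩ : ∃ z ∈ C.verts, z ∉ ({u, v} : Set V) := by
      by_contra! hn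
      have h1 := Set.ncard_le_ncard (show C.verts ⊆ {u, v} from hn)
      have h2 := Set.ncard_pair huv.1
      omega
    rw [Set.mem_insert_iff, Set.mem_singleton_iff, not_or] at hzuv
    obtain ⟨f, hf, hs, ha⟩ := hC.exists_nearPerfect hz
    have h1 := ha u hu' (Ne.symm hzuv.1)
    have h2 : f u = v := by
      by_contra hne
      have h3 : f u ∈ supp f := hf.mem_supp (hs ▸ ⟨hu', Ne.symm hzuv.1⟩)
      rw [hs] at h3
      have h4 : ({u, v, z, f u} : Set V) ⊆ C.verts := by
        rintro x (rfl | rfl | rfl | rfl)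
        exacts [hu', hv', hz, h3.1]
      have h5 := Set.ncard_le_ncard h4
      have h6 : ({v, z, f u} : Set V).ncard = 3 :=
        Set.ncard_eq_three.2 ⟨v, z, f u, Ne.symm hzuv.2, Ne.symm hne, Ne.symm h3.2, rfl⟩
      rw [Set.ncard_insert_of_notMem (by
        rintro (h | h | h)
        exacts [huv.1 h, hzuv.1 h.symm, h1.ne h]), h6, hverts, hβ] at h5
      omega
    rwa [h2] at h1

lemma isOddCycle_fibreSubgraph (t : κ) : IsOddCycle (fibreGraph β) (fibreSubgraph β t) := by
  obtain ⟨a, b, c, hab, hac, hbc, h⟩ := Set.ncard_eq_three.1 (hβ t)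
  have ha : β a = t := by
    change a ∈ {v | β v = t}
    simp [h]
  have hb : β b = t := by
    change b ∈ {v | β v = t}
    simp [h]
  have hc : β c = t := by
    change c ∈ {v | β v = t}
    simp [h]
  have h1 : (fibreGraph β).Adj a b := ⟨hab, ha.trans hb.symm⟩
  have h2 : (fibreGraph β).Adj b c := ⟨hbc, hb.trans hc.symm⟩
  have h3 : (fibreGraph β).Adj c a := ⟨hac.symm, hc.trans ha.symm⟩
  have hodd : IsOddCycle (fibreGraph β) (Walk.cons h1 (.cons h2 (.cons h3 .nil))).toSubgraph := by
    refine ⟨a, _, ?_, ⟨1, rfl⟩, rfl⟩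
    rw [Walk.cons_isCycle_iff]
    simp [hab, hbc, hac, hab.symm, hac.symm]
  obtain ⟨s, hs⟩ := eq_fibreSubgraph hβ hodd
  have has : a ∈ (fibreSubgraph β s).verts := by
    rw [← hs]
    simp
  have hst : s = t := (show β a = s from has).symm.trans ha
  rw [← hst, ← hs]
  exact hodd

lemma fibreSubgraph_injective : Function.Injective (fibreSubgraph β) := by
  intro s t hst
  obtain ⟨v, hv⟩ := (isOddCycle_fibreSubgraph hβ s).nonempty
  have hv' : v ∈ (fibreSubgraph β t).verts := hst ▸ hv
  exact (show β v = s from hv).symm.trans hv'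

lemma numOddCycles_fibreGraph : numOddCycles (fibreGraph β) = Nat.card κ := by
  have h : {C | IsOddCycle (fibreGraph β) C} = fibreSubgraph β '' Set.univ := by
    ext C
    constructor
    · intro hC
      obtain ⟨t, rfl⟩ := eq_fibreSubgraph hβ hC
      exact ⟨t, trivial, rfl⟩
    · rintro ⟨t, -, rfl⟩
      exact isOddCycle_fibreSubgraph hβ t
  rw [numOddCycles, h, Set.ncard_image_of_injective _ (fibreSubgraph_injective hβ), Set.ncard_univ]

/-- A fibre has an odd number of vertices and matching edges do not leave it, so some vertex is
unsaturated. It is base and root of a flower with trivial stem; the other two vertices are matched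
to each other by maximality. -/
lemma reachSet_fibreSubgraph_nonempty (t : κ) :
    (reachSet (fibreGraph β) (fibreSubgraph β t)).Nonempty := by
  obtain ⟨f, hf⟩ := exists_isMaxMat (fibreGraph β)
  obtain ⟨b, hb, hfb⟩ : ∃ b, β b = t ∧ f b = b := by
    by_contra! hn
    have h1 := even_ncard_supp (isMat_restr (W := {v | β v = t}) hf.1)
    rw [← Set.ncard_image_of_injective _ Subtype.val_injective, image_supp_restr] at h1
    have h2 : {v | v ∈ supp f ∧ v ∈ {v | β v = t} ∧ f v ∈ {v | β v = t}} = {v | β v = t} := by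
      ext v
      refine ⟨fun h => h.2.1, fun h => ⟨hn v h, h, ?_⟩⟩
      exact (hf.1.2 v (hn v h)).2.symm.trans h
    rw [h2, hβ] at h1
    exact absurd h1 (by decide)
  refine ⟨b, (mem_reachSet_iff (isOddCycle_fibreSubgraph hβ t) b).2 ⟨f, b, b, .nil, hf,
    ⟨⟨hb, ?_, fun x hx hxb => ?_⟩, Walk.IsPath.nil, trivial, by simp, hfb, by simp⟩, Or.inl hb⟩⟩
  · rw [hfb]
    exact fun h => h.ne rfl
  · have h1 : f x ≠ x := fun h => hf.not_adj h hfb ⟨hxb, Eq.trans hx hb.symm⟩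
    have h2 := hf.1.2 x h1
    exact ⟨hx, h2.2.symm.trans hx, h2⟩

/-- Disjoint triangles form an `R`-disjoint graph. -/
theorem isRDisjoint_fibreGraph [Nonempty κ] : IsRDisjoint (fibreGraph β) := by
  refine ⟨⟨_, isOddCycle_fibreSubgraph hβ (Classical.arbitrary κ)⟩, fun C hC => ?_,
    fun C C' hC hC' hne => ?_⟩
  · obtain ⟨t, rfl⟩ := eq_fibreSubgraph hβ hC
    exact reachSet_fibreSubgraph_nonempty hβ t
  · obtain ⟨s, rfl⟩ := eq_fibreSubgraph hβ hC
    obtain ⟨t, rfl⟩ := eq_fibreSubgraph hβ hC'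
    rw [Set.disjoint_left]
    intro v hv hv'
    have h1 : β v = s := reachSet_fibreSubgraph_subset s hv
    have h2 : β v = t := reachSet_fibreSubgraph_subset t hv'
    exact hne (by rw [← h1, h2])

end triangles

lemma exists_isRDisjoint {k : ℕ} (hk : 1 ≤ k) : ∃ (n : ℕ) (G : SimpleGraph (Fin n)),
    IsRDisjoint G ∧ numOddCycles G = k := by
  have hβ : ∀ t : Fin k, {v : Fin (k * 3) | (finProdFinEquiv.symm v).1 = t}.ncard = 3 := by
    intro t
    have h : {v : Fin (k * 3) | (finProdFinEquiv.symm v).1 = t} =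
        (fun i : Fin 3 => finProdFinEquiv (t, i)) '' Set.univ := by
      ext v
      constructor
      · rintro rfl
        exact ⟨_, trivial, finProdFinEquiv.apply_symm_apply v⟩
      · rintro ⟨i, -, rfl⟩
        exact congrArg Prod.fst (finProdFinEquiv.symm_apply_apply (t, i))
    rw [h, Set.ncard_image_of_injective, Set.ncard_univ, Nat.card_eq_fintype_card, Fintype.card_fin]
    intro i j hij
    exact (Prod.ext_iff.1 (finProdFinEquiv.injective hij)).2
  have : Nonempty (Fin k) := ⟨⟨0, hk⟩⟩
  exact ⟨k * 3, _, isRDisjoint_fibreGraph hβ, by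
    rw [numOddCycles_fibreGraph hβ, Nat.card_eq_fintype_card, Fintype.card_fin]⟩

end BABGraph

theorem mainTheorem6 :
    (∀ {V : Type*} [Finite V] (G : SimpleGraph V) (k : ℕ) (B : Set V) (P : Fin k → Set V),
      BABGraph.IsBAB G B P →
        (BABGraph.kernel G).ncard + (BABGraph.corona G).ncard ≤ 2 * G.indepNum + k ∧
        ((2 * G.indepNum + k : ℕ) : ℤ) = BABGraph.critDiff G + (Nat.card V : ℤ)) ∧
    (∀ {V : Type*} [Finite V] (G : SimpleGraph V) (k : ℕ),
      BABGraph.IsRDisjoint G → BABGraph.numOddCycles G = k →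
        (∃ (B : Set V) (P : Fin k → Set V), BABGraph.IsBAB G B P) ∧
        (BABGraph.kernel G).ncard + (BABGraph.corona G).ncard = 2 * G.indepNum + k) ∧
    (∀ k : ℕ, 1 ≤ k → ∃ (n : ℕ) (G : SimpleGraph (Fin n)),
      BABGraph.IsRDisjoint G ∧ BABGraph.numOddCycles G = k) := by
  refine ⟨fun G k B P h => ⟨h.ncard_kernel_add_ncard_corona_le, h.two_mul_indepNum_add⟩,
    fun G k hG hk => ?_, fun k hk => BABGraph.exists_isRDisjoint hk⟩
  obtain ⟨B, P, h, hodd⟩ := hG.exists_isBAB hk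
  exact ⟨⟨B, P, h⟩, h.ncard_kernel_add_ncard_corona_eq hodd⟩
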